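/- For $x,y\in\{0,1\}^q$ let $\mathrm{ham}(x,y)$ be the number of coordinates in which $x$ and $y$ differ. For a 0-1 matrix $A$ of size $p\times q$ and a 0-1 matrix $B$ of size $q\times r$, let $\lambda(A,\ell,row)$ be the minimum, over all choices of $\ell$ centers in $\{0,1\}^q$ (repetitions allowed), of the maximum Hamming distance between a row of $A$ and its closest center; let $\lambda(B,k,col)$ be the analogous minimum for the columns of $B$ and $k$ centers. For every constant $\alpha\ge 1$ there are a randomized algorithm (a single program for a unit-cost word RAM with words of $O(\log(p+q+r))$ bits, the operations $+,-,\times,\div$ on words, comparisons, indirect addressing and fair random bits) and a constant $K$ such that the following holds for all $p,q,r$, all $\ell\in[p]$ and $k\in[r]$, and all 0-1 matrices $A$ and $B$ of sizes $p\times q$ and $q\times r$. On input $p,q,r,\ell,k,A,B$ the algorithm always halts with the exact arithmetic matrix product of $A$ and $B$ in memory, and with probability at least $1-\frac{1}{(p+r)^{\alpha}}$ its running time is at most $$K\cdot\bigl(p\log p\,(q+\ell)+r\log r\,(q+k)+\ell qk+pr\,(1+\lambda(A,\ell,row)+\lambda(B,k,col))\bigr).$$ -/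

import Mathlib

/-! ## Clustering radii of 0-1 matrices

The Hamming space `{0,1}^d` is `Fin d → Bool` with Mathlib's `hammingDist`; a 0-1 matrix is a matrix
over `Bool`, read as a matrix of numbers through `Bool.toNat` (`false ↦ 0`, `true ↦ 1`). -/

/-- The optimal value of the `k`-center clustering problem for the points `P 0, …, P (n-1)` of the
Hamming space `{0,1}^d` (for `n, k ≥ 1`): the minimum, over all choices `T` of `k` centers in
`{0,1}^d`, of the maximum distance between a point and its closest center. -/
noncomputable def kCenterRadius {n d : ℕ} (P : Fin n → Fin d → Bool) (k : ℕ) : ℕ :=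
  ⨅ T : Fin k → Fin d → Bool, ⨆ v : Fin n, ⨅ u : Fin k, hammingDist (P v) (T u)

/-- `λ(A, ℓ, row)`: the optimal `ℓ`-center radius of the rows of `A`. -/
noncomputable def lambdaRow {p q : ℕ} (A : Matrix (Fin p) (Fin q) Bool) (l : ℕ) : ℕ :=
  kCenterRadius (fun i j => A i j) l

/-- `λ(B, k, col)`: the optimal `k`-center radius of the columns of `B`. -/
noncomputable def lambdaCol {q r : ℕ} (B : Matrix (Fin q) (Fin r) Bool) (k : ℕ) : ℕ :=
  kCenterRadius (fun j i => B i j) k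

/-- The arithmetic (natural-number) product of two 0-1 matrices. -/
def arithProduct {p q r : ℕ} (A : Matrix (Fin p) (Fin q) Bool) (B : Matrix (Fin q) (Fin r) Bool) :
    Matrix (Fin p) (Fin r) ℕ :=
  A.map Bool.toNat * B.map Bool.toNat

/-! ## A randomized word RAM

Registers and memory cells hold words of `w` bits. Every instruction costs one unit of time. -/

/-- The arithmetic operations of the machine. -/
inductive ArithOp where
  | add | sub | mul | div

/-- The result of an operation on words of `w` bits: sums and products are reduced modulo `2 ^ w`,
subtraction is truncated at `0`, and `div` rounds down. -/
def ArithOp.apply (w : ℕ) : ArithOp → ℕ → ℕ → ℕ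
  | .add, a, b => (a + b) % 2 ^ w
  | .sub, a, b => (a - b) % 2 ^ w
  | .mul, a, b => (a * b) % 2 ^ w
  | .div, a, b => (a / b) % 2 ^ w

/-- The instructions; `d a b` are register numbers. -/
inductive Instr where
  /-- `R d := n` -/
  | const (d n : ℕ)
  /-- `R d := R a op R b` -/
  | arith (op : ArithOp) (d a b : ℕ)
  /-- `R d := M[R a]` -/
  | load (d a : ℕ)
  /-- `M[R a] := R b` -/
  | store (a b : ℕ)
  /-- `R d :=` the next fair random bit -/
  | coin (d : ℕ)
  /-- if `R a < R b`, continue with instruction number `t` -/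
  | jumpLT (a b t : ℕ)

/-- A program is a finite list of instructions; it is the same for all inputs. -/
abbrev Program := List Instr

/-- A configuration of the machine. -/
structure Config where
  /-- the number of the instruction to be executed next -/
  pc : ℕ
  /-- the registers -/
  reg : ℕ → ℕ
  /-- the memory -/
  mem : ℕ → ℕ
  /-- how many random bits have been used so far -/
  used : ℕ

/-- The effect of one instruction, with word length `w` and the sequence `ω` of random bits. -/
def Instr.exec (w : ℕ) (ω : ℕ → Bool) (s : Config) : Instr → Config
  | .const d n => { s with pc := s.pc + 1, reg := Function.update s.reg d (n % 2 ^ w) }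
  | .arith op d a b =>
      { s with pc := s.pc + 1, reg := Function.update s.reg d (op.apply w (s.reg a) (s.reg b)) }
  | .load d a => { s with pc := s.pc + 1, reg := Function.update s.reg d (s.mem (s.reg a)) }
  | .store a b => { s with pc := s.pc + 1, mem := Function.update s.mem (s.reg a) (s.reg b) }
  | .coin d =>
      { s with pc := s.pc + 1, reg := Function.update s.reg d (ω s.used).toNat, used := s.used + 1 }
  | .jumpLT a b t => { s with pc := if s.reg a < s.reg b then t else s.pc + 1 }

/-- One step; the machine has halted, and stays as it is, when `pc` is outside the program. -/
def Program.step (P : Program) (w : ℕ) (ω : ℕ → Bool) (s : Config) : Config :=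
  match P[s.pc]? with
  | some i => i.exec w ω s
  | none => s

/-- The configuration after `t` steps from `s`. -/
def Program.run (P : Program) (w : ℕ) (ω : ℕ → Bool) (s : Config) (t : ℕ) : Config :=
  (P.step w ω)^[t] s

/-- The machine has halted in configuration `s`. -/
def Program.Halted (P : Program) (s : Config) : Prop := P.length ≤ s.pc

/-- The fair-coin measure on infinite sequences of independent random bits. -/
noncomputable def coinMeasure : MeasureTheory.Measure (ℕ → Bool) :=
  MeasureTheory.Measure.infinitePi fun _ => (PMF.uniformOfFintype Bool).toMeasure

/-! ## The matrix product problem on the machine -/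

/-- Words of `O(log (p + q + r))` bits: `c` times the length of `p + q + r` in binary. -/
def wordLength (c p q r : ℕ) : ℕ := c * Nat.size (p + q + r)

/-- The memory at the start: the entries of `A` row by row from address `0` on, then those of `B`
row by row, then zeros. -/
def inputMem {p q r : ℕ} (A : Matrix (Fin p) (Fin q) Bool) (B : Matrix (Fin q) (Fin r) Bool)
    (a : ℕ) : ℕ :=
  if h : a < p * q then (A (Fin.divNat ⟨a, h⟩) (Fin.modNat ⟨a, h⟩)).toNat
  else if h : a - p * q < q * r then
    (B (Fin.divNat ⟨a - p * q, h⟩) (Fin.modNat ⟨a - p * q, h⟩)).toNat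
  else 0

/-- The start configuration: registers `0, …, 4` hold `p, q, r, l, k`, the other ones `0`. -/
def inputConfig {p q r : ℕ} (A : Matrix (Fin p) (Fin q) Bool) (B : Matrix (Fin q) (Fin r) Bool)
    (l k : ℕ) : Config where
  pc := 0
  reg n := [p, q, r, l, k].getD n 0
  mem := inputMem A B
  used := 0

/-- The memory of `s` holds the matrix `D`, row by row, directly after the space of the input. -/
def HoldsOutput {p r : ℕ} (q : ℕ) (s : Config) (D : Matrix (Fin p) (Fin r) ℕ) : Prop :=
  ∀ (i : Fin p) (j : Fin r), s.mem (p * q + q * r + (i * r + j)) = D i j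

/-- The time bound, without the constant factor. -/
noncomputable def productTimeBound {p q r : ℕ} (A : Matrix (Fin p) (Fin q) Bool)
    (B : Matrix (Fin q) (Fin r) Bool) (l k : ℕ) : ℝ :=
  p * Real.log p * (q + l) + r * Real.log r * (q + k) + l * q * k
    + p * r * (1 + lambdaRow A l + lambdaCol B k)

set_option linter.unusedSimpArgs false

namespace WordRam

/-! ## A structured language for the word RAM -/

/-! Let `x`, `y` be points of the cube at Hamming distance `h`, and `c` a uniformly random point.
The difference of the distances of `c` to `x` and to `y` is a sum of `h` independent signs, so its
absolute value is typically of order `√h`. Take `m = C * τ` random points, with `τ` of the order of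
`log (p + r)`, and let the sketch of a point be the vector of its distances to them. The
`ℓ¹`-distance of two sketches then lies between `m√h / 40` and `2m√h`, except with probability
exponentially small in `m` (`card_lower_tail`, `card_upper_tail`). A union bound over all pairs of
rows of `A` and columns of `B` makes all these estimates good at once with the required probability
(`coinMeasure_exists_not_goodPair_le`, `failure_le`).

Rows and columns are clustered separately by farthest-point clustering on the sketches, where a
distance costs `m` instead of `q` steps. Besides a radius `R` this yields one point more than there
are centers, with pairwise estimates at least `R`. Two of these points share a center of an optimal
clustering of radius `Λ`, so their distance is at most `2Λ`; this bounds `R`, and then every point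
lies within `12800 * Λ` of its center (`FarthestPoint.hammingDist_le`). Neither symmetry nor a
triangle inequality is needed for the estimates.

For the product, all inner products of row centers with column centers are tabulated. If row `i` has
center `a` and column `j` has center `b`, then `i·j - a·b = (i - a)·j + a·(j - b)`. The two terms
only involve the positions where a point differs from its center, and these have been listed
beforehand (`dot_correction`). An entry thus costs a constant plus the lengths of two lists. The
identity holds for any choice of centers, so the output is right for every bit sequence
(`program_run`); chance only affects the running time.

The algorithm pays a factor `log (p + r)` throughout, while the claimed bound has `p log p` and `r
log r`; `log_mul_le` shows that the difference costs a constant factor. To reach the machine, the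
algorithm is written in a small structured language with a clock. `wp_sound` transfers
postconditions and step counts to the compiled code, and `wp_mainStmt` analyses the algorithm. -/

/-- The exact value of an arithmetic operation. -/
def opVal : ArithOp → ℕ → ℕ → ℕ
  | .add, a, b => a + b
  | .sub, a, b => a - b
  | .mul, a, b => a * b
  | .div, a, b => a / b

lemma apply_eq_opVal {w : ℕ} {o : ArithOp} {a b : ℕ} (h : opVal o a b < 2 ^ w) :
    o.apply w a b = opVal o a b := by
  cases o <;> exact Nat.mod_eq_of_lt h

/-- A structured state: variables, arrays, the number of coins used, and a clock. -/
structure St where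
  /-- the variables -/
  var : ℕ → ℕ
  /-- the arrays -/
  arr : ℕ → ℕ → ℕ
  /-- the number of coins used -/
  used : ℕ
  /-- the clock -/
  time : ℕ

/-- Expressions. -/
inductive Ex where
  /-- a literal -/
  | lit (n : ℕ)
  /-- a variable -/
  | var (x : ℕ)
  /-- an arithmetic operation -/
  | op (o : ArithOp) (a b : Ex)
  /-- an array element -/
  | ld (a : ℕ) (i : Ex)

/-- Statements. -/
inductive Stmt where
  /-- assignment to a variable -/
  | set (x : ℕ) (e : Ex)
  /-- assignment to an array element -/
  | st (a : ℕ) (i v : Ex)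
  /-- a random bit -/
  | coin (x : ℕ)
  /-- sequential composition -/
  | seq (c d : Stmt)
  /-- if `e < f` then `c` -/
  | cond (e f : Ex) (c : Stmt)
  /-- for `x` from `0` up to but excluding the value of variable `y` -/
  | loop (x y : ℕ) (c : Stmt)

/-! ### Placing nineteen arrays in a single memory -/

/-- The memory layout: arrays `0, 1, 2` are contiguous and separated by `b1, b2, W`, the other ones
are interleaved after `W`; `L` bounds the indices of the latter and all values. -/
structure Layout where
  /-- word length -/
  w : ℕ
  /-- end of array `0` -/
  b1 : ℕ
  /-- end of array `1` -/
  b2 : ℕ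
  /-- end of array `2` -/
  W : ℕ
  /-- the bound for values -/
  L : ℕ

/-- The conditions on the memory layout. -/
structure Layout.Ok (Γ : Layout) : Prop where
  h1 : Γ.b1 ≤ Γ.b2
  h2 : Γ.b2 ≤ Γ.W
  h3 : 16 * Γ.L + Γ.W + 16 ≤ 2 ^ Γ.w
  h4 : 100 ≤ Γ.L

/-- The number of valid indices of an array. -/
def Layout.lim (Γ : Layout) (a : ℕ) : ℕ :=
  if a = 0 then Γ.b1 else if a = 1 then Γ.b2 - Γ.b1 else if a = 2 then Γ.W - Γ.b2 else Γ.L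

/-- The register with the base address of an array. -/
def baseReg (a : ℕ) : ℕ := if a = 0 then 40 else if a = 1 then 42 else if a = 2 then 43 else 44

/-- The base address of an array. -/
def Layout.base (Γ : Layout) (a : ℕ) : ℕ :=
  if a = 0 then 0 else if a = 1 then Γ.b1 else if a = 2 then Γ.b2 else Γ.W

/-- The distance of consecutive array elements. -/
def stride (a : ℕ) : ℕ := if a < 3 then 1 else 16

/-- The offset of an array from its base. -/
def offs (a : ℕ) : ℕ := if a < 3 then 0 else a - 3

/-- The address of an array element. -/
def Layout.addr (Γ : Layout) (a i : ℕ) : ℕ := i * stride a + offs a + Γ.base a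

/-- Arrays `0, 1, 2` occupy consecutive intervals. Beyond them, array `a` uses the addresses that
are congruent to `a - 3` modulo `16` relative to `W`, and `a < 19` keeps these residues distinct. -/
lemma Layout.Ok.addr_inj {Γ : Layout} (h : Γ.Ok) {a i a' i' : ℕ} (ha : a < 19) (ha' : a' < 19)
    (hi : i < Γ.lim a) (hi' : i' < Γ.lim a') (e : Γ.addr a i = Γ.addr a' i') :
    a = a' ∧ i = i' := by
  have := h.h1
  have := h.h2
  unfold Layout.lim at hi hi'
  unfold Layout.addr stride offs Layout.base at e
  split_ifs at * <;> omega

lemma Layout.Ok.addr_lt {Γ : Layout} (h : Γ.Ok) {a i : ℕ} (ha : a < 19)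
    (hi : i < Γ.lim a) : i * stride a + offs a + Γ.base a < 2 ^ Γ.w := by
  have := h.h1
  have := h.h2
  have := h.h3
  unfold Layout.lim at hi
  unfold stride offs Layout.base
  split_ifs at * <;> omega

/-- The value of an expression. -/
def Ex.eval (s : St) : Ex → ℕ
  | .lit n => n
  | .var x => s.var x
  | .op o a b => opVal o (a.eval s) (b.eval s)
  | .ld a i => s.arr a (i.eval s)

/-- The evaluation of an expression stays within the bounds. -/
def Ex.ok (Γ : Layout) (s : St) : Ex → Prop
  | .lit n => n < Γ.L
  | .var x => x < 40 ∧ s.var x < Γ.L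
  | .op o a b => a.ok Γ s ∧ b.ok Γ s ∧ opVal o (a.eval s) (b.eval s) < Γ.L
  | .ld a i => a < 19 ∧ i.ok Γ s ∧ i.eval s < Γ.lim a

/-- The number of steps for an expression. -/
def Ex.cost : Ex → ℕ
  | .lit _ => 1
  | .var _ => 1
  | .op _ a b => a.cost + b.cost + 1
  | .ld _ i => i.cost + 6

/-- Code that turns the index in register `d` into an address. -/
def addrCode (a d : ℕ) : List Instr :=
  [.const (d + 1) (stride a), .arith .mul d d (d + 1), .const (d + 1) (offs a),
    .arith .add d d (d + 1), .arith .add d d (baseReg a)]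

/-- Code that puts the value of an expression into register `d`. -/
def Ex.code : Ex → ℕ → List Instr
  | .lit n, d => [.const d n]
  | .var x, d => [.arith .add d x 40]
  | .op o a b, d => a.code d ++ b.code (d + 1) ++ [.arith o d d (d + 1)]
  | .ld a i, d => i.code d ++ addrCode a d ++ [.load d d]

lemma Ex.length_code (e : Ex) : ∀ d, (e.code d).length = e.cost := by
  induction e with
  | lit n => intro d; rfl
  | var x => intro d; rfl
  | op o a b iha ihb => intro d; simp [Ex.code, Ex.cost, iha, ihb, Nat.add_assoc]
  | ld a i ih => intro d; simp [Ex.code, Ex.cost, ih, addrCode]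

/-- The code of a statement at offset `o`. -/
def Stmt.code : Stmt → ℕ → List Instr
  | .set x e, _ => e.code 50 ++ [.arith .add x 50 40]
  | .st a i v, _ => i.code 50 ++ addrCode a 50 ++ v.code 51 ++ [.store 50 51]
  | .coin x, _ => [.coin x]
  | .seq c d, o => c.code o ++ d.code (o + (c.code o).length)
  | .cond e f c, o =>
      let o' := o + (e.cost + f.cost + 2)
      e.code 50 ++ f.code 51 ++ [.jumpLT 50 51 o', .jumpLT 40 41 (o' + (c.code o').length)] ++
        c.code o'
  | .loop x y c, o =>
      [.const x 0, .jumpLT x y (o + 3), .jumpLT 40 41 (o + 3 + (c.code (o + 3)).length + 2)] ++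
        c.code (o + 3) ++ [.arith .add x x 41, .jumpLT 40 41 (o + 1)]

/-- Assignment to a variable that takes `t` steps. -/
def St.setVar (s : St) (x v t : ℕ) : St :=
  { s with var := Function.update s.var x v, time := s.time + t }

/-- Assignment to an array element that takes `t` steps. -/
def St.setArr (s : St) (a i v t : ℕ) : St :=
  { s with arr := Function.update s.arr a (Function.update (s.arr a) i v), time := s.time + t }

/-- Waiting. -/
def St.tick (s : St) (t : ℕ) : St := { s with time := s.time + t }

/-- Weakest preconditions; loops require an invariant. -/
def wp (Γ : Layout) (ω : ℕ → Bool) : Stmt → (St → Prop) → St → Prop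
  | .set x e, Q, s => x < 40 ∧ e.ok Γ s ∧ e.eval s < Γ.L ∧ Q (s.setVar x (e.eval s) (e.cost + 1))
  | .st a i v, Q, s => a < 19 ∧ i.ok Γ s ∧ v.ok Γ s ∧ i.eval s < Γ.lim a ∧
      Q (s.setArr a (i.eval s) (v.eval s) (i.cost + v.cost + 6))
  | .coin x, Q, s => x < 40 ∧
      Q { s.setVar x (ω s.used).toNat 1 with used := s.used + 1 }
  | .seq c d, Q, s => wp Γ ω c (wp Γ ω d Q) s
  | .cond e f c, Q, s => e.ok Γ s ∧ f.ok Γ s ∧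
      (e.eval s < f.eval s → wp Γ ω c Q (s.tick (e.cost + f.cost + 1))) ∧
      (¬ e.eval s < f.eval s → Q (s.tick (e.cost + f.cost + 2)))
  -- The clock charges 1 for the initialization, 1 for a successful test, 2 for the increment with
  -- the jump back, and 2 for the failed test with the jump to the exit.
  | .loop x y c, Q, s => ∃ I : ℕ → St → Prop, x < 40 ∧ y < 40 ∧ x ≠ y ∧ s.var y < Γ.L ∧
      I 0 (s.setVar x 0 1) ∧
      (∀ i s', i < s.var y → s'.var x = i → s'.var y = s.var y → I i s' →
        wp Γ ω c (fun s'' => s''.var x = i ∧ s''.var y = s.var y ∧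
          I (i + 1) (s''.setVar x (i + 1) 2)) (s'.tick 1)) ∧
      ∀ s', s'.var x = s.var y → s'.var y = s.var y → I (s.var y) s' → Q (s'.tick 2)

lemma wp_mono {Γ : Layout} {ω : ℕ → Bool} {c : Stmt} : ∀ {Q Q' : St → Prop} {s : St},
    wp Γ ω c Q s → (∀ s', Q s' → Q' s') → wp Γ ω c Q' s := by
  induction c with
  | set x e => exact fun h k => ⟨h.1, h.2.1, h.2.2.1, k _ h.2.2.2⟩
  | st a i v => exact fun h k => ⟨h.1, h.2.1, h.2.2.1, h.2.2.2.1, k _ h.2.2.2.2⟩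
  | coin x => exact fun h k => ⟨h.1, k _ h.2⟩
  | seq c d ihc ihd => exact fun h k => ihc h fun s' h' => ihd h' k
  | cond e f c ih =>
    exact fun h k => ⟨h.1, h.2.1, fun h' => ih (h.2.2.1 h') k, fun h' => k _ (h.2.2.2 h')⟩
  | loop x y c ih =>
    rintro Q Q' s ⟨I, h1, h2, h3, h4, h5, h6, h7⟩ k
    exact ⟨I, h1, h2, h3, h4, h5, h6, fun s' a b c => k _ (h7 s' a b c)⟩

/-! ### Frame conditions for statements and loops -/

/-- The variables that a statement may change. -/
def Stmt.vars : Stmt → List ℕ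
  | .set x _ => [x]
  | .st _ _ _ => []
  | .coin x => [x]
  | .seq c d => c.vars ++ d.vars
  | .cond _ _ c => c.vars
  | .loop x _ c => x :: c.vars

/-- The arrays that a statement may change. -/
def Stmt.arrs : Stmt → List ℕ
  | .set _ _ => []
  | .st a _ _ => [a]
  | .coin _ => []
  | .seq c d => c.arrs ++ d.arrs
  | .cond _ _ c => c.arrs
  | .loop _ _ c => c.arrs

/-- `s'` differs from `s` only in what `c` may change. -/
structure Frame (c : Stmt) (s s' : St) : Prop where
  var : ∀ x, x ∉ c.vars → s'.var x = s.var x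
  arr : ∀ a, a ∉ c.arrs → s'.arr a = s.arr a

/-- Strengthening a postcondition by the frame condition. -/
lemma wp_frame_aux {Γ : Layout} {ω : ℕ → Bool} {c : Stmt} :
    ∀ {Q : St → Prop} {s s₀ : St} {V A : List ℕ}, (∀ x ∈ c.vars, x ∈ V) → (∀ x ∈ c.arrs, x ∈ A) →
    (∀ x, x ∉ V → s.var x = s₀.var x) → (∀ x, x ∉ A → s.arr x = s₀.arr x) →
    wp Γ ω c Q s → wp Γ ω c (fun s' => Q s' ∧
      (∀ x, x ∉ V → s'.var x = s₀.var x) ∧ (∀ x, x ∉ A → s'.arr x = s₀.arr x)) s := by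
  induction c with
  | set x e =>
    refine fun hV hA hv ha h => ⟨h.1, h.2.1, h.2.2.1, h.2.2.2, fun z hz => ?_, ha⟩
    have : z ≠ x := fun e => hz (hV z (by simp [Stmt.vars, e]))
    simp [St.setVar, this, hv z hz]
  | st a i v =>
    refine fun hV hA hv ha h => ⟨h.1, h.2.1, h.2.2.1, h.2.2.2.1, h.2.2.2.2, hv, fun z hz => ?_⟩
    have : z ≠ a := fun e => hz (hA z (by simp [Stmt.arrs, e]))
    simp [St.setArr, this, ha z hz]
  | coin x =>
    refine fun hV hA hv ha h => ⟨h.1, h.2, fun z hz => ?_, ha⟩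
    have : z ≠ x := fun e => hz (hV z (by simp [Stmt.vars, e]))
    simp [St.setVar, this, hv z hz]
  | seq c d ihc ihd =>
    intro Q s s₀ V A hV hA hv ha h
    simp only [Stmt.vars, Stmt.arrs, List.mem_append] at hV hA
    refine wp_mono (c := c)
      (ihc (fun x hx => hV x (.inl hx)) (fun x hx => hA x (.inl hx)) hv ha h) ?_
    rintro s' ⟨h1, h2, h3⟩
    exact ihd (fun x hx => hV x (.inr hx)) (fun x hx => hA x (.inr hx)) h2 h3 h1
  | cond e f c ih =>
    exact fun hV hA hv ha h => ⟨h.1, h.2.1, fun h' => ih hV hA hv ha (h.2.2.1 h'),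
      fun h' => ⟨h.2.2.2 h', hv, ha⟩⟩
  | loop x y c ih =>
    rintro Q s s₀ V A hV hA hv ha ⟨I, h1, h2, h3, h4, h5, h6, h7⟩
    simp only [Stmt.vars, Stmt.arrs, List.mem_cons] at hV hA
    have key : ∀ s' : St, (∀ z, z ∉ V → s'.var z = s₀.var z) → ∀ v t z, z ∉ V →
        (s'.setVar x v t).var z = s₀.var z := by
      intro s' hs v t z hz
      have : z ≠ x := fun e => hz (hV z (.inl e))
      simp [St.setVar, this, hs z hz]
    -- `V`, `A` and the reference state `s₀` stay fixed during the induction, so the frame condition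
    -- can simply be conjoined to the given invariant.
    refine ⟨fun i s' => I i s' ∧ (∀ x, x ∉ V → s'.var x = s₀.var x) ∧
      (∀ x, x ∉ A → s'.arr x = s₀.arr x), h1, h2, h3, h4, ⟨h5, key s hv _ _, ha⟩, ?_, ?_⟩
    · rintro i s' hi hx hy ⟨hI, hv', ha'⟩
      refine wp_mono (ih (fun x hx => hV x (.inr hx)) hA (s := s'.tick 1) hv' ha'
        (h6 i s' hi hx hy hI)) ?_
      rintro s'' ⟨⟨a1, a2, a3⟩, a4, a5⟩
      exact ⟨a1, a2, a3, key s'' a4 _ _, a5⟩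
    · rintro s' hx hy ⟨hI, hv', ha'⟩
      exact ⟨h7 s' hx hy hI, hv', ha'⟩

lemma wp_frame {Γ : Layout} {ω : ℕ → Bool} {c : Stmt} {Q : St → Prop} {s : St}
    (h : wp Γ ω c Q s) : wp Γ ω c (fun s' => Q s' ∧ Frame c s s') s :=
  wp_mono (wp_frame_aux (fun _ h => h) (fun _ h => h) (fun _ _ => rfl) (fun _ _ => rfl) h)
    fun _ h => ⟨h.1, h.2.1, h.2.2⟩

/-- The loop rule, with the frame condition built into the invariant. -/
lemma wp_loop {Γ : Layout} {ω : ℕ → Bool} {x y : ℕ} {c : Stmt} {Q : St → Prop} {s : St}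
    (I : ℕ → St → Prop) (hx : x < 40) (hy : y < 40) (hxy : x ≠ y) (hxc : x ∉ c.vars)
    (hyc : y ∉ c.vars) (n : ℕ) (hn : s.var y = n) (hL : n < Γ.L) (h0 : I 0 (s.setVar x 0 1))
    (hs : ∀ i s', i < n → s'.var x = i → Frame (.loop x y c) s s' → I i s' →
      wp Γ ω c (fun s'' => I (i + 1) (s''.setVar x (i + 1) 2)) (s'.tick 1))
    (hQ : ∀ s', Frame (.loop x y c) s s' → I n s' → Q (s'.tick 2)) :
    wp Γ ω (.loop x y c) Q s := by
  subst hn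
  refine ⟨fun i s' => I i s' ∧ Frame (.loop x y c) s s', hx, hy, hxy, hL, ⟨h0, ?_, ?_⟩, ?_,
    fun s' _ _ h => hQ s' h.2 h.1⟩
  · intro z hz
    simp only [Stmt.vars, List.mem_cons, not_or] at hz
    simp [St.setVar, hz.1]
  · intro z hz
    rfl
  · rintro i s' hi hx hy ⟨hI, hF⟩
    refine wp_mono (wp_frame (hs i s' hi hx hF hI)) ?_
    rintro s'' ⟨h1, h2⟩
    refine ⟨(h2.var x hxc).trans hx, (h2.var y hyc).trans hy, h1, fun z hz => ?_, fun z hz => ?_⟩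
    · have hz' := hz
      simp only [Stmt.vars, List.mem_cons, not_or] at hz'
      simp only [St.setVar, Function.update_of_ne hz'.1]
      exact (h2.var z hz'.2).trans (hF.var z hz)
    · exact (h2.arr z hz).trans (hF.arr z hz)

/-! ## Correctness of the compiler -/

/-- The program contains the code `c` at offset `o`. -/
def CodeAt (P : Program) (o : ℕ) (c : List Instr) : Prop :=
  ∃ pre post, P = pre ++ c ++ post ∧ pre.length = o

lemma CodeAt.left {P : Program} {o : ℕ} {a b : List Instr} (h : CodeAt P o (a ++ b)) :
    CodeAt P o a := by
  obtain ⟨pre, post, rfl, rfl⟩ := h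
  exact ⟨pre, b ++ post, by simp, rfl⟩

lemma CodeAt.right {P : Program} {o : ℕ} {a b : List Instr} (h : CodeAt P o (a ++ b)) :
    CodeAt P (o + a.length) b := by
  obtain ⟨pre, post, rfl, rfl⟩ := h
  exact ⟨pre ++ a, post, by simp, by simp⟩

lemma CodeAt.tail {P : Program} {o : ℕ} {i : Instr} {b : List Instr} (h : CodeAt P o (i :: b)) :
    CodeAt P (o + 1) b :=
  CodeAt.right (a := [i]) h

lemma CodeAt.step {P : Program} {o : ℕ} {i : Instr} {b : List Instr} (h : CodeAt P o (i :: b))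
    {w : ℕ} {ω : ℕ → Bool} {s : Config} (hs : s.pc = o) : P.step w ω s = i.exec w ω s := by
  obtain ⟨pre, post, rfl, rfl⟩ := h
  simp [Program.step, hs]

lemma run_add (P : Program) (w : ℕ) (ω : ℕ → Bool) (s : Config) (a b : ℕ) :
    P.run w ω s (a + b) = P.run w ω (P.run w ω s a) b := by
  unfold Program.run
  rw [Nat.add_comm, Function.iterate_add_apply]

lemma run_one (P : Program) (w : ℕ) (ω : ℕ → Bool) (s : Config) :
    P.run w ω s 1 = P.step w ω s := rfl

/-- The configuration `s` of the machine represents the structured state `σ`. -/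
structure Rel (Γ : Layout) (s : Config) (σ : St) : Prop where
  var : ∀ x, x < 40 → s.reg x = σ.var x
  zero : s.reg 40 = 0
  one : s.reg 41 = 1
  b1 : s.reg 42 = Γ.b1
  b2 : s.reg 43 = Γ.b2
  W : s.reg 44 = Γ.W
  arr : ∀ a i, a < 19 → i < Γ.lim a → s.mem (Γ.addr a i) = σ.arr a i
  used : s.used = σ.used

lemma Rel.base {Γ : Layout} {s : Config} {σ : St} (h : Rel Γ s σ) (a : ℕ) :
    s.reg (baseReg a) = Γ.base a := by
  unfold baseReg Layout.base
  split_ifs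
  exacts [h.zero, h.b1, h.b2, h.W]

/-- Running `t` steps puts `v` into register `d`, changes no lower register, and moves `t` forward. -/
def Evals (P : Program) (w : ℕ) (ω : ℕ → Bool) (s : Config) (t d v : ℕ) : Prop :=
  ∃ s', P.run w ω s t = s' ∧ s'.pc = s.pc + t ∧ s'.reg d = v ∧ (∀ x < d, s'.reg x = s.reg x) ∧
    s'.mem = s.mem ∧ s'.used = s.used

lemma Rel.of_eq {Γ : Layout} {s s' : Config} {σ : St} (h : Rel Γ s σ)
    (hr : ∀ x < 50, s'.reg x = s.reg x) (hm : s'.mem = s.mem) (hu : s'.used = s.used) :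
    Rel Γ s' σ where
  var x hx := (hr x (by omega)).trans (h.var x hx)
  zero := (hr _ (by omega)).trans h.zero
  one := (hr _ (by omega)).trans h.one
  b1 := (hr _ (by omega)).trans h.b1
  b2 := (hr _ (by omega)).trans h.b2
  W := (hr _ (by omega)).trans h.W
  arr a i ha hi := by rw [hm]; exact h.arr a i ha hi
  used := hu.trans h.used

/-- Only `d` and `d + 1` are overwritten, and `50 ≤ d` protects the base registers `40`, …, `44`. No
reduction modulo `2 ^ w` takes effect, since every intermediate value is at most the final address.
-/
lemma addrCode_evals {Γ : Layout} (hΓ : Γ.Ok) {P : Program} {ω : ℕ → Bool} {o a d i : ℕ}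
    {s : Config} {σ : St} (hc : CodeAt P o (addrCode a d)) (hs : s.pc = o) (hR : Rel Γ s σ)
    (hd : 50 ≤ d) (ha : a < 19) (hi : i < Γ.lim a) (hv : s.reg d = i) :
    Evals P Γ.w ω s 5 d (Γ.addr a i) := by
  have hb := hΓ.addr_lt ha hi
  have h16 := hΓ.h3
  have hL := hΓ.h4
  have hst : stride a < 2 ^ Γ.w := by unfold stride; split_ifs <;> omega
  have hof : offs a < 2 ^ Γ.w := by unfold offs; split_ifs <;> omega
  have hbr : baseReg a < 45 := by unfold baseReg; split_ifs <;> omega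
  have c0 := hc
  have c1 := c0.tail
  have c2 := c1.tail
  have c3 := c2.tail
  have c4 := c3.tail
  refine ⟨_, rfl, ?_⟩
  have e1 : P.run Γ.w ω s 5 = P.step Γ.w ω (P.step Γ.w ω (P.step Γ.w ω (P.step Γ.w ω
    (P.step Γ.w ω s)))) := rfl
  have t1 := c0.step (w := Γ.w) (ω := ω) hs
  have t2 := c1.step (w := Γ.w) (ω := ω) (congrArg Config.pc t1 |>.trans (by simp [Instr.exec, hs]))
  have t3 := c2.step (w := Γ.w) (ω := ω) (congrArg Config.pc t2 |>.trans (by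
    rw [t1]; simp [Instr.exec, hs]))
  have t4 := c3.step (w := Γ.w) (ω := ω) (congrArg Config.pc t3 |>.trans (by
    rw [t2, t1]; simp [Instr.exec, hs]))
  have t5 := c4.step (w := Γ.w) (ω := ω) (congrArg Config.pc t4 |>.trans (by
    rw [t3, t2, t1]; simp [Instr.exec, hs]))
  rw [e1, t5, t4, t3, t2, t1]
  have ne : baseReg a ≠ d := by omega
  have ne' : baseReg a ≠ d + 1 := by omega
  have m1 : (i * stride a) % 2 ^ Γ.w = i * stride a := Nat.mod_eq_of_lt (by omega)
  have m2 : (i * stride a + offs a) % 2 ^ Γ.w = i * stride a + offs a := Nat.mod_eq_of_lt (by omega)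
  refine ⟨by simp [Instr.exec], ?_, ?_, by simp [Instr.exec], by simp [Instr.exec]⟩
  · simp [Instr.exec, ArithOp.apply, hv, Nat.mod_eq_of_lt hst, Nat.mod_eq_of_lt hof,
      ne, ne', hR.base, m1, m2, Nat.mod_eq_of_lt hb, Layout.addr]
  · intro x hx
    have : x ≠ d := by omega
    have : x ≠ d + 1 := by omega
    simp [Instr.exec, *]

/-- The registers from `d` on form a stack: evaluating the second operand into `d + 1` leaves the
first one in `d` intact, because `Evals` preserves all lower registers. Registers below `50`, which
hold the represented state, are never touched. -/
lemma Ex.ok.evals {Γ : Layout} (hΓ : Γ.Ok) {P : Program} {ω : ℕ → Bool} {σ : St} {e : Ex} :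
    ∀ {d o : ℕ} {s : Config}, CodeAt P o (e.code d) → s.pc = o → Rel Γ s σ → e.ok Γ σ → 50 ≤ d →
      Evals P Γ.w ω s e.cost d (e.eval σ) := by
  have h16 := hΓ.h3
  have hM : Γ.L ≤ 2 ^ Γ.w := by omega
  induction e with
  | lit n =>
    intro d o s hc hs hR hok hd
    have hok' : n < Γ.L := hok
    refine ⟨_, (run_one _ _ _ _).trans (hc.step hs), rfl, ?_, ?_, rfl, rfl⟩
    · simp [Instr.exec, Ex.eval, Nat.mod_eq_of_lt (hok'.trans_le hM)]
    · intro x hx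
      have : x ≠ d := by omega
      simp [Instr.exec, this]
  | var x =>
    intro d o s hc hs hR hok hd
    have hlt := hok.2.trans_le hM
    refine ⟨_, (run_one _ _ _ _).trans (hc.step hs), rfl, ?_, ?_, rfl, rfl⟩
    · simp [Instr.exec, Ex.eval, ArithOp.apply, hR.var x hok.1, hR.zero, Nat.mod_eq_of_lt hlt]
    · intro x hx
      have : x ≠ d := by omega
      simp [Instr.exec, this]
  | op o' a b iha ihb =>
    intro d o s hc hs hR hok hd
    obtain ⟨ok1, ok2, ok3⟩ := hok
    obtain ⟨s1, r1, p1, v1, f1, m1, u1⟩ := iha hc.left.left hs hR ok1 hd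
    have c2 := hc.left.right
    rw [Ex.length_code] at c2
    obtain ⟨s2, r2, p2, v2, f2, m2, u2⟩ := ihb c2 (by omega)
      (hR.of_eq (fun x hx => f1 x (by omega)) m1 u1) ok2 (by omega)
    have c3 := hc.right
    rw [List.length_append, Ex.length_code, Ex.length_code] at c3
    refine ⟨(Instr.arith o' d d (d + 1)).exec Γ.w ω s2, ?_, ?_, ?_, ?_, ?_, ?_⟩
    · rw [Ex.cost, run_add, run_add, r1, r2, run_one, c3.step (by omega)]
    · simp only [Instr.exec, Ex.cost]; omega
    · have e1 : s2.reg d = a.eval σ := (f2 d (by omega)).trans v1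
      simp [Instr.exec, Ex.eval, e1, v2, apply_eq_opVal (ok3.trans_le hM)]
    · intro x hx
      have : x ≠ d := by omega
      simp [Instr.exec, this, f2 x (by omega), f1 x hx]
    · exact m2.trans m1
    · exact u2.trans u1
  | ld a i ih =>
    intro d o s hc hs hR hok hd
    obtain ⟨ok1, ok2, ok3⟩ := hok
    obtain ⟨s1, r1, p1, v1, f1, m1, u1⟩ := ih hc.left.left hs hR ok2 hd
    have c2 := hc.left.right
    rw [Ex.length_code] at c2
    obtain ⟨s2, r2, p2, v2, f2, m2, u2⟩ := addrCode_evals (ω := ω) hΓ c2 (by omega)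
      (hR.of_eq (fun x hx => f1 x (by omega)) m1 u1) hd ok1 ok3 v1
    have c3 := hc.right
    rw [List.length_append, Ex.length_code] at c3
    refine ⟨(Instr.load d d).exec Γ.w ω s2, ?_, ?_, ?_, ?_, ?_, ?_⟩
    · rw [Ex.cost, show i.cost + 6 = i.cost + 5 + 1 from rfl, run_add, run_add, r1, r2, run_one,
        c3.step (by simp [addrCode]; omega)]
    · simp only [Instr.exec, Ex.cost]; omega
    · simp only [Instr.exec, Ex.eval, v2, Function.update_self, m2, m1]
      exact hR.arr _ _ ok1 ok3
    · intro x hx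
      have : x ≠ d := by omega
      simp [Instr.exec, this, f2 x (by omega), f1 x hx]
    · exact m2.trans m1
    · exact u2.trans u1

lemma Rel.setVar {Γ : Layout} {s : Config} {σ : St} (h : Rel Γ s σ) {x : ℕ} (hx : x < 40)
    (v t pc : ℕ) :
    Rel Γ { s with pc := pc, reg := Function.update s.reg x v } (σ.setVar x v t) := by
  constructor
  · intro z hz
    by_cases e : z = x
    · simp [St.setVar, e]
    · simp [St.setVar, e, h.var z hz]
  all_goals first
    | (simp only; rw [Function.update_of_ne (by omega)]
       first | exact h.zero | exact h.one | exact h.b1 | exact h.b2 | exact h.W)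
    | exact h.arr
    | exact h.used

lemma Rel.setPc {Γ : Layout} {s : Config} {σ : St} (h : Rel Γ s σ) (t pc : ℕ) :
    Rel Γ { s with pc := pc } (σ.tick t) :=
  ⟨h.1, h.2, h.3, h.4, h.5, h.6, h.7, h.8⟩

/-- The compiled code does what the weakest precondition says, in the time that the clock shows. -/
theorem wp_sound {Γ : Layout} (hΓ : Γ.Ok) {P : Program} {ω : ℕ → Bool} {c : Stmt} :
    ∀ {Q : St → Prop} {o : ℕ} {s : Config} {σ : St}, CodeAt P o (c.code o) → s.pc = o → Rel Γ s σ →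
      wp Γ ω c Q σ → ∃ σ' t, Q σ' ∧ σ'.time = σ.time + t ∧ Rel Γ (P.run Γ.w ω s t) σ' ∧
        (P.run Γ.w ω s t).pc = o + (c.code o).length := by
  have h16 := hΓ.h3
  have hM : Γ.L < 2 ^ Γ.w := by omega
  induction c with
  | set x e =>
    rintro Q o s σ hc hs hR ⟨hx, hok, hlt, hQ⟩
    obtain ⟨s1, r1, p1, v1, f1, m1, u1⟩ := hok.evals (ω := ω) hΓ hc.left hs hR le_rfl
    have c2 := hc.right
    rw [Ex.length_code] at c2
    refine ⟨_, e.cost + 1, hQ, rfl, ?_⟩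
    have hR1 := hR.of_eq f1 m1 u1
    rw [run_add, r1, run_one, c2.step (by omega)]
    refine ⟨?_, ?_⟩
    · have := hR1.setVar hx (e.eval σ) (e.cost + 1) (s1.pc + 1)
      simp only [Instr.exec, ArithOp.apply, v1, hR1.zero, add_zero]
      rwa [Nat.mod_eq_of_lt (hlt.trans hM)]
    · simp only [Instr.exec, Stmt.code, List.length_append, Ex.length_code, List.length_singleton]
      omega
  | st a i v =>
    rintro Q o s σ hc hs hR ⟨ha, hoki, hokv, hlim, hQ⟩
    obtain ⟨s1, r1, p1, v1, f1, m1, u1⟩ := hoki.evals (ω := ω) hΓ hc.left.left.left hs hR le_rfl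
    have c2 := hc.left.left.right
    rw [Ex.length_code] at c2
    have hR1 := hR.of_eq f1 m1 u1
    obtain ⟨s2, r2, p2, v2, f2, m2, u2⟩ := addrCode_evals (ω := ω) hΓ c2 (by omega)
      hR1 le_rfl ha hlim v1
    have hR2 := hR1.of_eq f2 m2 u2
    have c3 := hc.left.right
    rw [List.length_append, Ex.length_code, show (addrCode a 50).length = 5 from rfl] at c3
    obtain ⟨s3, r3, p3, v3, f3, m3, u3⟩ := hokv.evals (ω := ω) hΓ c3 (by omega) hR2 (by omega)
    have hR3 := hR2.of_eq (fun x hx => f3 x (by omega)) m3 u3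
    have c4 := hc.right
    rw [List.length_append, List.length_append, Ex.length_code, Ex.length_code,
      show (addrCode a 50).length = 5 from rfl] at c4
    refine ⟨_, i.cost + v.cost + 6, hQ, rfl, ?_⟩
    rw [show i.cost + v.cost + 6 = i.cost + 5 + v.cost + 1 by omega, run_add, run_add, run_add,
      r1, r2, r3, run_one, c4.step (by omega)]
    refine ⟨⟨hR3.var, hR3.zero, hR3.one, hR3.b1, hR3.b2, hR3.W, ?_, hR3.used⟩, ?_⟩
    · intro a' i' ha' hi'
      simp only [Instr.exec, v3, f3 50 (by omega), v2, St.setArr]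
      -- Injectivity of the layout enters here: a store must leave every other represented array
      -- element unchanged.
      by_cases e : Γ.addr a' i' = Γ.addr a (i.eval σ)
      · obtain ⟨rfl, rfl⟩ := hΓ.addr_inj ha' ha hi' hlim e
        simp
      · rw [Function.update_of_ne e]
        have := hR3.arr a' i' ha' hi'
        by_cases e' : a' = a
        · subst e'
          rw [Function.update_self, Function.update_of_ne]
          · exact this
          · rintro rfl
            exact e rfl
        · rwa [Function.update_of_ne e']
    · simp only [Instr.exec, Stmt.code, List.length_append, Ex.length_code, List.length_singleton,
        show (addrCode a 50).length = 5 from rfl]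
      omega
  | coin x =>
    rintro Q o s σ hc hs hR ⟨hx, hQ⟩
    refine ⟨_, 1, hQ, rfl, ?_⟩
    rw [run_one, hc.step hs]
    have := hR.setVar hx (ω σ.used).toNat 1 (s.pc + 1)
    simp only [Instr.exec, hR.used]
    exact ⟨⟨this.var, this.zero, this.one, this.b1, this.b2, this.W, this.arr, rfl⟩,
      by simp [Stmt.code, hs]⟩
  | seq c d ihc ihd =>
    intro Q o s σ hc hs hR h
    obtain ⟨σ1, t1, h1, e1, R1, p1⟩ := ihc hc.left hs hR h
    obtain ⟨σ2, t2, h2, e2, R2, p2⟩ := ihd hc.right p1 R1 h1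
    refine ⟨σ2, t1 + t2, h2, by omega, ?_⟩
    rw [run_add]
    refine ⟨R2, p2.trans ?_⟩
    simp only [Stmt.code, List.length_append]
    omega
  | cond e f c ih =>
    rintro Q o s σ hc hs hR ⟨hok1, hok2, hT, hF⟩
    simp only [Stmt.code] at hc ⊢
    obtain ⟨o', ho'⟩ : ∃ o', o' = o + (e.cost + f.cost + 2) := ⟨_, rfl⟩
    rw [← ho'] at hc ⊢
    obtain ⟨s1, r1, p1, v1, f1, m1, u1⟩ := hok1.evals (ω := ω) hΓ hc.left.left.left hs hR le_rfl
    have c2 := hc.left.left.right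
    rw [Ex.length_code] at c2
    have hR1 := hR.of_eq f1 m1 u1
    obtain ⟨s2, r2, p2, v2, f2, m2, u2⟩ := hok2.evals (ω := ω) hΓ c2 (by omega) hR1 (by omega)
    have hR2 := hR1.of_eq (fun x hx => f2 x (by omega)) m2 u2
    have c3 := hc.left.right
    rw [List.length_append, Ex.length_code, Ex.length_code] at c3
    have st3 := c3.step (w := Γ.w) (ω := ω) (s := s2) (by omega)
    have v1' : s2.reg 50 = e.eval σ := (f2 50 (by omega)).trans v1
    simp only [Instr.exec, v2, v1'] at st3
    have c5 := hc.right
    simp only [List.length_append, Ex.length_code, List.length_cons, List.length_nil] at c5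
    by_cases hlt : e.eval σ < f.eval σ
    · rw [if_pos hlt] at st3
      obtain ⟨σ', t, q1, q2, q3, q4⟩ := ih (o := o')
        (by convert c5 using 1) rfl (hR2.setPc (e.cost + f.cost + 1) _) (hT hlt)
      refine ⟨σ', e.cost + f.cost + 1 + t, q1, ?_, ?_⟩
      · rw [q2]; simp only [St.tick]; omega
      · rw [run_add, run_add, run_add, r1, r2, run_one, st3]
        refine ⟨q3, q4.trans ?_⟩
        simp only [List.length_append, Ex.length_code, List.length_cons, List.length_nil]
        omega
    · rw [if_neg hlt] at st3
      refine ⟨_, e.cost + f.cost + 2, hF hlt, rfl, ?_⟩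
      rw [show e.cost + f.cost + 2 = e.cost + f.cost + 1 + 1 from rfl, run_add, run_add, run_add,
        r1, r2, run_one, run_one, st3, c3.tail.step (by simp only; omega)]
      simp only [Instr.exec, hR2.zero, hR2.one, zero_lt_one, if_true]
      refine ⟨hR2.setPc _ _, ?_⟩
      simp only [List.length_append, Ex.length_code, List.length_cons, List.length_nil]
      omega
  | loop x y c ih =>
    rintro Q o s σ hc hs hR ⟨I, hx, hy, hxy, hL, h0, hI, hQ⟩
    simp only [Stmt.code] at hc ⊢
    have c0 := hc.left.left
    have c1 := c0.tail
    have c2 := c1.tail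
    have c3 : CodeAt P (o + 3) (c.code (o + 3)) := hc.left.right
    have c4 := hc.right
    simp only [List.length_append, List.length_cons, List.length_nil] at c4
    have c5 := c4.tail
    set len := (c.code (o + 3)).length with hlen
    -- After `j` passes the machine stands at the loop test, which is the instruction at `o + 1`.
    have iter : ∀ j, j ≤ σ.var y → ∃ σ' t, I j σ' ∧ σ'.var x = j ∧ σ'.var y = σ.var y ∧
        σ'.time = σ.time + t ∧ Rel Γ (P.run Γ.w ω s t) σ' ∧ (P.run Γ.w ω s t).pc = o + 1 := by
      intro j
      induction j with
      | zero =>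
        intro _
        refine ⟨_, 1, h0, by simp [St.setVar], by simp [St.setVar, hxy.symm], rfl, ?_⟩
        rw [run_one, c0.step hs]
        simp only [Instr.exec, Nat.zero_mod]
        exact ⟨hR.setVar hx _ _ _, by omega⟩
      | succ j ihj =>
        intro hj
        obtain ⟨σ1, t1, a1, a2, a3, a4, a5, a6⟩ := ihj (by omega)
        have st1 := c1.step (w := Γ.w) (ω := ω) a6
        simp only [Instr.exec] at st1
        rw [a5.var x hx, a5.var y hy, a2, a3, if_pos (by omega)] at st1
        obtain ⟨σ2, t2, b1, b2, b3, b4⟩ := ih (o := o + 3) c3 rfl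
          (a5.setPc 1 (o + 3)) (hI j σ1 (by omega) a2 a3 a1)
        refine ⟨_, t1 + 1 + t2 + 1 + 1, b1.2.2, by simp [St.setVar],
          by simpa [St.setVar, hxy.symm] using b1.2.1, ?_, ?_⟩
        · simp only [St.setVar, b2, St.tick, a4]; omega
        · rw [run_add, run_add, run_add, run_add, run_one, run_one, run_one, st1]
          have st2 := c4.step (w := Γ.w) (ω := ω) (b4.trans (by omega))
          rw [st2]
          simp only [Instr.exec, b3.one, b3.var x hx, b1.1, ArithOp.apply]
          rw [Nat.mod_eq_of_lt (by omega)]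
          have R2 := b3.setVar hx (j + 1) 2 (o + 1)
          rw [c5.step (by simp only [b4]; omega)]
          have R2z : Function.update (P.run Γ.w ω { P.run Γ.w ω s t1 with pc := o + 3 } t2).reg
            x (j + 1) 40 = 0 := R2.zero
          have R2o : Function.update (P.run Γ.w ω { P.run Γ.w ω s t1 with pc := o + 3 } t2).reg
            x (j + 1) 41 = 1 := R2.one
          simp only [Instr.exec, R2z, R2o, zero_lt_one, if_true]
          exact ⟨R2, trivial⟩
    obtain ⟨σ1, t1, a1, a2, a3, a4, a5, a6⟩ := iter _ le_rfl
    refine ⟨_, t1 + 1 + 1, hQ σ1 a2 a3 a1, by simp only [St.tick, a4]; omega, ?_⟩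
    rw [run_add, run_add, run_one, run_one, c1.step a6]
    simp only [Instr.exec]
    rw [a5.var x hx, a5.var y hy, a2, a3, if_neg (by omega), c2.step (by simp only; omega)]
    simp only [Instr.exec, a5.zero, a5.one, zero_lt_one, if_true]
    refine ⟨a5.setPc _ _, ?_⟩
    simp only [List.length_append, List.length_cons, List.length_nil]
    omega

/-! ## Rules for symbolic execution -/

/-- sum -/
infixl:65 " +ₑ " => Ex.op ArithOp.add
/-- difference -/
infixl:65 " -ₑ " => Ex.op ArithOp.sub
/-- product -/
infixl:70 " *ₑ " => Ex.op ArithOp.mul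
/-- quotient -/
infixl:70 " /ₑ " => Ex.op ArithOp.div
/-- sequential composition -/
infixr:30 " ;; " => Stmt.seq

@[simp] lemma setVar_var (s : St) (x v t z : ℕ) :
    (s.setVar x v t).var z = if z = x then v else s.var z := by
  simp [St.setVar, Function.update_apply]

@[simp] lemma setVar_arr (s : St) (x v t : ℕ) : (s.setVar x v t).arr = s.arr := rfl
@[simp] lemma setVar_used (s : St) (x v t : ℕ) : (s.setVar x v t).used = s.used := rfl
@[simp] lemma setVar_time (s : St) (x v t : ℕ) : (s.setVar x v t).time = s.time + t := rfl
@[simp] lemma setArr_var (s : St) (a i v t : ℕ) : (s.setArr a i v t).var = s.var := rfl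

@[simp] lemma setArr_arr (s : St) (a i v t b : ℕ) :
    (s.setArr a i v t).arr b = if b = a then Function.update (s.arr a) i v else s.arr b := by
  simp [St.setArr, Function.update_apply]

@[simp] lemma setArr_used (s : St) (a i v t : ℕ) : (s.setArr a i v t).used = s.used := rfl
@[simp] lemma setArr_time (s : St) (a i v t : ℕ) : (s.setArr a i v t).time = s.time + t := rfl
@[simp] lemma tick_var (s : St) (t : ℕ) : (s.tick t).var = s.var := rfl
@[simp] lemma tick_arr (s : St) (t : ℕ) : (s.tick t).arr = s.arr := rfl
@[simp] lemma tick_used (s : St) (t : ℕ) : (s.tick t).used = s.used := rfl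
@[simp] lemma tick_time (s : St) (t : ℕ) : (s.tick t).time = s.time + t := rfl

attribute [simp] Ex.ok Ex.eval Ex.cost opVal

section

variable {Γ : Layout} {ω : ℕ → Bool} {Q : St → Prop} {s : St}

@[simp] lemma wp_set {x : ℕ} {e : Ex} : wp Γ ω (.set x e) Q s ↔
    x < 40 ∧ e.ok Γ s ∧ e.eval s < Γ.L ∧ Q (s.setVar x (e.eval s) (e.cost + 1)) := Iff.rfl

@[simp] lemma wp_st {a : ℕ} {i v : Ex} : wp Γ ω (.st a i v) Q s ↔
    a < 19 ∧ i.ok Γ s ∧ v.ok Γ s ∧ i.eval s < Γ.lim a ∧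
      Q (s.setArr a (i.eval s) (v.eval s) (i.cost + v.cost + 6)) := Iff.rfl

@[simp] lemma wp_coin {x : ℕ} : wp Γ ω (.coin x) Q s ↔
    x < 40 ∧ Q { s.setVar x (ω s.used).toNat 1 with used := s.used + 1 } := Iff.rfl

@[simp] lemma wp_seq {c d : Stmt} : wp Γ ω (c ;; d) Q s ↔ wp Γ ω c (wp Γ ω d Q) s := Iff.rfl

@[simp] lemma wp_cond {e f : Ex} {c : Stmt} : wp Γ ω (.cond e f c) Q s ↔
    e.ok Γ s ∧ f.ok Γ s ∧
      (e.eval s < f.eval s → wp Γ ω c Q (s.tick (e.cost + f.cost + 1))) ∧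
      (¬ e.eval s < f.eval s → Q (s.tick (e.cost + f.cost + 2))) := Iff.rfl

end

/-! ### Rules for loops that tabulate a function or accumulate a sum -/

/-- A loop that fills the positions `o, …, o + n - 1` of an array with `f 0, …, f (n - 1)`. -/
lemma wp_tabulate {Γ : Layout} {ω : ℕ → Bool} {x y : ℕ} {c : Stmt} {s : St} (a o n : ℕ)
    (f τ : ℕ → ℕ) (hx : x < 40) (hy : y < 40) (hxy : x ≠ y) (hxc : x ∉ c.vars)
    (hyc : y ∉ c.vars) (hn : s.var y = n) (hL : n < Γ.L)
    (hc : ∀ i s', i < n → s'.var x = i → Frame (.loop x y c) s s' →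
      (∀ z, s'.arr a z = if o ≤ z ∧ z < o + i then f (z - o) else s.arr a z) →
      wp Γ ω c (fun s'' => s''.arr a = Function.update (s'.arr a) (o + i) (f i) ∧
        s''.time ≤ s'.time + τ i) s') :
    wp Γ ω (.loop x y c) (fun s' => (∀ z, s'.arr a z = if o ≤ z ∧ z < o + n then f (z - o)
      else s.arr a z) ∧ s'.time ≤ s.time + 3 + ∑ i ∈ Finset.range n, (τ i + 3)) s := by
  refine wp_loop (fun i s' =>
    (∀ z, s'.arr a z = if o ≤ z ∧ z < o + i then f (z - o) else s.arr a z) ∧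
      s'.time ≤ s.time + 1 + ∑ i ∈ Finset.range i, (τ i + 3)) hx hy hxy hxc hyc n hn hL ?_ ?_ ?_
  · refine ⟨fun z => ?_, by simp⟩
    rw [if_neg (by omega)]; rfl
  · rintro i s' hi hxi hF ⟨h1, h2⟩
    refine wp_mono (hc i (s'.tick 1) hi hxi ⟨hF.1, hF.2⟩ h1) ?_
    rintro s'' ⟨h3, h4⟩
    refine ⟨fun z => ?_, ?_⟩
    · simp only [setVar_arr, h3, tick_arr, Function.update_apply, h1]
      by_cases hz : z = o + i
      · subst hz
        simp
      · rw [if_neg hz]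
        congr 1
        exact propext ⟨fun _ => by omega, fun _ => by omega⟩
    · rw [Finset.sum_range_succ]
      simp only [setVar_time, tick_time] at *
      omega
  · rintro s' hF ⟨h1, h2⟩
    refine ⟨h1, ?_⟩
    simp only [tick_time]
    omega

/-- A loop that adds `f 0 + ⋯ + f (n - 1)` to a variable. -/
lemma wp_sum {Γ : Layout} {ω : ℕ → Bool} {x y acc : ℕ} {e : Ex} {s : St} (n : ℕ)
    (f : ℕ → ℕ) (hx : x < 40) (hy : y < 40) (hxy : x ≠ y) (hxa : x ≠ acc)
    (hya : y ≠ acc) (ha : acc < 40) (hn : s.var y = n) (hL : n < Γ.L)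
    (hS : s.var acc + ∑ i ∈ Finset.range n, f i < Γ.L)
    (hc : ∀ i s', i < n → s'.var x = i → (∀ z, z ≠ x → z ≠ acc → s'.var z = s.var z) →
      s'.arr = s.arr → e.ok Γ s' ∧ e.eval s' = f i) :
    wp Γ ω (.loop x y (.set acc (.var acc +ₑ e))) (fun s' =>
      s'.var acc = s.var acc + ∑ i ∈ Finset.range n, f i ∧
      (∀ z, z ≠ x → z ≠ acc → s'.var z = s.var z) ∧ s'.arr = s.arr ∧
      s'.time = s.time + 3 + n * (e.cost + 6)) s := by
  refine wp_loop (fun i s' => s'.var acc = s.var acc + ∑ i ∈ Finset.range i, f i ∧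
      (∀ z, z ≠ x → z ≠ acc → s'.var z = s.var z) ∧ s'.arr = s.arr ∧
      s'.time = s.time + 1 + i * (e.cost + 6)) hx hy hxy (by simpa [Stmt.vars])
      (by simpa [Stmt.vars]) n hn hL ?_ ?_ ?_
  · refine ⟨by simp [hxa.symm], fun z hz _ => by simp [hz], rfl, by simp⟩
  · rintro i s' hi hxi hF ⟨h1, h2, h3, h4⟩
    obtain ⟨k1, k2⟩ := hc i (s'.tick 1) hi hxi h2 h3
    have hle : ∑ i ∈ Finset.range (i + 1), f i ≤ ∑ i ∈ Finset.range n, f i :=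
      Finset.sum_le_sum_of_subset (by simpa using hi)
    rw [Finset.sum_range_succ] at hle
    simp only [wp_set, Ex.ok, Ex.eval, opVal, tick_var, k2, h1]
    refine ⟨ha, ⟨⟨ha, by omega⟩, k1, by omega⟩, by omega, ?_, ?_, h3, ?_⟩
    · rw [Finset.sum_range_succ]
      simp [hxa.symm, add_assoc]
    · intro z hz hz'
      simp [hz, hz', h2 z hz hz']
    · simp only [setVar_time, tick_time, h4, Ex.cost]
      ring
  · rintro s' hF ⟨h1, h2, h3, h4⟩
    refine ⟨h1, h2, h3, ?_⟩
    simp only [tick_time, h4]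
    ring

/-! ## Preparing the points and their sketches -/

/-- Variable `6` becomes the number of points, and `5` becomes `C` times its logarithm. -/
def sizeStmt (C : ℕ) : Stmt :=
  .set 6 (.var 0 +ₑ .var 2) ;; .set 9 (.lit 1) ;; .set 5 (.lit 0) ;;
  .loop 7 6 (.cond (.var 9) (.var 6)
    (.set 9 (.var 9 +ₑ .var 9) ;; .set 5 (.var 5 +ₑ .lit C)))

/-- All loops are counted, so the doubling is tried `p + r` times and simply idles once the power is
large enough. In the invariant either every pass has doubled, `τ = i`, or the target is reached; at
the end the first case also suffices because `n ≤ 2 ^ n`. -/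
lemma wp_sizeStmt {Γ : Layout} {ω : ℕ → Bool} {s : St} {C p r : ℕ} (hp : s.var 0 = p)
    (hr : s.var 2 = r) (h1 : 1 ≤ p) (hL : 2 * (p + r) + 2 < Γ.L) (hC : C * (p + r) < Γ.L)
    (hC' : C < Γ.L) :
    wp Γ ω (sizeStmt C) (fun s' => (∃ τ, s'.var 5 = C * τ ∧ p + r ≤ 2 ^ τ ∧
      2 ^ τ < 2 * (p + r)) ∧ s'.var 6 = p + r ∧ s'.used = s.used ∧
      s'.time ≤ s.time + 20 + (p + r) * 15) s := by
  unfold sizeStmt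
  simp only [wp_seq, wp_set, Ex.ok, Ex.eval, opVal, Ex.cost, setVar_var, hp, hr]
  refine ⟨by omega, ⟨⟨by omega, by omega⟩, ⟨by omega, by omega⟩, by omega⟩, by omega, by omega,
    by omega, by omega, by omega, by omega, by omega, ?_⟩
  refine wp_loop (fun i s' => (∃ τ ≤ i, s'.var 9 = 2 ^ τ ∧ s'.var 5 = C * τ ∧
    2 ^ τ < 2 * (p + r) ∧ (τ = i ∨ p + r ≤ 2 ^ τ)) ∧ s'.var 6 = p + r ∧ s'.used = s.used ∧
    s'.time ≤ s.time + 12 + i * 15) (by omega) (by omega) (by omega) (by simp [Stmt.vars])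
    (by simp [Stmt.vars]) (p + r) (by simp) (by omega) ?_ ?_ ?_
  · refine ⟨⟨0, le_rfl, by simp, by simp, by simp; omega, by simp⟩, by simp, rfl, ?_⟩
    simp only [setVar_time]; omega
  · rintro i s' hi hxi hF ⟨⟨τ, hτ, h9, h5, hlt, hor⟩, h6, hu, ht⟩
    have hCτ : C * τ + C ≤ C * (p + r) := by
      rw [← Nat.mul_succ]; exact Nat.mul_le_mul_left _ (by omega)
    simp only [wp_cond, wp_seq, wp_set, Ex.ok, Ex.eval, opVal, Ex.cost, tick_var, setVar_var,
      h9, h6, h5, if_true, if_false, reduceCtorEq]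
    refine ⟨⟨by omega, by omega⟩, ⟨by omega, by omega⟩, fun h => ?_, fun h => ?_⟩
    · refine ⟨by omega, ⟨⟨by omega, by omega⟩, ⟨by omega, by omega⟩, by omega⟩, by omega,
        by omega, ?_⟩
      simp only [setVar_var, Nat.reduceEqDiff, if_false, h5, Nat.succ_ne_self]
      refine ⟨⟨⟨by omega, by omega⟩, by omega, by omega⟩, by omega,
        ⟨τ + 1, by omega, ?_, ?_, ?_, ?_⟩, ?_, hu, ?_⟩
      · simp [pow_succ, mul_two]
      · simp [mul_add]
      · rw [pow_succ]; omega
      · rcases hor with rfl | h'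
        · exact .inl rfl
        · omega
      · simp [h6]
      · simp only [setVar_time, tick_time]; omega
    · refine ⟨⟨τ, by omega, by simp [h9], by simp [h5], hlt, .inr (by omega)⟩, by simp [h6], hu, ?_⟩
      simp only [setVar_time, tick_time]; omega
  · rintro s' hF ⟨⟨τ, hτ, h9, h5, hlt, hor⟩, h6, hu, ht⟩
    refine ⟨⟨τ, h5, ?_, hlt⟩, h6, hu, ?_⟩
    · rcases hor with rfl | h'
      · exact Nat.lt_two_pow_self.le
      · exact h'
    · simp only [tick_time]; omega

/-- Array `4` is filled with random bits. -/
def coinsStmt : Stmt :=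
  .set 8 (.var 5 *ₑ .var 1) ;; .loop 7 8 (.coin 9 ;; .st 4 (.var 7) (.var 9))

/-- Since no bit has been used before, cell `z` receives exactly `ω z`. This ties the sketches to a
fixed initial segment of the random sequence. -/
lemma wp_coinsStmt {Γ : Layout} {ω : ℕ → Bool} {s : St} {m q : ℕ} (hm : s.var 5 = m)
    (hq : s.var 1 = q) (hu : s.used = 0) (hmL : m < Γ.L) (hqL : q < Γ.L) (hL : m * q < Γ.L)
    (hL2 : 2 < Γ.L) :
    wp Γ ω coinsStmt (fun s' => (∀ z < m * q, s'.arr 4 z = (ω z).toNat) ∧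
      s'.time ≤ s.time + 10 + m * q * 15) s := by
  unfold coinsStmt
  simp only [wp_seq, wp_set, Ex.ok, Ex.eval, opVal, Ex.cost, hm, hq]
  refine ⟨by omega, ⟨⟨by omega, by omega⟩, ⟨by omega, by omega⟩, by omega⟩, by omega, ?_⟩
  refine wp_loop (fun i s' => (∀ z < i, s'.arr 4 z = (ω z).toNat) ∧ s'.used = i ∧
    s'.time ≤ s.time + 5 + i * 15) (by omega) (by omega) (by omega) (by simp [Stmt.vars])
    (by simp [Stmt.vars]) (m * q) (by simp) hL ?_ ?_ ?_
  · exact ⟨by simp, hu, by simp only [setVar_time]; omega⟩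
  · rintro i s' hi hxi hF ⟨h1, h2, h3⟩
    have hb : (ω i).toNat < Γ.L := (Bool.toNat_lt _).trans hL2
    have hlim : Γ.lim 4 = Γ.L := rfl
    simp only [wp_seq, wp_coin, wp_st, Ex.ok, Ex.eval, opVal, Ex.cost, tick_var, tick_used,
      setVar_var, h2, hxi, if_true, Nat.reduceEqDiff, if_false, hlim]
    refine ⟨by omega, by omega, ⟨by omega, by omega⟩, ⟨by omega, hb⟩, by omega, ?_, rfl, ?_⟩
    · intro z hz
      simp only [setVar_arr, setArr_arr, if_true, Function.update_apply]
      split_ifs with hzi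
      · rw [hzi]
      · exact h1 z (by omega)
    · simp only [setVar_time, setArr_time, tick_time]; omega
  · rintro s' hF ⟨h1, h2, h3⟩
    refine ⟨h1, ?_⟩
    simp only [tick_time]; omega

/-- The rows of the first matrix and the columns of the second one are put into array `3`. -/
def pointsStmt : Stmt :=
  .set 8 (.var 0 *ₑ .var 1) ;; .loop 7 8 (.st 3 (.var 7) (.ld 0 (.var 7))) ;;
  .set 30 (.var 0 *ₑ .var 1) ;; .set 8 (.var 2 *ₑ .var 1) ;;
  .loop 7 8 (.set 9 (.var 7 /ₑ .var 1) ;; .set 10 (.var 7 -ₑ .var 9 *ₑ .var 1) ;;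
    .st 3 (.var 30 +ₑ .var 7) (.ld 1 (.var 10 *ₑ .var 2 +ₑ .var 9)))

lemma add_mul_lt {i j n m : ℕ} (hi : i < n) (hj : j < m) : i * m + j < n * m := by
  calc i * m + j < i * m + m := by omega
    _ = (i + 1) * m := by ring
    _ ≤ n * m := Nat.mul_le_mul_right _ hi

lemma div_mod_lt {t n m : ℕ} (h : t < n * m) :
    t / m < n ∧ t % m < m ∧ t / m * m + t % m = t ∧ t - t / m * m = t % m := by
  have hm : 0 < m := Nat.pos_of_ne_zero fun e => by simp [e] at h
  have := Nat.div_add_mod t m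
  rw [Nat.mul_comm] at this
  exact ⟨Nat.div_lt_of_lt_mul (by rwa [Nat.mul_comm]), Nat.mod_lt _ hm, this, by omega⟩

/-- The second matrix is transposed on the way: target position `t` of its part belongs to column `t
/ q` and row `t % q`. From here on rows and columns are alike, each a contiguous block of `q` cells.
-/
lemma wp_pointsStmt {Γ : Layout} {ω : ℕ → Bool} {s : St} {p q r : ℕ} (hp : s.var 0 = p)
    (hq : s.var 1 = q) (hr : s.var 2 = r) (hpL : p < Γ.L) (hqL : q < Γ.L) (hrL : r < Γ.L)
    (hL : p * q + r * q + r < Γ.L) (h0 : Γ.lim 0 = p * q) (h1 : Γ.lim 1 = q * r) :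
    wp Γ ω pointsStmt (fun s' => (∀ v < p, ∀ j < q, s'.arr 3 (v * q + j) = s.arr 0 (v * q + j)) ∧
      (∀ v < r, ∀ j < q, s'.arr 3 ((p + v) * q + j) = s.arr 1 (j * r + v)) ∧
      s'.time ≤ s.time + 40 + (p + r) * q * 50) s := by
  have hlim : Γ.lim 3 = Γ.L := rfl
  unfold pointsStmt
  simp only [wp_seq, wp_set, Ex.ok, Ex.eval, opVal, Ex.cost, hp, hq, hr]
  refine ⟨by omega, ⟨⟨by omega, by omega⟩, ⟨by omega, by omega⟩, by omega⟩, by omega, ?_⟩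
  refine wp_mono (wp_frame (wp_tabulate 3 0 (p * q) (fun z => s.arr 0 z) (fun _ => 20)
    (by omega) (by omega) (by omega) (by simp [Stmt.vars]) (by simp [Stmt.vars]) (by simp)
    (by omega) ?_)) ?_
  · intro i s' hi hxi hF h3
    have e0 : s'.arr 0 = s.arr 0 := hF.arr 0 (by simp [Stmt.arrs])
    simp only [wp_st, Ex.ok, Ex.eval, Ex.cost, hxi, h0, hlim, e0, setArr_arr, if_true, zero_add,
      setArr_time]
    refine ⟨by omega, ⟨by omega, by omega⟩, ⟨by omega, ⟨by omega, by omega⟩, hi⟩, by omega, trivial,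
      by omega⟩
  rintro s1 ⟨⟨h3, ht⟩, hF⟩
  have e0 : s1.var 0 = p := (hF.var 0 (by simp [Stmt.vars])).trans (by simp [hp])
  have e1 : s1.var 1 = q := (hF.var 1 (by simp [Stmt.vars])).trans (by simp [hq])
  have e2 : s1.var 2 = r := (hF.var 2 (by simp [Stmt.vars])).trans (by simp [hr])
  have a1 : s1.arr 1 = s.arr 1 := hF.arr 1 (by simp [Stmt.arrs])
  simp only [wp_seq, wp_set, Ex.ok, Ex.eval, opVal, Ex.cost, e0, e1, e2, setVar_var,
    Nat.reduceEqDiff, if_false]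
  refine ⟨by omega, ⟨⟨by omega, by omega⟩, ⟨by omega, by omega⟩, by omega⟩, by omega, by omega,
    ⟨⟨by omega, ?_⟩, ⟨by omega, ?_⟩, by omega⟩, by omega, ?_⟩
  · simp [e2, hrL]
  · simp [e1, hqL]
  refine wp_mono (wp_tabulate 3 (p * q) (r * q) (fun z => s.arr 1 (z % q * r + z / q))
    (fun _ => 45) (by omega) (by omega) (by omega) (by simp [Stmt.vars]) (by simp [Stmt.vars])
    (by simp [e1, e2]) (by omega) ?_) ?_
  · intro i s' hi hxi hF' h3'
    have f1 : s'.var 1 = q := (hF'.var 1 (by simp [Stmt.vars])).trans (by simp [e1])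
    have f2 : s'.var 2 = r := (hF'.var 2 (by simp [Stmt.vars])).trans (by simp [e2])
    have f30 : s'.var 30 = p * q := (hF'.var 30 (by simp [Stmt.vars])).trans (by simp)
    have b1 : s'.arr 1 = s.arr 1 := (hF'.arr 1 (by simp [Stmt.arrs])).trans a1
    obtain ⟨d1, d2, d3, d4⟩ := div_mod_lt hi
    have d5 := add_mul_lt d2 d1
    have : q * r = r * q := mul_comm _ _
    have : i % q * r ≤ q * r := Nat.mul_le_mul_right _ d2.le
    simp only [wp_seq, wp_set, wp_st, Ex.ok, Ex.eval, opVal, Ex.cost, hxi, h1, hlim, b1, setVar_var,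
      f1, f2, f30, d4, setArr_arr, if_true, setVar_arr, Nat.reduceEqDiff,
      if_false, setArr_time, setVar_time, OfNat.ofNat_ne_one]
    refine ⟨by omega, ⟨⟨by omega, by omega⟩, ⟨by omega, by omega⟩, by omega⟩, by omega, by omega,
      ⟨⟨by omega, by omega⟩, ⟨⟨by omega, by omega⟩, ⟨by omega, ?_⟩, by omega⟩, by omega⟩, by omega,
      by omega, ⟨⟨by omega, by omega⟩, ⟨by omega, by omega⟩, by omega⟩,
      ⟨by omega, ⟨⟨⟨by omega, by omega⟩, ⟨by omega, ?_⟩, by omega⟩, ⟨by omega, by omega⟩, by omega⟩,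
        by omega⟩, by omega, trivial, by omega⟩
    · simp [f1, hqL]
    · simp [f2, hrL]
  · rintro s2 ⟨h3', ht'⟩
    simp only [setVar_arr, setVar_time, Finset.sum_const, Finset.card_range, smul_eq_mul] at *
    refine ⟨fun v hv j hj => ?_, fun v hv j hj => ?_, ?_⟩
    · have := add_mul_lt hv hj
      rw [h3', if_neg (by omega), h3, if_pos (by omega), Nat.sub_zero]
    · have := add_mul_lt hv hj
      have hq0 : 0 < q := by omega
      have ev : (v * q + j) / q = v := by
        rw [mul_comm, Nat.mul_add_div hq0, Nat.div_eq_of_lt hj, add_zero]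
      have em : (v * q + j) % q = j := by
        rw [mul_comm, Nat.mul_add_mod, Nat.mod_eq_of_lt hj]
      rw [h3', add_mul, if_pos (by omega), show p * q + v * q + j - p * q = v * q + j by omega,
        ev, em]
    · have : (p + r) * q * 50 = p * q * 50 + r * q * 50 := by ring
      omega

/-- The absolute difference, by truncated subtraction. -/
def absDiff (a b : ℕ) : ℕ := (a - b) + (b - a)

/-- The absolute difference of two expressions. -/
def exDiff (a b : Ex) : Ex := (a -ₑ b) +ₑ (b -ₑ a)

/-- Array `5` is filled with the distances of the points to the random points. -/
def sketchStmt : Stmt :=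
  .set 8 (.var 6 *ₑ .var 5) ;;
  .loop 7 8 (
    .set 9 (.var 7 /ₑ .var 5) ;; .set 10 ((.var 7 -ₑ .var 9 *ₑ .var 5) *ₑ .var 1) ;;
    .set 9 (.var 9 *ₑ .var 1) ;; .set 12 (.lit 0) ;;
    .loop 11 1 (.set 12 (.var 12 +ₑ
      exDiff (.ld 4 (.var 10 +ₑ .var 11)) (.ld 3 (.var 9 +ₑ .var 11)))) ;;
    .st 5 (.var 7) (.var 12))

/-- The distance of point `v` in array `x` to point `i` in array `b`. -/
def sketch (x b : ℕ → ℕ) (q v i : ℕ) : ℕ :=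
  ∑ j ∈ Finset.range q, absDiff (b (i * q + j)) (x (v * q + j))

lemma absDiff_le_one {a b : ℕ} (ha : a ≤ 1) (hb : b ≤ 1) : absDiff a b ≤ 1 := by
  unfold absDiff; omega

lemma sum_range_le {f : ℕ → ℕ} {n c : ℕ} (h : ∀ i < n, f i ≤ c) :
    ∑ i ∈ Finset.range n, f i ≤ n * c := by
  simpa using Finset.sum_le_card_nsmul (Finset.range n) f c (by simpa using h)

/-- One counted loop runs over all pairs of a point and a random point, decoded by division. Each
entry is a sum of `q` terms that are at most `1`, so it fits into a word. -/
lemma wp_sketchStmt {Γ : Layout} {ω : ℕ → Bool} {s : St} {m n q : ℕ} (hm : s.var 5 = m)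
    (hn : s.var 6 = n) (hq : s.var 1 = q) (hmL : m < Γ.L) (hqL : q + 2 < Γ.L) (hnL : n < Γ.L)
    (hL : n * m < Γ.L) (hL1 : m * q < Γ.L) (hL2 : n * q < Γ.L)
    (hx : ∀ v < n, ∀ j < q, s.arr 3 (v * q + j) ≤ 1)
    (hb : ∀ v < m, ∀ j < q, s.arr 4 (v * q + j) ≤ 1) :
    wp Γ ω sketchStmt (fun s' => (∀ v < n, ∀ i < m, s'.arr 5 (v * m + i) =
      sketch (s.arr 3) (s.arr 4) q v i) ∧ s'.time ≤ s.time + 10 + n * m * (70 + q * 50)) s := by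
  have hlim3 : Γ.lim 3 = Γ.L := rfl
  have hlim4 : Γ.lim 4 = Γ.L := rfl
  have hlim5 : Γ.lim 5 = Γ.L := rfl
  unfold sketchStmt
  simp only [wp_seq, wp_set, Ex.ok, Ex.eval, opVal, Ex.cost, hm, hn]
  refine ⟨by omega, ⟨⟨by omega, by omega⟩, ⟨by omega, by omega⟩, by omega⟩, by omega, ?_⟩
  refine wp_mono (wp_tabulate 5 0 (n * m) (fun z => sketch (s.arr 3) (s.arr 4) q (z / m) (z % m))
    (fun _ => 65 + q * 50)
    (by omega) (by omega) (by omega) (by simp [Stmt.vars]) (by simp [Stmt.vars]) (by simp)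
    (by omega) ?_) ?_
  · intro t s' ht hxt hF h5
    have e1 : s'.var 1 = q := (hF.var 1 (by simp [Stmt.vars])).trans (by simp [hq])
    have e5 : s'.var 5 = m := (hF.var 5 (by simp [Stmt.vars])).trans (by simp [hm])
    have a3 : s'.arr 3 = s.arr 3 := hF.arr 3 (by simp [Stmt.arrs])
    have a4 : s'.arr 4 = s.arr 4 := hF.arr 4 (by simp [Stmt.arrs])
    obtain ⟨d1, d2, d3, d4⟩ := div_mod_lt ht
    have k1 : t / m * q ≤ n * q := Nat.mul_le_mul_right _ d1.le
    have k2 : t % m * q ≤ m * q := Nat.mul_le_mul_right _ d2.le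
    simp only [wp_seq, wp_set, Ex.ok, Ex.eval, opVal, Ex.cost, hxt, e1, e5, setVar_var, d4,
      if_true, OfNat.one_ne_ofNat, Nat.reduceEqDiff, if_false]
    refine ⟨by omega, ⟨⟨by omega, by omega⟩, ⟨by omega, by omega⟩, by omega⟩, by omega, by omega,
      ⟨⟨⟨by omega, by omega⟩, ⟨⟨by omega, by omega⟩, ⟨by omega, by omega⟩, by omega⟩, by omega⟩,
        ⟨by omega, by omega⟩, by omega⟩, by omega, by omega,
      ⟨⟨by omega, by omega⟩, ⟨by omega, by omega⟩, by omega⟩, by omega, by omega,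
      by omega, by omega, ?_⟩
    have hsk : sketch (s.arr 3) (s.arr 4) q (t / m) (t % m) ≤ q := by
      unfold sketch
      simpa using sum_range_le (c := 1) fun j hj =>
        absDiff_le_one (hb _ d2 j hj) (hx _ d1 j hj)
    refine wp_mono (wp_sum q (fun j => absDiff (s.arr 4 (t % m * q + j)) (s.arr 3 (t / m * q + j)))
      (by omega) (by omega) (by omega) (by omega) (by omega) (by omega) (by simp [e1])
      (by omega) ?_ ?_) ?_
    · simp only [setVar_var, if_true, zero_add]
      exact lt_of_le_of_lt hsk (by omega)
    · intro j s2 hj hxj hv ha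
      have v9 : s2.var 9 = t / m * q := (hv 9 (by omega) (by omega)).trans (by simp)
      have v10 : s2.var 10 = t % m * q := (hv 10 (by omega) (by omega)).trans (by simp)
      have := add_mul_lt d1 hj
      have := add_mul_lt d2 hj
      have := hb _ d2 j hj
      have := hx _ d1 j hj
      simp only [setVar_arr] at ha
      simp only [exDiff, Ex.ok, Ex.eval, opVal, v9, v10, hxj, ha, a3, a4, hlim3, hlim4, absDiff]
      refine ⟨?_, trivial⟩
      refine ⟨⟨⟨?_, ?_, ?_⟩, ⟨?_, ?_, ?_⟩, ?_⟩, ⟨⟨?_, ?_, ?_⟩, ⟨?_, ?_, ?_⟩, ?_⟩, ?_⟩ <;> omega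
    · rintro s2 ⟨h12, hv, ha, htm⟩
      have v7 : s2.var 7 = t := (hv 7 (by omega) (by omega)).trans (by simp [hxt])
      simp only [setVar_var, if_true, zero_add] at h12
      simp only [exDiff, setVar_time, Ex.cost] at htm
      have hs : ∑ j ∈ Finset.range q, absDiff (s.arr 4 (t % m * q + j)) (s.arr 3 (t / m * q + j))
        = sketch (s.arr 3) (s.arr 4) q (t / m) (t % m) := rfl
      simp only [wp_st, Ex.ok, Ex.eval, Ex.cost, v7, h12, hlim5, setArr_arr, setArr_time, if_true,
        ha, zero_add, setVar_arr, hs]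
      exact ⟨by omega, ⟨by omega, by omega⟩, ⟨by omega, by omega⟩, by omega, trivial, by omega⟩
  · rintro s2 ⟨h5, ht⟩
    simp only [setVar_time, Finset.sum_const, Finset.card_range, smul_eq_mul] at ht
    refine ⟨fun v hv i hi => ?_, ?_⟩
    · have := add_mul_lt hv hi
      have hm0 : 0 < m := by omega
      have ev : (v * m + i) / m = v := by
        rw [mul_comm, Nat.mul_add_div hm0, Nat.div_eq_of_lt hi, add_zero]
      have em : (v * m + i) % m = i := by
        rw [mul_comm, Nat.mul_add_mod, Nat.mod_eq_of_lt hi]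
      rw [h5, if_pos (by omega), Nat.sub_zero, ev, em]
    · have : n * m * (65 + q * 50 + 3) ≤ n * m * (70 + q * 50) := Nat.mul_le_mul_left _ (by omega)
      omega

/-! ## Farthest-point clustering -/

/-- The `ℓ¹`-distance of the sketches of points `u` and `v`. -/
def sketchDist (S : ℕ → ℕ) (m u v : ℕ) : ℕ :=
  ∑ i ∈ Finset.range m, absDiff (S (u * m + i)) (S (v * m + i))

/-- Updating array `6` (distance to the closest center) and array `7` (number of the closest
center) with a new center, and finding the point with the largest distance. -/
def scanStmt : Stmt :=
  .loop 7 21 (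
    .set 9 (.var 20 +ₑ .var 7) ;; .set 10 (.var 9 *ₑ .var 5) ;; .set 12 (.lit 0) ;;
    .loop 11 5 (.set 12 (.var 12 +ₑ
      exDiff (.ld 5 (.var 10 +ₑ .var 11)) (.ld 5 (.var 16 +ₑ .var 11)))) ;;
    .cond (.var 12) (.ld 6 (.var 9))
      (.st 6 (.var 9) (.var 12) ;; .st 7 (.var 9) (.var 22 +ₑ .var 27)) ;;
    .cond (.var 25) (.ld 6 (.var 9)) (.set 25 (.ld 6 (.var 9)) ;; .set 26 (.var 9)))

/-- A single pass both lowers the stored distances to account for the new center `far` and finds a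
maximizer of the lowered distances. This is sound because an entry of array `6` is final once its
point has been visited. -/
lemma wp_scanStmt {Γ : Layout} {ω : ℕ → Bool} {s : St} {m n q lo sz clo c far : ℕ}
    (h5 : s.var 5 = m) (h16 : s.var 16 = far * m) (h20 : s.var 20 = lo)
    (h21 : s.var 21 = sz) (h22 : s.var 22 = clo) (h25 : s.var 25 = 0) (h26 : s.var 26 = lo)
    (h27 : s.var 27 = c) (hmL : m < Γ.L) (hnL : n < Γ.L) (hL : n * m < Γ.L)
    (hqm : q * m + q + 1 < Γ.L) (hlo : lo + sz ≤ n) (hclo : clo + c < n) (hfar : far < n)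
    (hS : ∀ u < n, ∀ i < m, s.arr 5 (u * m + i) ≤ q)
    (hD : ∀ v < sz, s.arr 6 (lo + v) < Γ.L) (hsz : 1 ≤ sz) :
    wp Γ ω scanStmt (fun s' =>
      (∀ z, s'.arr 6 z = if lo ≤ z ∧ z < lo + sz then
        min (s.arr 6 z) (sketchDist (s.arr 5) m z far) else s.arr 6 z) ∧
      (∀ z, s'.arr 7 z = if lo ≤ z ∧ z < lo + sz ∧ sketchDist (s.arr 5) m z far < s.arr 6 z then
        clo + c else s.arr 7 z) ∧
      lo ≤ s'.var 26 ∧ s'.var 26 < lo + sz ∧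
      (∀ v < sz, s'.arr 6 (lo + v) ≤ s'.arr 6 (s'.var 26)) ∧
      s'.time ≤ s.time + 10 + sz * (100 + m * 60)) s := by
  have hlim5 : Γ.lim 5 = Γ.L := rfl
  have hlim6 : Γ.lim 6 = Γ.L := rfl
  have hlim7 : Γ.lim 7 = Γ.L := rfl
  unfold scanStmt
  refine wp_loop (fun i s' =>
    (∀ z, s'.arr 6 z = if lo ≤ z ∧ z < lo + i then
      min (s.arr 6 z) (sketchDist (s.arr 5) m z far) else s.arr 6 z) ∧
    (∀ z, s'.arr 7 z = if lo ≤ z ∧ z < lo + i ∧ sketchDist (s.arr 5) m z far < s.arr 6 z then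
      clo + c else s.arr 7 z) ∧
    -- The second alternative covers passes in which no positive distance has been seen: the strict
    -- comparison leaves the default candidate `lo` with maximum `0`.
    lo ≤ s'.var 26 ∧ (s'.var 26 < lo + i ∨ s'.var 25 = 0 ∧ s'.var 26 = lo) ∧
    s'.var 25 ≤ s'.arr 6 (s'.var 26) ∧ s'.var 25 < Γ.L ∧
    (∀ v < i, s'.arr 6 (lo + v) ≤ s'.var 25) ∧
    s'.time ≤ s.time + 5 + i * (100 + m * 60)) (by omega) (by omega) (by omega)
    (by simp [Stmt.vars]) (by simp [Stmt.vars]) sz h21 (by omega) ?_ ?_ ?_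
  · refine ⟨fun z => ?_, fun z => ?_, ?_, ?_, ?_, ?_, ?_, ?_⟩
    · rw [if_neg (by omega)]; rfl
    · rw [if_neg (by omega)]; rfl
    · simp [h26]
    · simp [h25, h26]
    · simp [h25]
    · simp [h25]; omega
    · simp
    · simp only [setVar_time]; omega
  · rintro i s' hi hxi hF ⟨k1, k2, k3, k4, k5, k6, k7, k8⟩
    have e5 : s'.var 5 = m := (hF.var 5 (by simp [Stmt.vars])).trans h5
    have e16 : s'.var 16 = far * m := (hF.var 16 (by simp [Stmt.vars])).trans h16
    have e20 : s'.var 20 = lo := (hF.var 20 (by simp [Stmt.vars])).trans h20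
    have e22 : s'.var 22 = clo := (hF.var 22 (by simp [Stmt.vars])).trans h22
    have e27 : s'.var 27 = c := (hF.var 27 (by simp [Stmt.vars])).trans h27
    have a5 : s'.arr 5 = s.arr 5 := hF.arr 5 (by simp [Stmt.arrs])
    have hv : lo + i < n := by omega
    have b1 : (lo + i) * m ≤ n * m := Nat.mul_le_mul_right _ hv.le
    have b2 : far * m ≤ n * m := Nat.mul_le_mul_right _ hfar.le
    have hd : sketchDist (s.arr 5) m (lo + i) far ≤ m * q := by
      refine sum_range_le fun j hj => ?_
      have := hS _ hv j hj
      have := hS _ hfar j hj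
      unfold absDiff; omega
    rw [mul_comm] at hd
    have hDi := hD i hi
    simp only [wp_seq, wp_set, Ex.ok, Ex.eval, opVal, Ex.cost, tick_var, setVar_var, hxi, e20, e5,
      if_true, Nat.reduceEqDiff, if_false]
    refine ⟨by omega, ⟨⟨by omega, by omega⟩, ⟨by omega, by omega⟩, by omega⟩, by omega, by omega,
      ⟨⟨by omega, by omega⟩, ⟨by omega, by omega⟩, by omega⟩, by omega, by omega, by omega,
      by omega, ?_⟩
    refine wp_mono (wp_sum m (fun j => absDiff (s.arr 5 ((lo + i) * m + j))
      (s.arr 5 (far * m + j))) (by omega) (by omega) (by omega) (by omega) (by omega) (by omega)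
      (by simp [e5]) (by omega) ?_ ?_) ?_
    · simp only [setVar_var, if_true, zero_add]
      exact lt_of_le_of_lt hd (by omega)
    · intro j s2 hj hxj hv' ha
      have v10 : s2.var 10 = (lo + i) * m := (hv' 10 (by omega) (by omega)).trans (by simp)
      have v16 : s2.var 16 = far * m := (hv' 16 (by omega) (by omega)).trans (by simp [e16])
      have := add_mul_lt hv hj
      have := add_mul_lt hfar hj
      have := hS _ hv j hj
      have := hS _ hfar j hj
      simp only [setVar_arr, tick_arr] at ha
      simp only [exDiff, Ex.ok, Ex.eval, opVal, v10, v16, hxj, ha, a5, hlim5, absDiff]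
      refine ⟨?_, trivial⟩
      refine ⟨⟨⟨?_, ?_, ?_⟩, ⟨?_, ?_, ?_⟩, ?_⟩, ⟨⟨?_, ?_, ?_⟩, ⟨?_, ?_, ?_⟩, ?_⟩, ?_⟩ <;> omega
    · rintro s2 ⟨h12, hv', ha, htm⟩
      simp only [setVar_var, if_true, zero_add] at h12
      change s2.var 12 = sketchDist (s.arr 5) m (lo + i) far at h12
      have v7 : s2.var 7 = i := (hv' 7 (by omega) (by omega)).trans (by simp [hxi])
      have v9 : s2.var 9 = lo + i := (hv' 9 (by omega) (by omega)).trans (by simp)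
      have v22 : s2.var 22 = clo := (hv' 22 (by omega) (by omega)).trans (by simp [e22])
      have v25 : s2.var 25 = s'.var 25 := (hv' 25 (by omega) (by omega)).trans (by simp)
      have v26 : s2.var 26 = s'.var 26 := (hv' 26 (by omega) (by omega)).trans (by simp)
      have v27 : s2.var 27 = c := (hv' 27 (by omega) (by omega)).trans (by simp [e27])
      simp only [exDiff, setVar_time, tick_time, Ex.cost] at htm
      simp only [setVar_arr, tick_arr] at ha
      have k1i := k1 (lo + i)
      rw [if_neg (by omega)] at k1i
      have k2i := k2 (lo + i)
      rw [if_neg (by omega)] at k2i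
      rw [wp_seq]
      -- Both branches of the first conditional are summarized by one formula with `min`, so that
      -- the search for the maximum is analysed only once.
      refine wp_mono (Q := fun s3 =>
        s3.arr 6 = Function.update (s'.arr 6) (lo + i)
          (min (s.arr 6 (lo + i)) (sketchDist (s.arr 5) m (lo + i) far)) ∧
        s3.arr 7 = Function.update (s'.arr 7) (lo + i)
          (if sketchDist (s.arr 5) m (lo + i) far < s.arr 6 (lo + i) then clo + c
            else s.arr 7 (lo + i)) ∧ s3.var = s2.var ∧ s3.time ≤ s2.time + 30) ?_ ?_
      · simp only [wp_cond, wp_seq, wp_st, Ex.ok, Ex.eval, opVal, Ex.cost, tick_var, tick_arr,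
          setArr_var, v9, h12, v22, v27, ha, hlim6, hlim7, setArr_arr, setArr_time, tick_time, k1i,
          if_true, Nat.reduceEqDiff, if_false]
        refine ⟨⟨by omega, by omega⟩, ⟨by omega, ⟨by omega, by omega⟩, by omega⟩, fun hlt => ?_,
          fun hlt => ?_⟩
        · rw [min_eq_right hlt.le, if_pos hlt]
          exact ⟨by omega, ⟨by omega, by omega⟩, ⟨by omega, by omega⟩, by omega, by omega,
            ⟨by omega, by omega⟩, ⟨⟨by omega, by omega⟩, ⟨by omega, by omega⟩, by omega⟩,
            by omega, rfl, rfl, trivial, by omega⟩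
        · rw [min_eq_left (by omega), if_neg hlt, ← k1i, ← k2i]
          simp [Function.update_eq_self, v9, h12]
      · rintro s3 ⟨w6, w7, wv, wt⟩
        have hmin : min (s.arr 6 (lo + i)) (sketchDist (s.arr 5) m (lo + i) far) < Γ.L :=
          (min_le_left _ _).trans_lt hDi
        set μ := min (s.arr 6 (lo + i)) (sketchDist (s.arr 5) m (lo + i) far) with hμ
        have n6 : ∀ z, s3.arr 6 z = if lo ≤ z ∧ z < lo + (i + 1) then
            min (s.arr 6 z) (sketchDist (s.arr 5) m z far) else s.arr 6 z := by
          intro z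
          rw [w6, Function.update_apply, k1]
          by_cases hz : z = lo + i
          · rw [if_pos hz, if_pos (by omega), hz]
          · rw [if_neg hz]
            congr 1
            exact propext ⟨fun _ => by omega, fun _ => by omega⟩
        have n7 : ∀ z, s3.arr 7 z = if lo ≤ z ∧ z < lo + (i + 1) ∧
            sketchDist (s.arr 5) m z far < s.arr 6 z then clo + c else s.arr 7 z := by
          intro z
          rw [w7, Function.update_apply, k2]
          by_cases hz : z = lo + i
          · rw [if_pos hz, hz]
            congr 1
            exact propext ⟨fun _ => ⟨by omega, by omega, by assumption⟩, fun h => h.2.2⟩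
          · rw [if_neg hz]
            congr 1
            exact propext ⟨fun h => ⟨by omega, by omega, h.2.2⟩, fun h => ⟨by omega, by omega, h.2.2⟩⟩
        have μ6 : s3.arr 6 (lo + i) = μ := by rw [w6, Function.update_self]
        have o6 : ∀ z, z ≠ lo + i → s3.arr 6 z = s'.arr 6 z := fun z hz => by
          rw [w6, Function.update_of_ne hz]
        have ht' : s3.time + 50 ≤ s.time + 5 + (i + 1) * (100 + m * 60) := by
          have : (i + 1) * (100 + m * 60) = i * (100 + m * 60) + 100 + m * 60 := by ring
          omega
        simp only [wp_cond, wp_seq, wp_set, Ex.ok, Ex.eval, opVal, Ex.cost, tick_var, tick_arr,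
          setVar_var, setVar_arr, setVar_time, tick_time, wv, v9, v25, v26, hlim6, μ6,
          if_true, Nat.reduceEqDiff, if_false]
        refine ⟨⟨by omega, by omega⟩, ⟨by omega, ⟨by omega, by omega⟩, by omega⟩, fun hlt => ?_,
          fun hlt => ?_⟩
        · refine ⟨by omega, ⟨by omega, ⟨by omega, by omega⟩, by omega⟩, by omega, by omega,
            ⟨by omega, by omega⟩, by omega, n6, n7, by omega, .inl (by omega), by omega, by omega,
            ?_, by omega⟩
          intro v hv2
          by_cases hvi : v = i
          · rw [hvi]; omega
          · rw [o6 _ (by omega)]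
            exact (k7 v (by omega)).trans hlt.le
        · refine ⟨n6, n7, by omega, ?_, ?_, by omega, ?_, by omega⟩
          · rcases k4 with h | h
            · exact .inl (by omega)
            · exact .inr h
          · rcases k4 with h | h
            · rw [o6 _ (by omega)]
              exact k5
            · omega
          · intro v hv2
            by_cases hvi : v = i
            · rw [hvi]; omega
            · rw [o6 _ (by omega)]
              exact k7 v (by omega)
  · rintro s' hF ⟨k1, k2, k3, k4, k5, k6, k7, k8⟩
    refine ⟨k1, k2, k3, ?_, fun v hv => (k7 v hv).trans k5, ?_⟩
    · simp only [tick_var]; omega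
    · simp only [tick_time]; omega

/-- Choosing `s.var 23` centers among the points `s.var 20, …, s.var 20 + s.var 21 - 1`. -/
def centersStmt : Stmt :=
  .loop 7 21 (.st 6 (.var 20 +ₑ .var 7) (.var 1 *ₑ .var 5 +ₑ .lit 1)) ;;
  .set 24 (.var 20) ;;
  .loop 27 23 (
    .st 8 (.var 22 +ₑ .var 27) (.var 24) ;; .set 16 (.var 24 *ₑ .var 5) ;;
    .set 25 (.lit 0) ;; .set 26 (.var 20) ;; scanStmt ;; .set 24 (.var 26))

/-- What farthest-point clustering achieves: every point has a center at distance at most `R`, and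
the centers and some further point have pairwise distances at least `R`. -/
structure FarthestPoint (d : ℕ → ℕ → ℕ) (lo sz clo kk : ℕ) (ctr cl : ℕ → ℕ) : Prop where
  ctr_mem : ∀ e < kk, lo ≤ ctr (clo + e) ∧ ctr (clo + e) < lo + sz
  cl_mem : ∀ v < sz, ∃ e < kk, cl (lo + v) = clo + e
  radius : ∃ R far, lo ≤ far ∧ far < lo + sz ∧
    (∀ v < sz, d (lo + v) (ctr (cl (lo + v))) ≤ R) ∧
    (∀ e < kk, R ≤ d far (ctr (clo + e))) ∧
    ∀ e < kk, ∀ e' < e, R ≤ d (ctr (clo + e)) (ctr (clo + e'))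

/-- After `c` rounds, for `c` at least `1`, array `6` holds the distance of each point to its
assigned center, which is its minimal distance to the centers so far, and variable `24` holds a
point maximizing it. That maximum never increases, and every new center was a maximizer when chosen;
hence all pairs of centers are at least the current maximum apart. After the last round the
maximizer is the extra point `far` and the maximum is `R`. -/
lemma wp_centersStmt {Γ : Layout} {ω : ℕ → Bool} {s : St} {m n q lo sz clo kk : ℕ}
    (h1 : s.var 1 = q) (h5 : s.var 5 = m) (h20 : s.var 20 = lo)
    (h21 : s.var 21 = sz) (h22 : s.var 22 = clo) (h23 : s.var 23 = kk)
    (hmL : m < Γ.L) (hnL : n < Γ.L) (hL : n * m < Γ.L)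
    (hqm : q * m + q + 1 < Γ.L) (hlo : lo + sz ≤ n) (hclo : clo + kk ≤ n)
    (hS : ∀ u < n, ∀ i < m, s.arr 5 (u * m + i) ≤ q) (hsz : 1 ≤ sz) (hkk : 1 ≤ kk) :
    wp Γ ω centersStmt (fun s' =>
      FarthestPoint (sketchDist (s.arr 5) m) lo sz clo kk (s'.arr 8) (s'.arr 7) ∧
      (∀ z, ¬ (lo ≤ z ∧ z < lo + sz) → s'.arr 7 z = s.arr 7 z) ∧
      (∀ z, ¬ (clo ≤ z ∧ z < clo + kk) → s'.arr 8 z = s.arr 8 z) ∧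
      s'.time ≤ s.time + 20 + sz * 30 + kk * (60 + sz * (100 + m * 60))) s := by
  have hlim6 : Γ.lim 6 = Γ.L := rfl
  have hlim8 : Γ.lim 8 = Γ.L := rfl
  have hd : ∀ u < n, ∀ v < n, sketchDist (s.arr 5) m u v ≤ q * m := by
    intro u hu v hv
    rw [mul_comm]
    refine sum_range_le fun j hj => ?_
    have := hS _ hu j hj
    have := hS _ hv j hj
    unfold absDiff; omega
  set d := sketchDist (s.arr 5) m with hdef
  unfold centersStmt
  rw [wp_seq]
  -- The starting value `q * m + 1` exceeds every sketch distance, so the first scan assigns a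
  -- center to every point.
  refine wp_mono (wp_frame (wp_tabulate 6 lo sz (fun _ => q * m + 1) (fun _ => 20)
    (by omega) (by omega) (by omega) (by simp [Stmt.vars]) (by simp [Stmt.vars]) h21
    (by omega) ?_)) ?_
  · intro i s' hi hxi hF _
    have e1 : s'.var 1 = q := (hF.var 1 (by simp [Stmt.vars])).trans h1
    have e5 : s'.var 5 = m := (hF.var 5 (by simp [Stmt.vars])).trans h5
    have e20 : s'.var 20 = lo := (hF.var 20 (by simp [Stmt.vars])).trans h20
    simp only [wp_st, Ex.ok, Ex.eval, opVal, Ex.cost, e1, e5, e20, hxi, hlim6, setArr_arr,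
      setArr_time, if_true]
    exact ⟨by omega, ⟨⟨by omega, by omega⟩, ⟨by omega, by omega⟩, by omega⟩,
      ⟨⟨⟨by omega, by omega⟩, ⟨by omega, by omega⟩, by omega⟩, by omega, by omega⟩, by omega,
      trivial, by omega⟩
  rintro s1 ⟨⟨g6, gt⟩, hF⟩
  simp only [Finset.sum_const, Finset.card_range, smul_eq_mul] at gt
  have e1 : s1.var 1 = q := (hF.var 1 (by simp [Stmt.vars])).trans h1
  have e5 : s1.var 5 = m := (hF.var 5 (by simp [Stmt.vars])).trans h5
  have e20 : s1.var 20 = lo := (hF.var 20 (by simp [Stmt.vars])).trans h20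
  have e21 : s1.var 21 = sz := (hF.var 21 (by simp [Stmt.vars])).trans h21
  have e22 : s1.var 22 = clo := (hF.var 22 (by simp [Stmt.vars])).trans h22
  have e23 : s1.var 23 = kk := (hF.var 23 (by simp [Stmt.vars])).trans h23
  have a5 : s1.arr 5 = s.arr 5 := hF.arr 5 (by simp [Stmt.arrs])
  have a7 : s1.arr 7 = s.arr 7 := hF.arr 7 (by simp [Stmt.arrs])
  have a8 : s1.arr 8 = s.arr 8 := hF.arr 8 (by simp [Stmt.arrs])
  simp only [wp_seq, wp_set, Ex.ok, Ex.eval, opVal, Ex.cost, e20]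
  refine ⟨by omega, ⟨by omega, by omega⟩, by omega, ?_⟩
  refine wp_loop (fun c s' =>
    (lo ≤ s'.var 24 ∧ s'.var 24 < lo + sz) ∧
    (∀ e < c, lo ≤ s'.arr 8 (clo + e) ∧ s'.arr 8 (clo + e) < lo + sz) ∧
    (∀ v < sz, (c = 0 ∧ s'.arr 6 (lo + v) = q * m + 1) ∨ ∃ e < c, s'.arr 7 (lo + v) = clo + e ∧
      s'.arr 6 (lo + v) = d (lo + v) (s'.arr 8 (clo + e))) ∧
    (∀ v < sz, ∀ e < c, s'.arr 6 (lo + v) ≤ d (lo + v) (s'.arr 8 (clo + e))) ∧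
    (∀ v < sz, s'.arr 6 (lo + v) ≤ s'.arr 6 (s'.var 24)) ∧
    (∀ e < c, ∀ e' < e, s'.arr 6 (s'.var 24) ≤ d (s'.arr 8 (clo + e)) (s'.arr 8 (clo + e'))) ∧
    (∀ z, ¬ (lo ≤ z ∧ z < lo + sz) → s'.arr 7 z = s.arr 7 z) ∧
    (∀ z, ¬ (clo ≤ z ∧ z < clo + kk) → s'.arr 8 z = s.arr 8 z) ∧
    s'.time ≤ s.time + 10 + sz * 30 + c * (60 + sz * (100 + m * 60))) (by omega) (by omega)
    (by omega) (by simp [Stmt.vars, scanStmt]) (by simp [Stmt.vars, scanStmt]) kk (by simp [e23])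
    (by omega) ?_ ?_ ?_
  · have hg : ∀ v < sz, s1.arr 6 (lo + v) = q * m + 1 := fun v hv => by
      rw [g6, if_pos (by omega)]
    refine ⟨by simp; omega, by simp, fun v hv => .inl ⟨rfl, hg v hv⟩, by simp, ?_, by simp,
      fun z _ => by simp [a7], fun z _ => by simp [a8], ?_⟩
    · intro v hv
      simp only [setVar_var, Nat.reduceEqDiff, if_false, if_true, setVar_arr, hg v hv]
      have := hg 0 (by omega)
      rw [add_zero] at this
      omega
    · simp only [setVar_time]; omega
  · rintro c s' hc hxc hF' ⟨⟨k1, k1'⟩, k2, k3, k4, k5, k6, k7, k8, k9⟩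
    have f1 : s'.var 1 = q := (hF'.var 1 (by simp [Stmt.vars, scanStmt])).trans (by simp [e1])
    have f5 : s'.var 5 = m := (hF'.var 5 (by simp [Stmt.vars, scanStmt])).trans (by simp [e5])
    have f20 : s'.var 20 = lo := (hF'.var 20 (by simp [Stmt.vars, scanStmt])).trans (by simp [e20])
    have f21 : s'.var 21 = sz := (hF'.var 21 (by simp [Stmt.vars, scanStmt])).trans (by simp [e21])
    have f22 : s'.var 22 = clo := (hF'.var 22 (by simp [Stmt.vars, scanStmt])).trans (by simp [e22])
    have b5 : s'.arr 5 = s.arr 5 := (hF'.arr 5 (by simp [Stmt.arrs, scanStmt])).trans (by simp [a5])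
    obtain ⟨far, hfar⟩ : ∃ far, s'.var 24 = far := ⟨_, rfl⟩
    rw [hfar] at k1 k1' k5 k6
    have b2 : far * m ≤ n * m := Nat.mul_le_mul_right _ (by omega)
    simp only [wp_seq, wp_set, wp_st, Ex.ok, Ex.eval, opVal, Ex.cost, tick_var, setVar_var,
      setArr_var, hxc, f20, f22, f5, hfar, hlim8, if_true, Nat.reduceEqDiff, if_false]
    refine ⟨by omega, ⟨⟨by omega, by omega⟩, ⟨by omega, by omega⟩, by omega⟩,
      ⟨by omega, by omega⟩, by omega, by omega, ⟨⟨by omega, by omega⟩, ⟨by omega, by omega⟩,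
      by omega⟩, by omega, by omega, by omega, by omega, by omega, ⟨by omega, by omega⟩,
      by omega, ?_⟩
    refine wp_mono (wp_frame (wp_scanStmt (m := m) (n := n) (q := q) (lo := lo) (sz := sz)
      (clo := clo) (c := c) (far := far) (by simp [f5]) (by simp) (by simp [f20]) (by simp [f21])
      (by simp [f22]) (by simp) (by simp) (by simp [hxc]) hmL hnL hL hqm hlo (by omega) (by omega)
      (by simpa [b5] using hS) ?_ hsz)) ?_
    · intro v hv
      simp only [setVar_arr, setArr_arr, Nat.reduceEqDiff, if_false, tick_arr]
      rcases k3 v hv with ⟨_, h⟩ | ⟨e, he, _, h⟩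
      · omega
      · have := hd (lo + v) (by omega) _ (by have := (k2 e he).2; omega : s'.arr 8 (clo + e) < n)
        omega
    rintro s2 ⟨⟨w6, w7, w26, w26', wmax, wt⟩, hF2⟩
    have c8 : s2.arr 8 = Function.update (s'.arr 8) (clo + c) far :=
      (hF2.arr 8 (by simp [Stmt.arrs, scanStmt])).trans (by simp)
    simp only [setVar_arr, setArr_arr, Nat.reduceEqDiff, if_false, tick_arr, b5, setVar_time,
      setArr_time, tick_time] at w6 w7 wt
    have c8n : ∀ e < c, s2.arr 8 (clo + e) = s'.arr 8 (clo + e) := fun e he => by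
      rw [c8, Function.update_of_ne (by omega)]
    have c8s : s2.arr 8 (clo + c) = far := by rw [c8, Function.update_self]
    have c6 : ∀ v < sz, s2.arr 6 (lo + v) = min (s'.arr 6 (lo + v)) (d (lo + v) far) :=
      fun v hv => by rw [w6, if_pos (by omega)]
    have c7 : ∀ v < sz, s2.arr 7 (lo + v) =
        if d (lo + v) far < s'.arr 6 (lo + v) then clo + c else s'.arr 7 (lo + v) := by
      intro v hv
      rw [w7]
      congr 1
      exact propext ⟨fun h => h.2.2, fun h => ⟨by omega, by omega, h⟩⟩
    obtain ⟨x, hx⟩ : ∃ x, s2.var 26 = lo + x := ⟨s2.var 26 - lo, by omega⟩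
    obtain ⟨y, hy⟩ : ∃ y, far = lo + y := ⟨far - lo, by omega⟩
    -- Because the largest distance does not grow, the separation of the older centers remains a
    -- valid lower bound.
    have hdec : s2.arr 6 (s2.var 26) ≤ s'.arr 6 far := by
      rw [hx, c6 x (by omega)]
      exact (min_le_left _ _).trans (k5 x (by omega))
    simp only [wp_set, Ex.ok, Ex.eval, opVal, Ex.cost, setVar_var, setVar_arr, setVar_time,
      if_true, Nat.reduceEqDiff, if_false]
    refine ⟨by omega, ⟨by omega, by omega⟩, by omega, ⟨w26, w26'⟩, ?_, ?_, ?_, wmax, ?_, ?_, ?_,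
      ?_⟩
    · intro e he
      by_cases hec : e = c
      · rw [hec, c8s]; omega
      · rw [c8n e (by omega)]
        exact k2 e (by omega)
    · intro v hv
      right
      rw [c6 v hv, c7 v hv]
      by_cases hlt : d (lo + v) far < s'.arr 6 (lo + v)
      · exact ⟨c, by omega, by rw [if_pos hlt], by rw [min_eq_right hlt.le, c8s]⟩
      · rw [if_neg hlt, min_eq_left (by omega)]
        rcases k3 v hv with ⟨_, h⟩ | ⟨e, he, h, h'⟩
        · have := hd (lo + v) (by omega) far (by omega)
          omega
        · exact ⟨e, by omega, h, by rw [c8n e he, h']⟩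
    · intro v hv e he
      rw [c6 v hv]
      by_cases hec : e = c
      · rw [hec, c8s]; exact min_le_right _ _
      · rw [c8n e (by omega)]
        exact (min_le_left _ _).trans (k4 v hv e (by omega))
    · intro e he e' he'
      rw [c8n e' (by omega)]
      by_cases hec : e = c
      · rw [hec, c8s]
        refine hdec.trans ?_
        rw [hy]
        exact k4 y (by omega) e' (by omega)
      · rw [c8n e (by omega)]
        exact hdec.trans (k6 e (by omega) e' he')
    · intro z hz
      rw [w7, if_neg (fun h => hz ⟨h.1, h.2.1⟩), k7 z hz]
    · intro z hz
      rw [c8, Function.update_of_ne (by omega), k8 z hz]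
    · have : (c + 1) * (60 + sz * (100 + m * 60)) =
        c * (60 + sz * (100 + m * 60)) + 60 + sz * (100 + m * 60) := by ring
      omega
  · rintro s' hF' ⟨⟨k1, k1'⟩, k2, k3, k4, k5, k6, k7, k8, k9⟩
    refine ⟨⟨k2, ?_, s'.arr 6 (s'.var 24), s'.var 24, k1, k1', ?_, ?_, k6⟩, k7, k8, ?_⟩
    · intro v hv
      rcases k3 v hv with ⟨h, _⟩ | ⟨e, he, h, h'⟩
      · omega
      · exact ⟨e, he, h⟩
    · intro v hv
      rcases k3 v hv with ⟨h, _⟩ | ⟨e, he, h, h'⟩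
      · omega
      · simp only [tick_arr]
        rw [h, ← h']
        exact k5 v hv
    · intro e he
      obtain ⟨y, hy⟩ : ∃ y, s'.var 24 = lo + y := ⟨s'.var 24 - lo, by omega⟩
      have := k4 y (by omega) e he
      rw [← hy] at this
      exact this
    · simp only [tick_time]; omega

/-! ## The product from the clusters -/

/-- The first `cnt` values of `pos` are the positions below `b` where `x` and `y` differ. -/
structure DiffList (x y : ℕ → ℕ) (b cnt : ℕ) (pos : ℕ → ℕ) : Prop where
  cnt_le : cnt ≤ b
  pos_lt : ∀ t < cnt, pos t < b
  sum_eq : ∀ f : ℕ → ℕ, ∑ t ∈ Finset.range cnt, f (pos t) =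
    ∑ j ∈ Finset.range b, if x j = y j then 0 else f j

lemma DiffList.congr {x y : ℕ → ℕ} {b cnt : ℕ} {pos pos' : ℕ → ℕ} (h : DiffList x y b cnt pos)
    (e : ∀ t < cnt, pos' t = pos t) : DiffList x y b cnt pos' where
  cnt_le := h.cnt_le
  pos_lt t ht := by rw [e t ht]; exact h.pos_lt t ht
  sum_eq f := by
    rw [← h.sum_eq f]
    exact Finset.sum_congr rfl fun t ht => by rw [e t (Finset.mem_range.mp ht)]

lemma DiffList.succ_of_eq {x y : ℕ → ℕ} {b cnt : ℕ} {pos : ℕ → ℕ} (h : DiffList x y b cnt pos)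
    (e : x b = y b) : DiffList x y (b + 1) cnt pos where
  cnt_le := h.cnt_le.trans (by omega)
  pos_lt t ht := (h.pos_lt t ht).trans (by omega)
  sum_eq f := by rw [h.sum_eq f, Finset.sum_range_succ, if_pos e, add_zero]

/-- Stating `sum_eq` for all weights `f` makes the extension a comparison of the last summands. It
also records that each differing position is listed once, without a statement about order or
injectivity. -/
lemma DiffList.succ_of_ne {x y : ℕ → ℕ} {b cnt : ℕ} {pos : ℕ → ℕ} (h : DiffList x y b cnt pos)
    (e : x b ≠ y b) (hp : pos cnt = b) : DiffList x y (b + 1) (cnt + 1) pos where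
  cnt_le := by have := h.cnt_le; omega
  pos_lt t ht := by
    by_cases htc : t = cnt
    · rw [htc]; omega
    · exact (h.pos_lt t (by omega)).trans (by omega)
  sum_eq f := by
    rw [Finset.sum_range_succ, h.sum_eq f, Finset.sum_range_succ, if_neg e, hp]

/-- For every point, the positions where it differs from its center are listed in array `10`, and
their number is put into array `9`. -/
def diffStmt : Stmt :=
  .loop 9 6 (
    .set 10 (.var 9 *ₑ .var 1) ;; .set 13 (.ld 8 (.ld 7 (.var 9)) *ₑ .var 1) ;;
    .set 12 (.lit 0) ;;
    .loop 11 1 (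
      .cond (.lit 0) (exDiff (.ld 3 (.var 10 +ₑ .var 11)) (.ld 3 (.var 13 +ₑ .var 11))) (
        .st 10 (.var 10 +ₑ .var 12) (.var 11) ;; .set 12 (.var 12 +ₑ .lit 1))) ;;
    .st 9 (.var 9) (.var 12))

/-- The list of point `v` lives in block `v` of array `10`. It has at most `q` entries, so it fits
there and leaves the lists of earlier points alone. As the language can only compare by `<`,
inequality of two bits is tested as a positive absolute difference. -/
lemma wp_diffStmt {Γ : Layout} {ω : ℕ → Bool} {s : St} {n q l : ℕ}
    (h1 : s.var 1 = q) (h6 : s.var 6 = n) (hqL : q + 2 < Γ.L) (hnL : n < Γ.L) (hL : n * q < Γ.L)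
    (hx : ∀ v < n, ∀ j < q, s.arr 3 (v * q + j) ≤ 1) (hcl : ∀ v < n, s.arr 7 v < l)
    (hctr : ∀ v < l, s.arr 8 v < n) (hln : l ≤ n) :
    wp Γ ω diffStmt (fun s' => (∀ v < n, DiffList (fun j => s.arr 3 (v * q + j))
        (fun j => s.arr 3 (s.arr 8 (s.arr 7 v) * q + j)) q (s'.arr 9 v)
        (fun t => s'.arr 10 (v * q + t))) ∧
      s'.time ≤ s.time + 10 + n * (60 + q * 80)) s := by
  have hlim3 : Γ.lim 3 = Γ.L := rfl
  have hlim7 : Γ.lim 7 = Γ.L := rfl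
  have hlim8 : Γ.lim 8 = Γ.L := rfl
  have hlim9 : Γ.lim 9 = Γ.L := rfl
  have hlim10 : Γ.lim 10 = Γ.L := rfl
  unfold diffStmt
  refine wp_loop (fun i s' => (∀ v < i, DiffList (fun j => s.arr 3 (v * q + j))
      (fun j => s.arr 3 (s.arr 8 (s.arr 7 v) * q + j)) q (s'.arr 9 v)
      (fun t => s'.arr 10 (v * q + t))) ∧
    s'.time ≤ s.time + 5 + i * (60 + q * 80)) (by omega) (by omega) (by omega)
    (by simp [Stmt.vars]) (by simp [Stmt.vars]) n h6 (by omega) ?_ ?_ ?_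
  · exact ⟨by simp, by simp only [setVar_time]; omega⟩
  · rintro v s' hv hxv hF ⟨k1, k2⟩
    have e1 : s'.var 1 = q := (hF.var 1 (by simp [Stmt.vars])).trans h1
    have a3 : s'.arr 3 = s.arr 3 := hF.arr 3 (by simp [Stmt.arrs])
    have a7 : s'.arr 7 = s.arr 7 := hF.arr 7 (by simp [Stmt.arrs])
    have a8 : s'.arr 8 = s.arr 8 := hF.arr 8 (by simp [Stmt.arrs])
    have hw := hcl v hv
    obtain ⟨w, hwe⟩ : ∃ w, s.arr 7 v = w := ⟨_, rfl⟩
    rw [hwe] at hw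
    have hu := hctr w hw
    obtain ⟨u, hue⟩ : ∃ u, s.arr 8 w = u := ⟨_, rfl⟩
    rw [hue] at hu
    have b1 : v * q ≤ n * q := Nat.mul_le_mul_right _ hv.le
    have b2 : u * q ≤ n * q := Nat.mul_le_mul_right _ hu.le
    simp only [wp_seq, wp_set, Ex.ok, Ex.eval, opVal, Ex.cost, tick_var, setVar_var, tick_arr,
      setVar_arr, hxv, e1, a7, a8, hwe, hue, hlim7, hlim8, if_true, Nat.reduceEqDiff, if_false,
      OfNat.one_ne_ofNat]
    refine ⟨by omega, ⟨⟨by omega, by omega⟩, ⟨by omega, by omega⟩, by omega⟩, by omega, by omega,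
      ⟨⟨by omega, ⟨by omega, ⟨by omega, by omega⟩, by omega⟩, by omega⟩, ⟨by omega, by omega⟩,
        by omega⟩, by omega, by omega, by omega, by omega, ?_⟩
    refine wp_mono (wp_frame (wp_loop (fun j s2 =>
      DiffList (fun j => s.arr 3 (v * q + j)) (fun j => s.arr 3 (u * q + j)) j (s2.var 12)
        (fun t => s2.arr 10 (v * q + t)) ∧
      (∀ z < v * q, s2.arr 10 z = s'.arr 10 z) ∧
      s2.time ≤ s'.time + 35 + j * 80)
      (Q := fun s2 => DiffList (fun j => s.arr 3 (v * q + j)) (fun j => s.arr 3 (u * q + j)) q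
        (s2.var 12) (fun t => s2.arr 10 (v * q + t)) ∧
      (∀ z < v * q, s2.arr 10 z = s'.arr 10 z) ∧
      s2.time ≤ s'.time + 37 + q * 80)
      (by omega) (by omega) (by omega)
      (by simp [Stmt.vars]) (by simp [Stmt.vars]) q (by simp [e1]) (by omega) ?_ ?_ ?_)) ?_
    · refine ⟨?_, fun z _ => rfl, ?_⟩
      · simp only [setVar_var, Nat.reduceEqDiff, if_true, if_false]
        exact ⟨le_rfl, by simp, by simp⟩
      · simp only [setVar_time, tick_time]; omega
    · rintro j s2 hj hxj hF2 ⟨m1, m2, m3⟩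
      have f10 : s2.var 10 = v * q := (hF2.var 10 (by simp [Stmt.vars])).trans (by simp)
      have f13 : s2.var 13 = u * q := (hF2.var 13 (by simp [Stmt.vars])).trans (by simp)
      have c3 : s2.arr 3 = s.arr 3 := (hF2.arr 3 (by simp [Stmt.arrs])).trans (by simp [a3])
      have := add_mul_lt hv hj
      have := add_mul_lt hu hj
      have := hx v hv j hj
      have := hx u hu j hj
      have hcnt := m1.cnt_le
      simp only [exDiff, wp_cond, wp_seq, wp_set, wp_st, Ex.ok, Ex.eval, opVal, Ex.cost, tick_var,
        tick_arr, setVar_var, setArr_var, hxj, f10, f13, c3, hlim3, hlim10, if_true,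
        Nat.reduceEqDiff, if_false, OfNat.one_ne_ofNat]
      refine ⟨by omega, ⟨⟨⟨by omega, ⟨⟨by omega, by omega⟩, ⟨by omega, by omega⟩, by omega⟩,
        by omega⟩, ⟨by omega, ⟨⟨by omega, by omega⟩, ⟨by omega, by omega⟩, by omega⟩, by omega⟩,
        by omega⟩, ⟨⟨by omega, ⟨⟨by omega, by omega⟩, ⟨by omega, by omega⟩, by omega⟩,
        by omega⟩, ⟨by omega, ⟨⟨by omega, by omega⟩, ⟨by omega, by omega⟩, by omega⟩, by omega⟩,
        by omega⟩, by omega⟩, fun hlt => ?_, fun hlt => ?_⟩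
      · refine ⟨by omega, ⟨⟨by omega, by omega⟩, ⟨by omega, by omega⟩, by omega⟩,
          ⟨by omega, by omega⟩, by omega, by omega, ⟨⟨by omega, by omega⟩, by omega, by omega⟩,
          by omega, ?_, ?_, ?_⟩
        · simp only [setVar_arr, setArr_arr, if_true, tick_arr]
          refine DiffList.succ_of_ne (m1.congr fun t ht => ?_) ?_ ?_
          · rw [Function.update_of_ne (by omega)]
          · omega
          · simp
        · intro z hz
          simp only [setVar_arr, setArr_arr, if_true, tick_arr]
          rw [Function.update_of_ne (by omega), m2 z hz]
        · simp only [setVar_time, setArr_time, tick_time]; omega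
      · refine ⟨m1.succ_of_eq (by omega), m2, ?_⟩
        simp only [setVar_time, tick_time]; omega
    · rintro s2 hF2 ⟨m1, m2, m3⟩
      exact ⟨m1, m2, by simp only [tick_time]; omega⟩
    · rintro s2 ⟨⟨m1, m2, m3⟩, hF2⟩
      have f9 : s2.var 9 = v := (hF2.var 9 (by simp [Stmt.vars])).trans (by simp [hxv])
      have c9 : s2.arr 9 = s'.arr 9 := (hF2.arr 9 (by simp [Stmt.arrs])).trans (by simp)
      have := m1.cnt_le
      simp only [wp_st, Ex.ok, Ex.eval, Ex.cost, f9, hlim9]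
      refine ⟨by omega, ⟨by omega, by omega⟩, ⟨by omega, by omega⟩, by omega, ?_, ?_⟩
      · intro v' hv'
        simp only [setVar_arr, setArr_arr, if_true, c9, Nat.reduceEqDiff, if_false]
        by_cases hvv : v' = v
        · rw [hvv, Function.update_self, hwe, hue]
          exact m1
        · rw [Function.update_of_ne hvv]
          have hk := k1 v' (by omega)
          refine hk.congr fun t ht => ?_
          have h9 := hk.cnt_le
          have : v' * q + t < v * q := add_mul_lt (by omega) (by omega)
          rw [m2 _ this]
      · have : (v + 1) * (60 + q * 80) = v * (60 + q * 80) + 60 + q * 80 := by ring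
        simp only [setVar_time, setArr_time]; omega
  · rintro s' hF ⟨k1, k2⟩
    exact ⟨k1, by simp only [tick_time]; omega⟩

/-! ### Inner products of the centers and their correction -/

/-- The inner product of points `a` and `b`. -/
def dot (x : ℕ → ℕ) (q a b : ℕ) : ℕ := ∑ j ∈ Finset.range q, x (a * q + j) * x (b * q + j)

lemma mul_le_one' {a b : ℕ} (ha : a ≤ 1) (hb : b ≤ 1) : a * b ≤ 1 := by
  simpa using Nat.mul_le_mul ha hb

/-- The inner products of the centers are put into array `11`. -/
def tableStmt : Stmt :=
  .set 8 (.var 3 *ₑ .var 4) ;;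
  .loop 7 8 (
    .set 9 (.var 7 /ₑ .var 4) ;; .set 10 (.var 7 -ₑ .var 9 *ₑ .var 4) ;;
    .set 13 (.ld 8 (.var 9) *ₑ .var 1) ;; .set 14 (.ld 8 (.var 3 +ₑ .var 10) *ₑ .var 1) ;;
    .set 12 (.lit 0) ;;
    .loop 11 1 (.set 12 (.var 12 +ₑ
      .ld 3 (.var 13 +ₑ .var 11) *ₑ .ld 3 (.var 14 +ₑ .var 11))) ;;
    .st 11 (.var 7) (.var 12))

lemma wp_tableStmt {Γ : Layout} {ω : ℕ → Bool} {s : St} {n q l k : ℕ}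
    (h1 : s.var 1 = q) (h3 : s.var 3 = l) (h4 : s.var 4 = k) (hqL : q + 2 < Γ.L) (hnL : n < Γ.L)
    (hL : n * q < Γ.L) (hlk : l + k ≤ n) (hlkL : l * k < Γ.L)
    (hx : ∀ v < n, ∀ j < q, s.arr 3 (v * q + j) ≤ 1)
    (hctr : ∀ v < l + k, s.arr 8 v < n) :
    wp Γ ω tableStmt (fun s' => (∀ a < l, ∀ b < k,
        s'.arr 11 (a * k + b) = dot (s.arr 3) q (s.arr 8 a) (s.arr 8 (l + b))) ∧
      s'.time ≤ s.time + 10 + l * k * (70 + q * 50)) s := by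
  have hlim3 : Γ.lim 3 = Γ.L := rfl
  have hlim8 : Γ.lim 8 = Γ.L := rfl
  have hlim11 : Γ.lim 11 = Γ.L := rfl
  unfold tableStmt
  simp only [wp_seq, wp_set, Ex.ok, Ex.eval, opVal, Ex.cost, h3, h4]
  refine ⟨by omega, ⟨⟨by omega, by omega⟩, ⟨by omega, by omega⟩, by omega⟩, by omega, ?_⟩
  refine wp_mono (wp_tabulate 11 0 (l * k)
    (fun z => dot (s.arr 3) q (s.arr 8 (z / k)) (s.arr 8 (l + z % k))) (fun _ => 65 + q * 50)
    (by omega) (by omega) (by omega) (by simp [Stmt.vars]) (by simp [Stmt.vars]) (by simp)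
    (by omega) ?_) ?_
  · intro t s' ht hxt hF _
    have e1 : s'.var 1 = q := (hF.var 1 (by simp [Stmt.vars])).trans (by simp [h1])
    have e3 : s'.var 3 = l := (hF.var 3 (by simp [Stmt.vars])).trans (by simp [h3])
    have e4 : s'.var 4 = k := (hF.var 4 (by simp [Stmt.vars])).trans (by simp [h4])
    have a3 : s'.arr 3 = s.arr 3 := hF.arr 3 (by simp [Stmt.arrs])
    have a8 : s'.arr 8 = s.arr 8 := hF.arr 8 (by simp [Stmt.arrs])
    obtain ⟨d1, d2, d3, d4⟩ := div_mod_lt ht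
    have hu := hctr (t / k) (by omega)
    obtain ⟨u, hue⟩ : ∃ u, s.arr 8 (t / k) = u := ⟨_, rfl⟩
    rw [hue] at hu
    have hw := hctr (l + t % k) (by omega)
    obtain ⟨w, hwe⟩ : ∃ w, s.arr 8 (l + t % k) = w := ⟨_, rfl⟩
    rw [hwe] at hw
    have k1 : u * q ≤ n * q := Nat.mul_le_mul_right _ hu.le
    have k2 : w * q ≤ n * q := Nat.mul_le_mul_right _ hw.le
    simp only [wp_seq, wp_set, Ex.ok, Ex.eval, opVal, Ex.cost, hxt, e1, e3, e4, setVar_var,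
      setVar_arr, a8, d4, hue, hwe, hlim8, if_true, OfNat.one_ne_ofNat, Nat.reduceEqDiff, if_false]
    refine ⟨by omega, ⟨⟨by omega, by omega⟩, ⟨by omega, by omega⟩, by omega⟩, by omega, by omega,
      ⟨⟨by omega, by omega⟩, ⟨⟨by omega, by omega⟩, ⟨by omega, by omega⟩, by omega⟩, by omega⟩,
      by omega, by omega,
      ⟨⟨by omega, ⟨by omega, by omega⟩, by omega⟩, ⟨by omega, by omega⟩, by omega⟩,
      by omega, by omega,
      ⟨⟨by omega, ⟨⟨by omega, by omega⟩, ⟨by omega, by omega⟩, by omega⟩, by omega⟩,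
        ⟨by omega, by omega⟩, by omega⟩,
      by omega, by omega, by omega, by omega, ?_⟩
    have hdot : dot (s.arr 3) q u w ≤ q := by
      unfold dot
      simpa using sum_range_le (c := 1) fun j hj =>
        mul_le_one' (hx _ hu j hj) (hx _ hw j hj)
    refine wp_mono (wp_sum q (fun j => s.arr 3 (u * q + j) * s.arr 3 (w * q + j))
      (by omega) (by omega) (by omega) (by omega) (by omega) (by omega) (by simp [e1])
      (by omega) ?_ ?_) ?_
    · simp only [setVar_var, if_true, zero_add]
      exact lt_of_le_of_lt hdot (by omega)
    · intro j s2 hj hxj hv ha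
      have v13 : s2.var 13 = u * q := (hv 13 (by omega) (by omega)).trans (by simp)
      have v14 : s2.var 14 = w * q := (hv 14 (by omega) (by omega)).trans (by simp)
      have := add_mul_lt hu hj
      have := add_mul_lt hw hj
      have := mul_le_one' (hx _ hu j hj) (hx _ hw j hj)
      simp only [setVar_arr] at ha
      simp only [Ex.ok, Ex.eval, opVal, v13, v14, hxj, ha, a3, hlim3]
      refine ⟨?_, trivial⟩
      refine ⟨⟨?_, ⟨⟨?_, ?_⟩, ⟨?_, ?_⟩, ?_⟩, ?_⟩, ⟨?_, ⟨⟨?_, ?_⟩, ⟨?_, ?_⟩, ?_⟩, ?_⟩, ?_⟩ <;> omega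
    · rintro s2 ⟨h12, hv, ha, htm⟩
      have v7 : s2.var 7 = t := (hv 7 (by omega) (by omega)).trans (by simp [hxt])
      simp only [setVar_var, if_true, zero_add] at h12
      simp only [setVar_time, Ex.cost] at htm
      change s2.var 12 = dot (s.arr 3) q u w at h12
      simp only [wp_st, Ex.ok, Ex.eval, Ex.cost, v7, h12, hlim11, setArr_arr, setArr_time, if_true,
        ha, zero_add, setVar_arr, hue, hwe]
      exact ⟨by omega, ⟨by omega, by omega⟩, ⟨by omega, by omega⟩, by omega, trivial, by omega⟩
  · rintro s2 ⟨h5, ht⟩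
    simp only [setVar_time, Finset.sum_const, Finset.card_range, smul_eq_mul] at ht
    refine ⟨fun a ha b hb => ?_, ?_⟩
    · have := add_mul_lt ha hb
      have hm0 : 0 < k := by omega
      have ev : (a * k + b) / k = a := by
        rw [mul_comm, Nat.mul_add_div hm0, Nat.div_eq_of_lt hb, add_zero]
      have em : (a * k + b) % k = b := by
        rw [mul_comm, Nat.mul_add_mod, Nat.mod_eq_of_lt hb]
      rw [h5, if_pos (by omega), Nat.sub_zero, ev, em]
    · have : l * k * (65 + q * 50 + 3) ≤ l * k * (70 + q * 50) := Nat.mul_le_mul_left _ (by omega)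
      omega

/-- Correcting the inner product of the centers gives the inner product of the points. -/
lemma dot_correction {x : ℕ → ℕ} {q i j a b ci cj : ℕ} {pi pj : ℕ → ℕ}
    (hi : DiffList (fun z => x (i * q + z)) (fun z => x (a * q + z)) q ci pi)
    (hj : DiffList (fun z => x (j * q + z)) (fun z => x (b * q + z)) q cj pj) :
    dot x q a b + ∑ t ∈ Finset.range ci, x (i * q + pi t) * x (j * q + pi t) +
        ∑ t ∈ Finset.range cj, x (a * q + pj t) * x (j * q + pj t) =
      dot x q i j + (∑ t ∈ Finset.range ci, x (a * q + pi t) * x (j * q + pi t) +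
        ∑ t ∈ Finset.range cj, x (a * q + pj t) * x (b * q + pj t)) := by
  -- `sum_eq` turns list sums into sums over all coordinates. There the claim is the identity `x_i
  -- x_j - x_a x_b = (x_i - x_a) x_j + x_a (x_j - x_b)`, whose terms vanish where `i` agrees with
  -- `a`, respectively `j` with `b`; it is kept in additive form because the values are natural
  -- numbers.
  rw [hi.sum_eq (fun z => x (i * q + z) * x (j * q + z)),
    hj.sum_eq (fun z => x (a * q + z) * x (j * q + z)),
    hi.sum_eq (fun z => x (a * q + z) * x (j * q + z)),
    hj.sum_eq (fun z => x (a * q + z) * x (b * q + z))]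
  unfold dot
  simp only [← Finset.sum_add_distrib]
  refine Finset.sum_congr rfl fun z _ => ?_
  split_ifs with h1 h2 h2
  · rw [h1, h2]; ring
  · rw [h1]; ring
  · rw [h2]; ring
  · ring

/-- The product is computed from the inner products of the centers and the difference lists. -/
def outStmt : Stmt :=
  .set 8 (.var 0 *ₑ .var 2) ;;
  .loop 7 8 (
    .set 9 (.var 7 /ₑ .var 2) ;; .set 10 (.var 0 +ₑ (.var 7 -ₑ .var 9 *ₑ .var 2)) ;;
    .set 13 (.ld 7 (.var 9)) ;; .set 14 (.ld 7 (.var 10)) ;;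
    .set 12 (.ld 11 (.var 13 *ₑ .var 4 +ₑ (.var 14 -ₑ .var 3))) ;;
    .set 13 (.ld 8 (.var 13) *ₑ .var 1) ;; .set 14 (.ld 8 (.var 14) *ₑ .var 1) ;;
    .set 15 (.var 9 *ₑ .var 1) ;; .set 16 (.var 10 *ₑ .var 1) ;;
    .set 17 (.ld 9 (.var 9)) ;; .set 18 (.ld 9 (.var 10)) ;; .set 19 (.lit 0) ;;
    .loop 11 17 (.set 12 (.var 12 +ₑ .ld 3 (.var 15 +ₑ .ld 10 (.var 15 +ₑ .var 11)) *ₑ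
      .ld 3 (.var 16 +ₑ .ld 10 (.var 15 +ₑ .var 11)))) ;;
    .loop 11 18 (.set 12 (.var 12 +ₑ .ld 3 (.var 13 +ₑ .ld 10 (.var 16 +ₑ .var 11)) *ₑ
      .ld 3 (.var 16 +ₑ .ld 10 (.var 16 +ₑ .var 11)))) ;;
    .loop 11 17 (.set 19 (.var 19 +ₑ .ld 3 (.var 13 +ₑ .ld 10 (.var 15 +ₑ .var 11)) *ₑ
      .ld 3 (.var 16 +ₑ .ld 10 (.var 15 +ₑ .var 11)))) ;;
    .loop 11 18 (.set 19 (.var 19 +ₑ .ld 3 (.var 13 +ₑ .ld 10 (.var 16 +ₑ .var 11)) *ₑ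
      .ld 3 (.var 14 +ₑ .ld 10 (.var 16 +ₑ .var 11)))) ;;
    .st 2 (.var 7) (.var 12 -ₑ .var 19))

/-- One correction sum of `outStmt`: points `u`, `w` at the positions listed for point `v`. -/
lemma wp_corrSum {Γ : Layout} {ω : ℕ → Bool} {s : St} {n q u w v cnt y xu xw xv acc : ℕ}
    (hxu : s.var xu = u * q) (hxw : s.var xw = w * q) (hxv : s.var xv = v * q)
    (hcnt : s.var y = cnt) (hu : u < n) (hw : w < n) (hv : v < n) (hL : n * q < Γ.L)
    (h40 : xu < 40 ∧ xw < 40 ∧ xv < 40 ∧ y < 40 ∧ acc < 40)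
    (h11 : xu ≠ 11 ∧ xw ≠ 11 ∧ xv ≠ 11 ∧ y ≠ 11 ∧ acc ≠ 11)
    (hacc : xu ≠ acc ∧ xw ≠ acc ∧ xv ≠ acc ∧ y ≠ acc)
    (hle : cnt ≤ q) (hq : q + 2 < Γ.L) (hpos : ∀ t < cnt, s.arr 10 (v * q + t) < q)
    (hx : ∀ v < n, ∀ j < q, s.arr 3 (v * q + j) ≤ 1) (hb : s.var acc + q < Γ.L) :
    wp Γ ω (.loop 11 y (.set acc (.var acc +ₑ .ld 3 (.var xu +ₑ .ld 10 (.var xv +ₑ .var 11)) *ₑ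
      .ld 3 (.var xw +ₑ .ld 10 (.var xv +ₑ .var 11))))) (fun s' =>
      (s'.var acc = s.var acc + ∑ t ∈ Finset.range cnt,
        s.arr 3 (u * q + s.arr 10 (v * q + t)) * s.arr 3 (w * q + s.arr 10 (v * q + t))) ∧
      s'.var acc ≤ s.var acc + q ∧
      (∀ z, z ≠ 11 → z ≠ acc → s'.var z = s.var z) ∧ s'.arr = s.arr ∧
      s'.time ≤ s.time + 3 + cnt * 50) s := by
  have hlim3 : Γ.lim 3 = Γ.L := rfl
  have hlim10 : Γ.lim 10 = Γ.L := rfl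
  have hsum : ∑ t ∈ Finset.range cnt,
      s.arr 3 (u * q + s.arr 10 (v * q + t)) * s.arr 3 (w * q + s.arr 10 (v * q + t)) ≤ q :=
    (sum_range_le (c := 1) fun t ht =>
      mul_le_one' (hx _ hu _ (hpos t ht)) (hx _ hw _ (hpos t ht))).trans (by omega)
  refine wp_mono (wp_sum cnt (fun t => s.arr 3 (u * q + s.arr 10 (v * q + t)) *
    s.arr 3 (w * q + s.arr 10 (v * q + t))) (by omega) (by omega) (by omega) (by omega)
    (by omega) (by omega) hcnt (by omega) (by omega) ?_) ?_
  · intro t s' ht hxt hv' ha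
    have e1 : s'.var xu = u * q := (hv' xu (by omega) (by omega)).trans hxu
    have e2 : s'.var xw = w * q := (hv' xw (by omega) (by omega)).trans hxw
    have e3 : s'.var xv = v * q := (hv' xv (by omega) (by omega)).trans hxv
    have hp := hpos t ht
    have := add_mul_lt hu hp
    have := add_mul_lt hw hp
    have := add_mul_lt hv (ht.trans_le hle)
    have := mul_le_one' (hx _ hu _ hp) (hx _ hw _ hp)
    simp only [Ex.ok, Ex.eval, opVal, e1, e2, e3, hxt, ha, hlim3, hlim10]
    refine ⟨⟨⟨?_, ⟨⟨?_, ?_⟩, ⟨?_, ⟨⟨?_, ?_⟩, ⟨?_, ?_⟩, ?_⟩, ?_⟩, ?_⟩, ?_⟩,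
      ⟨?_, ⟨⟨?_, ?_⟩, ⟨?_, ⟨⟨?_, ?_⟩, ⟨?_, ?_⟩, ?_⟩, ?_⟩, ?_⟩, ?_⟩, ?_⟩, trivial⟩ <;> omega
  · rintro s' ⟨k1, k2, k3, k4⟩
    refine ⟨k1, by rw [k1]; exact Nat.add_le_add_left hsum _, k2, k3, ?_⟩
    simp only [Ex.cost] at k4
    omega

/-- Variable `12` collects the table entry and the two positive correction sums, variable `19` the
two negative ones. Each correction sum is at most `q`, which explains the bound on `5 * q`. Column
centers are numbered from `l` on, so `l` is subtracted before the table is consulted. -/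
lemma wp_outStmt {Γ : Layout} {ω : ℕ → Bool} {s : St} {p q r l k : ℕ}
    (h0 : s.var 0 = p) (h1 : s.var 1 = q) (h2 : s.var 2 = r) (h3 : s.var 3 = l) (h4 : s.var 4 = k)
    (hqL : 5 * q + 2 < Γ.L) (hnL : p + r < Γ.L) (hL : (p + r) * q < Γ.L)
    (hlp : l ≤ p) (hkr : k ≤ r) (hprL : p * r < Γ.L) (hlim2 : Γ.lim 2 = p * r)
    (hx : ∀ v < p + r, ∀ j < q, s.arr 3 (v * q + j) ≤ 1)
    (hctr : ∀ v < l + k, s.arr 8 v < p + r) (hclp : ∀ v < p, s.arr 7 v < l)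
    (hclr : ∀ v < r, l ≤ s.arr 7 (p + v) ∧ s.arr 7 (p + v) < l + k)
    (htab : ∀ a < l, ∀ b < k,
        s.arr 11 (a * k + b) = dot (s.arr 3) q (s.arr 8 a) (s.arr 8 (l + b)))
    (hdiff : ∀ v < p + r, DiffList (fun j => s.arr 3 (v * q + j))
        (fun j => s.arr 3 (s.arr 8 (s.arr 7 v) * q + j)) q (s.arr 9 v)
        (fun t => s.arr 10 (v * q + t))) :
    wp Γ ω outStmt (fun s' => (∀ i < p, ∀ j < r,
        s'.arr 2 (i * r + j) = dot (s.arr 3) q i (p + j)) ∧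
      s'.time ≤ s.time + 10 + ∑ t ∈ Finset.range (p * r),
        (200 + 100 * s.arr 9 (t / r) + 100 * s.arr 9 (p + t % r))) s := by
  have hlim3 : Γ.lim 3 = Γ.L := rfl
  have hlim7 : Γ.lim 7 = Γ.L := rfl
  have hlim8 : Γ.lim 8 = Γ.L := rfl
  have hlim9 : Γ.lim 9 = Γ.L := rfl
  have hlim11 : Γ.lim 11 = Γ.L := rfl
  unfold outStmt
  simp only [wp_seq, wp_set, Ex.ok, Ex.eval, opVal, Ex.cost, h0, h2]
  refine ⟨by omega, ⟨⟨by omega, by omega⟩, ⟨by omega, by omega⟩, by omega⟩, by omega, ?_⟩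
  refine wp_mono (wp_tabulate 2 0 (p * r)
    (fun z => dot (s.arr 3) q (z / r) (p + z % r))
    (fun t => 190 + 100 * s.arr 9 (t / r) + 100 * s.arr 9 (p + t % r))
    (by omega) (by omega) (by omega) (by simp [Stmt.vars]) (by simp [Stmt.vars]) (by simp)
    (by omega) ?_) ?_
  · intro t s' ht hxt hF _
    have e0 : s'.var 0 = p := (hF.var 0 (by simp [Stmt.vars])).trans (by simp [h0])
    have e1 : s'.var 1 = q := (hF.var 1 (by simp [Stmt.vars])).trans (by simp [h1])
    have e2 : s'.var 2 = r := (hF.var 2 (by simp [Stmt.vars])).trans (by simp [h2])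
    have e3 : s'.var 3 = l := (hF.var 3 (by simp [Stmt.vars])).trans (by simp [h3])
    have e4 : s'.var 4 = k := (hF.var 4 (by simp [Stmt.vars])).trans (by simp [h4])
    have a3 : s'.arr 3 = s.arr 3 := hF.arr 3 (by simp [Stmt.arrs])
    have a7 : s'.arr 7 = s.arr 7 := hF.arr 7 (by simp [Stmt.arrs])
    have a8 : s'.arr 8 = s.arr 8 := hF.arr 8 (by simp [Stmt.arrs])
    have a9 : s'.arr 9 = s.arr 9 := hF.arr 9 (by simp [Stmt.arrs])
    have a10 : s'.arr 10 = s.arr 10 := hF.arr 10 (by simp [Stmt.arrs])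
    have a11 : s'.arr 11 = s.arr 11 := hF.arr 11 (by simp [Stmt.arrs])
    obtain ⟨d1, d2, d3, d4⟩ := div_mod_lt ht
    obtain ⟨i, hi⟩ : ∃ i, t / r = i := ⟨_, rfl⟩
    obtain ⟨j, hj⟩ : ∃ j, t % r = j := ⟨_, rfl⟩
    rw [hi] at d1 d3 d4
    rw [hj] at d2 d3 d4
    have ha1 := hclp i d1
    obtain ⟨hb1, hb2⟩ := hclr j d2
    have hdi := hdiff i (by omega)
    have hdj := hdiff (p + j) (by omega)
    obtain ⟨a, hae⟩ : ∃ a, s.arr 7 i = a := ⟨_, rfl⟩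
    obtain ⟨b, hbe⟩ : ∃ b, s.arr 7 (p + j) = l + b := ⟨s.arr 7 (p + j) - l, by omega⟩
    rw [hae] at ha1 hdi
    rw [hbe] at hb1 hb2 hdj
    have hu := hctr a (by omega)
    have hw := hctr (l + b) hb2
    have htb := htab a ha1 b (by omega)
    obtain ⟨u, hue⟩ : ∃ u, s.arr 8 a = u := ⟨_, rfl⟩
    obtain ⟨w, hwe⟩ : ∃ w, s.arr 8 (l + b) = w := ⟨_, rfl⟩
    rw [hue] at hu hdi htb
    rw [hwe] at hw hdj htb
    have k1 : u * q ≤ (p + r) * q := Nat.mul_le_mul_right _ hu.le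
    have k2 : w * q ≤ (p + r) * q := Nat.mul_le_mul_right _ hw.le
    have k3 : i * q ≤ (p + r) * q := Nat.mul_le_mul_right _ (by omega)
    have k4 : (p + j) * q ≤ (p + r) * q := Nat.mul_le_mul_right _ (by omega)
    have k5 := add_mul_lt ha1 (show b < k by omega)
    have k6 : l * k ≤ p * r := Nat.mul_le_mul hlp hkr
    have hdot : dot (s.arr 3) q u w ≤ q := by
      unfold dot
      simpa using sum_range_le (c := 1) fun j hj =>
        mul_le_one' (hx _ hu j hj) (hx _ hw j hj)
    have hci := hdi.cnt_le
    have hcj := hdj.cnt_le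
    have k7 : l + b - l = b := by omega
    simp only [wp_seq, wp_set, Ex.ok, Ex.eval, opVal, Ex.cost, hxt, e0, e1, e2, e3, e4, setVar_var,
      setVar_arr, a7, a8, a9, a11, d4, hi, hue, hwe, hae, hbe, htb, k7, hlim7, hlim8, hlim9, hlim11,
      if_true, OfNat.one_ne_ofNat, OfNat.zero_ne_ofNat, Nat.reduceEqDiff, if_false]
    refine ⟨by omega, ⟨⟨by omega, by omega⟩, ⟨by omega, by omega⟩, by omega⟩, by omega, by omega,
      ⟨⟨by omega, by omega⟩, ⟨⟨by omega, by omega⟩, ⟨⟨by omega, by omega⟩, ⟨by omega, by omega⟩,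
        by omega⟩, by omega⟩, by omega⟩, by omega, by omega,
      ⟨by omega, ⟨by omega, by omega⟩, by omega⟩, by omega, by omega,
      ⟨by omega, ⟨by omega, by omega⟩, by omega⟩, by omega, by omega,
      ⟨by omega, ⟨⟨⟨by omega, by omega⟩, ⟨by omega, by omega⟩, by omega⟩, ⟨⟨by omega, by omega⟩,
        ⟨by omega, by omega⟩, by omega⟩, by omega⟩, by omega⟩, by omega, by omega,
      ⟨⟨by omega, ⟨by omega, by omega⟩, by omega⟩, ⟨by omega, by omega⟩, by omega⟩, by omega,
      by omega,
      ⟨⟨by omega, ⟨by omega, by omega⟩, by omega⟩, ⟨by omega, by omega⟩, by omega⟩, by omega,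
      by omega, ⟨⟨by omega, by omega⟩, ⟨by omega, by omega⟩, by omega⟩, by omega,
      by omega, ⟨⟨by omega, by omega⟩, ⟨by omega, by omega⟩, by omega⟩, by omega,
      by omega, ⟨by omega, ⟨by omega, by omega⟩, by omega⟩, by omega,
      by omega, ⟨by omega, ⟨by omega, by omega⟩, by omega⟩, by omega,
      by omega, by omega, by omega, ?_⟩
    refine wp_mono (wp_corrSum (n := p + r) (q := q) (u := i) (w := p + j) (v := i)
      (cnt := s.arr 9 i) (by simp) (by simp) (by simp) (by simp) (by omega) (by omega) (by omega)
      hL (by omega) (by omega) (by omega) hci (by omega) (by simpa [a10] using hdi.pos_lt)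
      (by simpa [a3] using hx) (by simp; omega)) ?_
    rintro s1 ⟨m1, m1', m2, m3, m4⟩
    simp only [setVar_var, setVar_arr, setVar_time, a3, a10, if_true, Nat.reduceEqDiff,
      if_false] at m1 m1' m3 m4
    have o1 : ∀ z ∈ [13, 14, 15, 16, 17, 18, 19, 7], s1.var z = _ := fun z hz =>
      m2 z (by rintro rfl; simp at hz) (by rintro rfl; simp at hz)
    have o13 : s1.var 13 = u * q := (o1 13 (by simp)).trans (by simp)
    have o14 : s1.var 14 = w * q := (o1 14 (by simp)).trans (by simp)
    have o15 : s1.var 15 = i * q := (o1 15 (by simp)).trans (by simp)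
    have o16 : s1.var 16 = (p + j) * q := (o1 16 (by simp)).trans (by simp)
    have o17 : s1.var 17 = s.arr 9 i := (o1 17 (by simp)).trans (by simp)
    have o18 : s1.var 18 = s.arr 9 (p + j) := (o1 18 (by simp)).trans (by simp)
    have o19 : s1.var 19 = 0 := (o1 19 (by simp)).trans (by simp)
    have o7 : s1.var 7 = t := (o1 7 (by simp)).trans (by simp [hxt])
    clear o1 m2
    have c3 : s1.arr 3 = s.arr 3 := by rw [m3, a3]
    have c10 : s1.arr 10 = s.arr 10 := by rw [m3, a10]
    rw [wp_seq]
    refine wp_mono (wp_corrSum (n := p + r) (q := q) (u := u) (w := p + j) (v := p + j)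
      (cnt := s.arr 9 (p + j)) o13 o16 o16 o18 (by omega) (by omega) (by omega)
      hL (by omega) (by omega) (by omega) hcj (by omega) (by simpa [c10] using hdj.pos_lt)
      (by simpa [c3] using hx) (by omega)) ?_
    rintro s2 ⟨n1, n1', n2, n3, n4⟩
    rw [c3, c10] at n1
    rw [wp_seq]
    refine wp_mono (wp_corrSum (n := p + r) (q := q) (u := u) (w := p + j) (v := i)
      (cnt := s.arr 9 i) (by rw [n2 13 (by omega) (by omega), o13])
      (by rw [n2 16 (by omega) (by omega), o16]) (by rw [n2 15 (by omega) (by omega), o15])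
      (by rw [n2 17 (by omega) (by omega), o17]) (by omega) (by omega) (by omega)
      hL (by omega) (by omega) (by omega) hci (by omega) (by simpa [n3, c10] using hdi.pos_lt)
      (by simpa [n3, c3] using hx) (by rw [n2 19 (by omega) (by omega), o19]; omega)) ?_
    rintro s3 ⟨q1, q1', q2, q3, q4⟩
    rw [n3, c3, c10, n2 19 (by omega) (by omega), o19] at q1
    rw [n2 19 (by omega) (by omega), o19] at q1'
    rw [wp_seq]
    refine wp_mono (wp_corrSum (n := p + r) (q := q) (u := u) (w := w) (v := p + j)
      (cnt := s.arr 9 (p + j)) (by rw [q2 13 (by omega) (by omega), n2 13 (by omega) (by omega), o13])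
      (by rw [q2 14 (by omega) (by omega), n2 14 (by omega) (by omega), o14])
      (by rw [q2 16 (by omega) (by omega), n2 16 (by omega) (by omega), o16])
      (by rw [q2 18 (by omega) (by omega), n2 18 (by omega) (by omega), o18])
      (by omega) (by omega) (by omega)
      hL (by omega) (by omega) (by omega) hcj (by omega) (by simpa [q3, n3, c10] using hdj.pos_lt)
      (by simpa [q3, n3, c3] using hx) (by omega)) ?_
    rintro s4 ⟨r1, r1', r2, r3, r4⟩
    rw [q3, n3, c3, c10, q1] at r1
    have v7 : s4.var 7 = t := by
      rw [r2 7 (by omega) (by omega), q2 7 (by omega) (by omega), n2 7 (by omega) (by omega), o7]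
    have v12 : s4.var 12 = s2.var 12 := by
      rw [r2 12 (by omega) (by omega), q2 12 (by omega) (by omega)]
    have ar : s4.arr 2 = s'.arr 2 := by rw [r3, q3, n3, m3]
    -- Truncated subtraction is exact here: by `dot_correction` the minuend is the subtrahend plus
    -- an inner product.
    have hfin : s4.var 12 - s4.var 19 = dot (s.arr 3) q i (p + j) := by
      have := dot_correction hdi hdj
      rw [v12, n1, m1, r1]
      omega
    have hlt : s4.var 12 - s4.var 19 < Γ.L := by omega
    simp only [wp_st, Ex.ok, Ex.eval, opVal, Ex.cost, v7, hlim2, setArr_arr, setArr_time, if_true,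
      ar, zero_add, hi, hj, hfin]
    rw [hfin] at hlt
    exact ⟨by omega, ⟨by omega, by omega⟩, ⟨⟨by omega, by omega⟩, ⟨by omega, by omega⟩, by omega⟩,
      by omega, trivial, by omega⟩
  · rintro s2 ⟨h5, ht⟩
    simp only [setVar_time] at ht
    refine ⟨fun a ha b hb => ?_, ?_⟩
    · have := add_mul_lt ha hb
      have hm0 : 0 < r := by omega
      have ev : (a * r + b) / r = a := by
        rw [mul_comm, Nat.mul_add_div hm0, Nat.div_eq_of_lt hb, add_zero]
      have em : (a * r + b) % r = b := by
        rw [mul_comm, Nat.mul_add_mod, Nat.mod_eq_of_lt hb]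
      rw [h5, if_pos (by omega), Nat.sub_zero, ev, em]
    · have : ∑ t ∈ Finset.range (p * r),
          (190 + 100 * s.arr 9 (t / r) + 100 * s.arr 9 (p + t % r) + 3) ≤
        ∑ t ∈ Finset.range (p * r), (200 + 100 * s.arr 9 (t / r) + 100 * s.arr 9 (p + t % r)) :=
        Finset.sum_le_sum fun _ _ => by omega
      omega

/-! ## The whole program -/

/-- The matrix product by clustering, with `C` times the logarithm of the number of points many
random points for the sketches. -/
def mainStmt (C : ℕ) : Stmt :=
  sizeStmt C ;; coinsStmt ;; pointsStmt ;; sketchStmt ;;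
  .set 20 (.lit 0) ;; .set 21 (.var 0) ;; .set 22 (.lit 0) ;; .set 23 (.var 3) ;; centersStmt ;;
  .set 20 (.var 0) ;; .set 21 (.var 2) ;; .set 22 (.var 3) ;; .set 23 (.var 4) ;; centersStmt ;;
  diffStmt ;; tableStmt ;; outStmt

/-- Needed for two changes: sketch distances in memory agree with `estDist` only on actual points,
and the clustering of the columns later writes to other parts of the arrays that describe the row
clusters. -/
lemma FarthestPoint.congr {d d' : ℕ → ℕ → ℕ} {lo sz clo kk : ℕ} {ctr cl ctr' cl' : ℕ → ℕ}
    (h : FarthestPoint d lo sz clo kk ctr cl)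
    (hd : ∀ u v, u < lo + sz → v < lo + sz → d' u v = d u v)
    (hctr : ∀ e < kk, ctr' (clo + e) = ctr (clo + e))
    (hcl : ∀ v < sz, cl' (lo + v) = cl (lo + v)) : FarthestPoint d' lo sz clo kk ctr' cl' where
  ctr_mem e he := by rw [hctr e he]; exact h.ctr_mem e he
  cl_mem v hv := by rw [hcl v hv]; exact h.cl_mem v hv
  radius := by
    obtain ⟨R, far, h1, h2, h3, h4, h5⟩ := h.radius
    refine ⟨R, far, h1, h2, fun v hv => ?_, fun e he => ?_, fun e he e' he' => ?_⟩
    · obtain ⟨e, he, hce⟩ := h.cl_mem v hv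
      have := h3 v hv
      rw [hcl v hv, hce, hctr e he, hd _ _ (by omega) (h.ctr_mem e he).2]
      rwa [hce] at this
    · rw [hctr e he, hd _ _ h2 (h.ctr_mem e he).2]
      exact h4 e he
    · rw [hctr e he, hctr e' (by omega), hd _ _ (h.ctr_mem e he).2 (h.ctr_mem e' (by omega)).2]
      exact h5 e he e' he'

/-- The estimated distance of the points `x u` and `x v` from the random bits `ω`. -/
def estDist (ω : ℕ → Bool) (x : ℕ → ℕ → ℕ) (m q u v : ℕ) : ℕ :=
  ∑ i ∈ Finset.range m, absDiff (∑ j ∈ Finset.range q, absDiff (ω (i * q + j)).toNat (x u j))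
    (∑ j ∈ Finset.range q, absDiff (ω (i * q + j)).toNat (x v j))

/-- What the main program achieves on points `x 0, …, x (p + r - 1)` in final state `s'`. -/
structure MainPost (ω : ℕ → Bool) (C p q r l k : ℕ) (x : ℕ → ℕ → ℕ) (s s' : St) : Prop where
  out : ∀ i < p, ∀ j < r, s'.arr 2 (i * r + j) = ∑ z ∈ Finset.range q, x i z * x (p + j) z
  clusters : ∃ (τ : ℕ) (ctr cl cnt : ℕ → ℕ), p + r ≤ 2 ^ τ ∧ 2 ^ τ < 2 * (p + r) ∧
    FarthestPoint (estDist ω x (C * τ) q) 0 p 0 l ctr cl ∧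
    FarthestPoint (estDist ω x (C * τ) q) p r l k ctr cl ∧
    (∀ v < p + r, cnt v =
      ∑ j ∈ Finset.range q, if x v j = x (ctr (cl v)) j then 0 else 1) ∧
    s'.time ≤ s.time + 300 + 200 * ((p + r) * (q + 1) + C * τ * q + (p + r) * (C * τ) * (q + 1) +
      l * p * (C * τ + 1) + k * r * (C * τ + 1) + l * k * (q + 1)) +
      ∑ t ∈ Finset.range (p * r), (200 + 100 * cnt (t / r) + 100 * cnt (p + t % r))

/-- This holds for each fixed `ω`, without any probability. Since `Γ.L` is at least the square of a
number exceeding all parameters, every product formed by the program fits into a word; the time is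
the sum of the bounds of the stages. -/
lemma wp_mainStmt {Γ : Layout} {ω : ℕ → Bool} {s : St} {C p q r l k : ℕ} {x : ℕ → ℕ → ℕ}
    (h0 : s.var 0 = p) (h1 : s.var 1 = q) (h2 : s.var 2 = r) (h3 : s.var 3 = l) (h4 : s.var 4 = k)
    (hu : s.used = 0) (hl : 1 ≤ l) (hlp : l ≤ p) (hk : 1 ≤ k) (hkr : k ≤ r)
    (hΓ : (C * (p + r) + C + (p + r) + 5 * q + 10) ^ 2 ≤ Γ.L)
    (l0 : Γ.lim 0 = p * q) (l1 : Γ.lim 1 = q * r) (l2 : Γ.lim 2 = p * r)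
    (hx : ∀ v j, x v j ≤ 1) (hA : ∀ v < p, ∀ j < q, s.arr 0 (v * q + j) = x v j)
    (hB : ∀ v < r, ∀ j < q, s.arr 1 (j * r + v) = x (p + v) j) :
    wp Γ ω (mainStmt C) (MainPost ω C p q r l k x s) s := by
  obtain ⟨N, hN⟩ : ∃ N, N = C * (p + r) + C + (p + r) + 5 * q + 10 := ⟨_, rfl⟩
  rw [← hN] at hΓ
  have hL : ∀ a b c, a ≤ N → b ≤ N → 3 * c ≤ N → a * b ≤ Γ.L ∧ (10 ≤ b → a + c < Γ.L) := by
    intro a b c ha hb hc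
    have e1 : a * b ≤ N ^ 2 := by rw [pow_two]; exact Nat.mul_le_mul ha hb
    refine ⟨e1.trans hΓ, fun _ => ?_⟩
    have : 10 * N ≤ N ^ 2 := by rw [pow_two]; exact Nat.mul_le_mul_right _ (by omega)
    omega
  have hNL : 10 * N ≤ Γ.L := by
    have : 10 * N ≤ N ^ 2 := by rw [pow_two]; exact Nat.mul_le_mul_right _ (by omega)
    omega
  have hmul : ∀ a b, a + 5 ≤ N → b + 5 ≤ N → a * b + 3 * N < Γ.L := by
    intro a b ha hb
    obtain ⟨M, rfl⟩ : ∃ M, N = M + 5 := ⟨N - 5, by omega⟩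
    have e1 : a * b ≤ M * M := Nat.mul_le_mul (by omega) (by omega)
    have : (M + 5) ^ 2 = M * M + 10 * M + 25 := by ring
    omega
  clear hL
  unfold mainStmt
  rw [wp_seq]
  refine wp_mono (wp_frame (wp_sizeStmt h0 h2 (by omega) (by omega) (by omega) (by omega))) ?_
  rintro s1 ⟨⟨⟨τ, m5, hτ, hτ'⟩, m6, mu, mt⟩, F1⟩
  obtain ⟨m, hm⟩ : ∃ m, m = C * τ := ⟨_, rfl⟩
  rw [← hm] at m5
  -- Otherwise `2 ^ τ` would be at least `2 * 2 ^ (p + r)`, more than `2 * (p + r)`.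
  have hτn : τ ≤ p + r := by
    by_contra h
    have h1 : 2 ^ (p + r + 1) ≤ 2 ^ τ := Nat.pow_le_pow_right (by omega) (by omega)
    have h2 : p + r < 2 ^ (p + r) := Nat.lt_two_pow_self
    rw [pow_succ] at h1
    omega
  have hmn : m ≤ C * (p + r) := by rw [hm]; exact Nat.mul_le_mul_left _ hτn
  have g0 : s1.var 0 = p := (F1.var 0 (by simp [Stmt.vars, sizeStmt])).trans h0
  have g1 : s1.var 1 = q := (F1.var 1 (by simp [Stmt.vars, sizeStmt])).trans h1
  have g2 : s1.var 2 = r := (F1.var 2 (by simp [Stmt.vars, sizeStmt])).trans h2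
  have g3 : s1.var 3 = l := (F1.var 3 (by simp [Stmt.vars, sizeStmt])).trans h3
  have g4 : s1.var 4 = k := (F1.var 4 (by simp [Stmt.vars, sizeStmt])).trans h4
  have A1 : s1.arr = s.arr := funext fun a => F1.arr a (by simp [Stmt.arrs, sizeStmt])
  have hnq := hmul (p + r) q (by omega) (by omega)
  have hmq := hmul m q (by omega) (by omega)
  have hnm := hmul (p + r) m (by omega) (by omega)
  have hpr := hmul p r (by omega) (by omega)
  have hlk := hmul l k (by omega) (by omega)
  have hnq' : (p + r) * q = p * q + r * q := by ring
  have hqm' : q * m = m * q := mul_comm _ _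
  rw [wp_seq]
  refine wp_mono (wp_frame (wp_coinsStmt m5 g1 (mu.trans hu) (by omega) (by omega) (by omega)
    (by omega))) ?_
  rintro s2 ⟨⟨k4, kt⟩, F2⟩
  have fv : ∀ z ∈ [0, 1, 2, 3, 4, 5, 6], s2.var z = s1.var z := fun z hz =>
    F2.var z (by simp only [Stmt.vars, coinsStmt]; revert hz; revert z; decide)
  have fa : ∀ a ∈ [0, 1], s2.arr a = s1.arr a := fun a ha =>
    F2.arr a (by simp only [Stmt.arrs, coinsStmt]; revert ha; revert a; decide)
  rw [wp_seq]
  refine wp_mono (wp_frame (wp_pointsStmt (p := p) (q := q) (r := r)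
    (by rw [fv 0 (by simp), g0]) (by rw [fv 1 (by simp), g1]) (by rw [fv 2 (by simp), g2])
    (by omega) (by omega) (by omega) (by omega) l0 l1)) ?_
  rintro s3 ⟨⟨p1, p2, pt⟩, F3⟩
  have fv3 : ∀ z ∈ [0, 1, 2, 3, 4, 5, 6], s3.var z = s1.var z := fun z hz =>
    (F3.var z (by simp only [Stmt.vars, pointsStmt]; revert hz; revert z; decide)).trans (fv z hz)
  have X3 : ∀ v < p + r, ∀ j < q, s3.arr 3 (v * q + j) = x v j := by
    intro v hv j hj
    by_cases hvp : v < p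
    · rw [p1 v hvp j hj, fa 0 (by simp), A1, hA v hvp j hj]
    · obtain ⟨v', rfl⟩ : ∃ v', v = p + v' := ⟨v - p, by omega⟩
      rw [p2 v' (by omega) j hj, fa 1 (by simp), A1, hB v' (by omega) j hj]
  have B3 : ∀ i < m, ∀ j < q, s3.arr 4 (i * q + j) = (ω (i * q + j)).toNat := by
    intro i hi j hj
    rw [F3.arr 4 (by simp [Stmt.arrs, pointsStmt]), k4 _ (add_mul_lt hi hj)]
  rw [wp_seq]
  refine wp_mono (wp_frame (wp_sketchStmt (m := m) (n := p + r) (q := q)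
    (by rw [fv3 5 (by simp), m5]) (by rw [fv3 6 (by simp), m6]) (by rw [fv3 1 (by simp), g1])
    (by omega) (by omega) (by omega) (by omega) (by omega) (by omega)
    (fun v hv j hj => by rw [X3 v hv j hj]; exact hx v j)
    (fun v hv j hj => by rw [B3 v hv j hj]; exact Bool.toNat_le _))) ?_
  rintro s4 ⟨⟨z5, zt⟩, F4⟩
  have fv4 : ∀ z ∈ [0, 1, 2, 3, 4, 5, 6], s4.var z = s1.var z := fun z hz =>
    (F4.var z (by simp only [Stmt.vars, sketchStmt]; revert hz; revert z; decide)).trans (fv3 z hz)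
  have X4 : s4.arr 3 = s3.arr 3 := F4.arr 3 (by simp [Stmt.arrs, sketchStmt])
  have S4 : ∀ u < p + r, ∀ i < m, s4.arr 5 (u * m + i) =
      ∑ j ∈ Finset.range q, absDiff (ω (i * q + j)).toNat (x u j) := by
    intro u hu' i hi
    rw [z5 u hu' i hi]
    refine Finset.sum_congr rfl fun j hj => ?_
    rw [B3 i hi j (Finset.mem_range.mp hj), X3 u hu' j (Finset.mem_range.mp hj)]
  have S4q : ∀ u < p + r, ∀ i < m, s4.arr 5 (u * m + i) ≤ q := by
    intro u hu' i hi
    rw [S4 u hu' i hi]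
    simpa using sum_range_le (c := 1) fun j hj => absDiff_le_one (Bool.toNat_le _) (hx u j)
  have D4 : ∀ u v, u < p + r → v < p + r →
      estDist ω x m q u v = sketchDist (s4.arr 5) m u v := by
    intro u v hu' hv'
    refine Finset.sum_congr rfl fun i hi => ?_
    rw [S4 u hu' i (Finset.mem_range.mp hi), S4 v hv' i (Finset.mem_range.mp hi)]
  clear z5 k4 p1 p2
  simp only [wp_seq, wp_set, Ex.ok, Ex.eval, Ex.cost, setVar_var, fv4 0 (by simp), g0,
    fv4 3 (by simp), g3, Nat.reduceEqDiff, if_false, OfNat.zero_ne_ofNat]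
  refine ⟨by omega, by omega, by omega, by omega, ⟨by omega, by omega⟩, by omega,
    by omega, by omega, by omega, by omega, ⟨by omega, by omega⟩, by omega, ?_⟩
  refine wp_mono (wp_frame (wp_centersStmt (m := m) (n := p + r) (q := q) (lo := 0) (sz := p)
    (clo := 0) (kk := l) (by simp [fv4 1, g1]) (by simp [fv4 5, m5]) (by simp) (by simp) (by simp)
    (by simp) (by omega) (by omega) (by omega) (by omega) (by omega) (by omega) S4q (by omega)
    hl)) ?_
  rintro s5 ⟨⟨c1, c2, c3, ct⟩, F5⟩
  have fv5 : ∀ z ∈ [0, 1, 2, 3, 4, 5, 6], s5.var z = s1.var z := fun z hz => by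
    rw [← fv4 z hz, F5.var z (by
      simp only [Stmt.vars, centersStmt, scanStmt]; revert hz; revert z; decide)]
    revert hz
    simp only [setVar_var, List.mem_cons, List.not_mem_nil, or_false]
    rintro (rfl | rfl | rfl | rfl | rfl | rfl | rfl) <;> simp
  have fa5 : ∀ a ∈ [3, 5], s5.arr a = s4.arr a := fun a ha =>
    F5.arr a (by simp only [Stmt.arrs, centersStmt, scanStmt]; revert ha; revert a; decide)
  simp only [setVar_arr, setVar_time] at c1 c2 c3 ct
  simp only [wp_seq, wp_set, Ex.ok, Ex.eval, Ex.cost, setVar_var, fv5 0 (by simp), g0,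
    fv5 3 (by simp), g3, fv5 2 (by simp), g2, fv5 4 (by simp), g4, Nat.reduceEqDiff, if_false,
    OfNat.zero_ne_ofNat]
  refine ⟨by omega, ⟨by omega, by omega⟩, by omega, by omega, ⟨by omega, by omega⟩, by omega,
    by omega, ⟨by omega, by omega⟩, by omega, by omega, ⟨by omega, by omega⟩, by omega, ?_⟩
  refine wp_mono (wp_frame (wp_centersStmt (m := m) (n := p + r) (q := q) (lo := p) (sz := r)
    (clo := l) (kk := k) (by simp [fv5 1, g1]) (by simp [fv5 5, m5]) (by simp) (by simp) (by simp)
    (by simp) (by omega) (by omega) (by omega) (by omega) (by omega) (by omega)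
    (by simpa [fa5 5] using S4q) (by omega) hk)) ?_
  rintro s6 ⟨⟨d1, d2, d3, dt⟩, F6⟩
  have fv6 : ∀ z ∈ [0, 1, 2, 3, 4, 5, 6], s6.var z = s1.var z := fun z hz => by
    rw [← fv5 z hz, F6.var z (by
      simp only [Stmt.vars, centersStmt, scanStmt]; revert hz; revert z; decide)]
    revert hz
    simp only [setVar_var, List.mem_cons, List.not_mem_nil, or_false]
    rintro (rfl | rfl | rfl | rfl | rfl | rfl | rfl) <;> simp
  simp only [setVar_arr, setVar_time, fa5 5 (by simp)] at d1 d2 d3 dt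
  have X6 : s6.arr 3 = s3.arr 3 := by
    rw [F6.arr 3 (by simp [Stmt.arrs, centersStmt, scanStmt])]
    simp only [setVar_arr]
    rw [fa5 3 (by simp), X4]
  have FA : FarthestPoint (estDist ω x m q) 0 p 0 l (s6.arr 8) (s6.arr 7) :=
    c1.congr (fun u v hu' hv' => D4 u v (by omega) (by omega))
      (fun e he => d3 _ (by omega)) (fun v hv => d2 _ (by omega))
  have FB : FarthestPoint (estDist ω x m q) p r l k (s6.arr 8) (s6.arr 7) :=
    d1.congr (fun u v hu' hv' => D4 u v (by omega) (by omega))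
      (fun e he => rfl) (fun v hv => rfl)
  clear c1 c2 c3 d1 d2 d3
  have X6x : ∀ v < p + r, ∀ j < q, s6.arr 3 (v * q + j) = x v j := by rw [X6]; exact X3
  have hx6 : ∀ v < p + r, ∀ j < q, s6.arr 3 (v * q + j) ≤ 1 :=
    fun v hv j hj => by rw [X6x v hv j hj]; exact hx v j
  have clA : ∀ v < p, s6.arr 7 v < l := fun v hv => by
    obtain ⟨e, he, h⟩ := FA.cl_mem v hv
    simp only [zero_add] at h
    omega
  have clB : ∀ v < r, l ≤ s6.arr 7 (p + v) ∧ s6.arr 7 (p + v) < l + k := fun v hv => by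
    obtain ⟨e, he, h⟩ := FB.cl_mem v hv
    omega
  have clAB : ∀ v < p + r, s6.arr 7 v < l + k := fun v hv => by
    by_cases hvp : v < p
    · have := clA v hvp; omega
    · obtain ⟨v', rfl⟩ : ∃ v', v = p + v' := ⟨v - p, by omega⟩
      exact (clB v' (by omega)).2
  have ctrAB : ∀ e < l + k, s6.arr 8 e < p + r := fun e he => by
    by_cases hel : e < l
    · have := FA.ctr_mem e hel
      simp only [zero_add] at this
      omega
    · obtain ⟨e', rfl⟩ : ∃ e', e = l + e' := ⟨e - l, by omega⟩
      exact (FB.ctr_mem e' (by omega)).2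
  rw [wp_seq]
  refine wp_mono (wp_frame (wp_diffStmt (n := p + r) (q := q) (l := l + k)
    (by rw [fv6 1 (by simp), g1]) (by rw [fv6 6 (by simp), m6]) (by omega) (by omega) (by omega)
    hx6 clAB ctrAB (by omega))) ?_
  rintro s7 ⟨⟨e1, et⟩, F7⟩
  have fv7 : ∀ z ∈ [0, 1, 2, 3, 4, 5, 6], s7.var z = s1.var z := fun z hz =>
    (F7.var z (by simp only [Stmt.vars, diffStmt]; revert hz; revert z; decide)).trans (fv6 z hz)
  have fa7 : ∀ a ∈ [3, 7, 8], s7.arr a = s6.arr a := fun a ha =>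
    F7.arr a (by simp only [Stmt.arrs, diffStmt]; revert ha; revert a; decide)
  rw [wp_seq]
  refine wp_mono (wp_frame (wp_tableStmt (n := p + r) (q := q) (l := l) (k := k)
    (by rw [fv7 1 (by simp), g1]) (by rw [fv7 3 (by simp), g3]) (by rw [fv7 4 (by simp), g4])
    (by omega) (by omega) (by omega) (by omega) (by omega)
    (by rw [fa7 3 (by simp)]; exact hx6) (by rw [fa7 8 (by simp)]; exact ctrAB))) ?_
  rintro s8 ⟨⟨t1, tt⟩, F8⟩
  have fv8 : ∀ z ∈ [0, 1, 2, 3, 4, 5, 6], s8.var z = s1.var z := fun z hz =>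
    (F8.var z (by simp only [Stmt.vars, tableStmt]; revert hz; revert z; decide)).trans (fv7 z hz)
  have fa8 : ∀ a ∈ [3, 7, 8], s8.arr a = s6.arr a := fun a ha =>
    (F8.arr a (by simp only [Stmt.arrs, tableStmt]; revert ha; revert a; decide)).trans (fa7 a ha)
  have a9 : s8.arr 9 = s7.arr 9 := F8.arr 9 (by simp [Stmt.arrs, tableStmt])
  have a10 : s8.arr 10 = s7.arr 10 := F8.arr 10 (by simp [Stmt.arrs, tableStmt])
  refine wp_mono (wp_outStmt (p := p) (q := q) (r := r) (l := l) (k := k)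
    (by rw [fv8 0 (by simp), g0]) (by rw [fv8 1 (by simp), g1]) (by rw [fv8 2 (by simp), g2])
    (by rw [fv8 3 (by simp), g3]) (by rw [fv8 4 (by simp), g4]) (by omega) (by omega) (by omega)
    hlp hkr (by omega) l2 (by rw [fa8 3 (by simp)]; exact hx6)
    (by rw [fa8 8 (by simp)]; exact ctrAB) (by rw [fa8 7 (by simp)]; exact clA)
    (by rw [fa8 7 (by simp)]; exact clB)
    (by rw [fa8 3 (by simp), fa8 8 (by simp), ← fa7 3 (by simp), ← fa7 8 (by simp)]; exact t1)
    (by rw [fa8 3 (by simp), fa8 8 (by simp), fa8 7 (by simp), a9, a10]; exact e1)) ?_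
  rintro s9 ⟨o1, ot⟩
  rw [fa8 3 (by simp)] at o1
  refine ⟨fun i hi j hj => ?_, τ, s6.arr 8, s6.arr 7, s8.arr 9, hτ, hτ', hm ▸ FA, hm ▸ FB, ?_, ?_⟩
  · rw [o1 i hi j hj]
    refine Finset.sum_congr rfl fun z hz => ?_
    rw [X6x i (by omega) z (Finset.mem_range.mp hz),
      X6x (p + j) (by omega) z (Finset.mem_range.mp hz)]
  · intro v hv
    have := (e1 v hv).sum_eq fun _ => 1
    rw [Finset.sum_const, Finset.card_range, smul_eq_mul, mul_one] at this
    rw [a9, this]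
    refine Finset.sum_congr rfl fun z hz => ?_
    rw [X6x v hv z (Finset.mem_range.mp hz),
      X6x _ (ctrAB _ (clAB v hv)) z (Finset.mem_range.mp hz)]
  · rw [← hm]
    generalize ∑ t ∈ Finset.range (p * r),
      (200 + 100 * s8.arr 9 (t / r) + 100 * s8.arr 9 (p + t % r)) = S at ot ⊢
    have w1 : s9.time ≤ s.time + 220 + (p + r) * 15 + m * q * 15 + (p + r) * q * 50 +
      (p + r) * m * (70 + q * 50) + (p * 30 + l * (60 + p * (100 + m * 60))) +
      (r * 30 + k * (60 + r * (100 + m * 60))) + (p + r) * (60 + q * 80) +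
      l * k * (70 + q * 50) + S := by omega
    refine w1.trans ?_
    -- The overhead per center is absorbed by the cost of its scan, which visits at least one point.
    have w2 : l ≤ l * p := Nat.le_mul_of_pos_right _ (by omega)
    have w3 : k ≤ k * r := Nat.le_mul_of_pos_right _ (by omega)
    have w4 : 0 ≤ l * p * m := Nat.zero_le _
    ring_nf
    ring_nf at w2 w3
    omega

/-! ## Random sketches preserve distances -/

open Finset in
-- Chernoff's bound in counting form: a sum over independent blocks turns the exponential moment
-- into an `m`-th power. With a negative multiple of a statistic as `f` it also bounds lower tails.
lemma card_mul_exp_le {κ : Type*} [Fintype κ] [DecidableEq κ] (m : ℕ) (f : κ → ℝ) (θ : ℝ)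
    (S : Finset (Fin m → κ)) (hS : ∀ b ∈ S, θ ≤ ∑ i, f (b i)) :
    (#S : ℝ) * Real.exp θ ≤ (∑ c, Real.exp (f c)) ^ m := by
  calc (#S : ℝ) * Real.exp θ = ∑ _b ∈ S, Real.exp θ := by simp
    _ ≤ ∑ b ∈ S, Real.exp (∑ i, f (b i)) :=
        Finset.sum_le_sum fun b hb => Real.exp_le_exp.mpr (hS b hb)
    _ ≤ ∑ b : Fin m → κ, Real.exp (∑ i, f (b i)) :=
        Finset.sum_le_univ_sum_of_nonneg fun _ => (Real.exp_pos _).le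
    _ = ∑ b : Fin m → κ, ∏ i, Real.exp (f (b i)) := by simp [Real.exp_sum]
    _ = (∑ c, Real.exp (f c)) ^ m := by
        rw [← Fintype.piFinset_univ, ← Finset.prod_univ_sum (fun _ => univ)
          (fun _ c => Real.exp (f c))]
        simp

/-- The difference of the distances of `c` to `x` and to `y`. -/
noncomputable def distGap {q : ℕ} (x y c : Fin q → Bool) : ℝ :=
  ∑ j, ((absDiff (c j).toNat (x j).toNat : ℝ) - absDiff (c j).toNat (y j).toNat)

open Finset in
-- The sum factors over the coordinates: a coordinate where `x` and `y` agree gives `2`, one where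
-- they differ gives `exp z + exp (-z) = 2 cosh z`. Complex `z` covers the exponential moments for
-- the upper tail and the cosine moments for the lower tail in one computation.
lemma sum_cexp_distGap {q : ℕ} (x y : Fin q → Bool) (z : ℂ) :
    ∑ c, Complex.exp (z * distGap x y c) = 2 ^ q * Complex.cosh z ^ hammingDist x y := by
  have h1 : ∀ c : Fin q → Bool, Complex.exp (z * distGap x y c) = ∏ j, Complex.exp (z *
      (((absDiff (c j).toNat (x j).toNat : ℝ) - absDiff (c j).toNat (y j).toNat : ℝ) : ℂ)) := by
    intro c
    rw [← Complex.exp_sum, distGap, Complex.ofReal_sum, Finset.mul_sum]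
  simp_rw [h1]
  rw [← Fintype.piFinset_univ, ← Finset.prod_univ_sum (fun _ => univ) (fun j b => Complex.exp (z *
      (((absDiff (Bool.toNat b) (x j).toNat : ℝ) - absDiff (Bool.toNat b) (y j).toNat : ℝ) : ℂ)))]
  have h2 : ∀ j, ∑ b : Bool, Complex.exp (z *
      (((absDiff (Bool.toNat b) (x j).toNat : ℝ) - absDiff (Bool.toNat b) (y j).toNat : ℝ) : ℂ))
      = 2 * (if x j ≠ y j then Complex.cosh z else 1) := by
    intro j
    rw [Complex.cosh]
    cases x j <;> cases y j <;> simp [absDiff] <;> ring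
  simp_rw [h2]
  rw [Finset.prod_mul_distrib, Finset.prod_ite]
  simp [hammingDist]

lemma sum_exp_distGap {q : ℕ} (x y : Fin q → Bool) (s : ℝ) :
    ∑ c, Real.exp (s * distGap x y c) = 2 ^ q * Real.cosh s ^ hammingDist x y := by
  have h := sum_cexp_distGap x y s
  exact_mod_cast h

/-- The case `z = s * I` of the preceding formula, with `cosh (s * I) = cos s` and real parts taken.
-/
lemma sum_cos_distGap {q : ℕ} (x y : Fin q → Bool) (s : ℝ) :
    ∑ c, Real.cos (s * distGap x y c) = 2 ^ q * Real.cos s ^ hammingDist x y := by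
  have h := congrArg Complex.re (sum_cexp_distGap x y (s * Complex.I))
  rw [Complex.cosh_mul_I, Complex.re_sum] at h
  have e : (2 ^ q * Complex.cos s ^ hammingDist x y : ℂ) =
      ((2 ^ q * Real.cos s ^ hammingDist x y : ℝ) : ℂ) := by push_cast; rfl
  rw [e, Complex.ofReal_re] at h
  rw [← h]
  refine Finset.sum_congr rfl fun c _ => ?_
  rw [show (s : ℂ) * Complex.I * distGap x y c = ((s * distGap x y c : ℝ) : ℂ) * Complex.I by
    push_cast; ring, Complex.exp_ofReal_mul_I_re]

/-- Replacing `exp (s|g|)` by `exp (s g) + exp (-s g)` removes the absolute value at the price of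
the factor `2`; then `cosh s ≤ exp (s² / 2)`. -/
lemma sum_exp_abs_distGap_le {q : ℕ} (x y : Fin q → Bool) (s : ℝ) :
    ∑ c, Real.exp (s * |distGap x y c|) ≤
      2 ^ q * (2 * Real.exp (s ^ 2 / 2) ^ hammingDist x y) := by
  calc ∑ c, Real.exp (s * |distGap x y c|)
      ≤ ∑ c, (Real.exp (s * distGap x y c) + Real.exp (-s * distGap x y c)) := by
        refine Finset.sum_le_sum fun c _ => ?_
        rcases abs_choice (distGap x y c) with h | h <;> rw [h]
        · linarith [Real.exp_pos (-s * distGap x y c)]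
        · rw [show s * -distGap x y c = -s * distGap x y c by ring]
          linarith [Real.exp_pos (s * distGap x y c)]
    _ = 2 ^ q * (2 * Real.cosh s ^ hammingDist x y) := by
        rw [Finset.sum_add_distrib, sum_exp_distGap, sum_exp_distGap, Real.cosh_neg]; ring
    _ ≤ _ := by
        have := Real.cosh_le_exp_half_sq s
        have := (Real.cosh_pos s).le
        gcongr

/-- A function of `|t|` is majorized by a combination of `1` and `cos t`, whose averages are
explicit. For `t ≤ 1` one uses `1 - cos t ≤ t² / 2`; for larger `t` the right side is at least
`1/2`, while `1 / (1 + t) ≤ 1/2`. -/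
lemma exp_neg_le_cos (t : ℝ) (ht : 0 ≤ t) : Real.exp (-t) ≤ 1 - (1 - Real.cos t) / 4 := by
  have h1 : Real.exp (-t) ≤ 1 / (1 + t) := by
    rw [Real.exp_neg, ← one_div]
    exact one_div_le_one_div_of_le (by linarith) (by linarith [Real.add_one_le_exp t])
  refine h1.trans ?_
  rw [div_le_iff₀ (by linarith)]
  have h2 := Real.one_sub_sq_div_two_le_cos (x := t)
  have h3 := Real.neg_one_le_cos t
  have h4 := Real.cos_le_one t
  by_cases h : t ≤ 1
  · nlinarith
  · nlinarith

/-- At scale `√h` the walk is not concentrated at `0`: the average of `cos (g / √h)` is `cos (1 /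
√h) ^ h`, at most `exp (-1/4) ≤ 4/5`. With `exp_neg_le_cos` this gives `3/4 + (1/4) * (4/5) =
19/20`. -/
lemma sum_exp_neg_abs_distGap_le {q : ℕ} (x y : Fin q → Bool) (h : x ≠ y) :
    ∑ c, Real.exp (-(1 / √(hammingDist x y)) * |distGap x y c|) ≤ 2 ^ q * (19 / 20) := by
  have hh : (1 : ℝ) ≤ hammingDist x y := by exact_mod_cast hammingDist_pos.mpr h
  set s := 1 / √(hammingDist x y : ℝ) with hs
  have hsq : 1 ≤ √(hammingDist x y : ℝ) := Real.one_le_sqrt.mpr hh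
  have s0 : 0 < s := by positivity
  have s1 : s ≤ 1 := by rw [hs, div_le_one (by linarith)]; exact hsq
  have s2 : s ^ 2 * hammingDist x y = 1 := by
    rw [hs, div_pow, Real.sq_sqrt (by linarith), one_pow, one_div_mul_cancel (by linarith)]
  -- Since `s ≤ 1`, the quartic error in the Taylor bound is at most a small multiple of `s²`, so
  -- `cos s ≤ 1 - s² / 4`.
  have hc : Real.cos s ≤ Real.exp (-(s ^ 2 / 4)) := by
    have h1 := Real.cos_bound (x := s) (by rwa [abs_of_pos s0])
    rw [abs_of_pos s0] at h1
    have h2 := (abs_le.mp h1).2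
    have h3 : s ^ 4 ≤ s ^ 2 := pow_le_pow_of_le_one s0.le s1 (by norm_num)
    have h4 := Real.add_one_le_exp (-(s ^ 2 / 4))
    nlinarith
  have hc0 : 0 ≤ Real.cos s := Real.cos_nonneg_of_neg_pi_div_two_le_of_le
    (by linarith [Real.pi_gt_three]) (by linarith [Real.pi_gt_three])
  have hpow : Real.cos s ^ hammingDist x y ≤ 4 / 5 := by
    calc Real.cos s ^ hammingDist x y ≤ Real.exp (-(s ^ 2 / 4)) ^ hammingDist x y := by gcongr
      _ = Real.exp (-(1 / 4)) := by
          rw [← Real.exp_nat_mul]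
          congr 1
          linarith
      _ ≤ 4 / 5 := by
          rw [Real.exp_neg, inv_le_comm₀ (Real.exp_pos _) (by norm_num)]
          have := Real.add_one_le_exp (1 / 4)
          linarith
  calc ∑ c, Real.exp (-s * |distGap x y c|)
      ≤ ∑ c, (3 / 4 + 1 / 4 * Real.cos (s * distGap x y c)) := by
        refine Finset.sum_le_sum fun c _ => ?_
        have := exp_neg_le_cos (s * |distGap x y c|) (by positivity)
        rw [neg_mul]
        refine this.trans ?_
        rcases abs_choice (distGap x y c) with h | h <;> rw [h]
        · linarith
        · rw [mul_neg, Real.cos_neg]; linarith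
    _ = 2 ^ q * (3 / 4 + 1 / 4 * Real.cos s ^ hammingDist x y) := by
        rw [Finset.sum_add_distrib, ← Finset.mul_sum, sum_cos_distGap]
        simp
        ring
    _ ≤ _ := by
        gcongr
        linarith

/-- The ratio in the tail bounds. -/
noncomputable def tailRatio : ℝ := 38 / 39

open Finset in
-- The moment `19/20` per block is compared with the threshold factor `exp (-1/40) ≥ 39/40`; the
-- quotient is `38/39`, which is the origin of `tailRatio`.
lemma card_lower_tail {q m : ℕ} (x y : Fin q → Bool) (h : x ≠ y) :
    (#{b : Fin m → Fin q → Bool | ∑ i, |distGap x y (b i)| < m * √(hammingDist x y) / 40} : ℝ) ≤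
      2 ^ (m * q) * tailRatio ^ m := by
  have hh : (1 : ℝ) ≤ hammingDist x y := by exact_mod_cast hammingDist_pos.mpr h
  have hsq : 0 < √(hammingDist x y : ℝ) := Real.sqrt_pos.mpr (by linarith)
  have key := card_mul_exp_le m (fun c => -(1 / √(hammingDist x y)) * |distGap x y c|)
    (-(1 / 40) * m) {b : Fin m → Fin q → Bool | ∑ i, |distGap x y (b i)| <
      m * √(hammingDist x y) / 40} (by
      intro b hb
      rw [Finset.mem_filter] at hb
      rw [← Finset.mul_sum]
      have : (1 / √(hammingDist x y)) * ∑ i, |distGap x y (b i)| ≤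
          (1 / √(hammingDist x y)) * (m * √(hammingDist x y) / 40) := by
        gcongr
        exact hb.2.le
      rw [show (1 / √(hammingDist x y)) * (m * √(hammingDist x y) / 40) = (m : ℝ) / 40 by
        field_simp] at this
      linarith)
  have hb := pow_le_pow_left₀ (Finset.sum_nonneg fun c _ => (Real.exp_pos _).le)
    (sum_exp_neg_abs_distGap_le x y h) m
  have hE : Real.exp (-(1 / 40) * m) = Real.exp (-(1 / 40)) ^ m := by
    rw [← Real.exp_nat_mul]; ring_nf
  have hexp : 39 / 40 ≤ Real.exp (-(1 / 40)) := by
    have := Real.add_one_le_exp (-(1 / 40) : ℝ)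
    linarith
  rw [hE] at key
  have hpos : (0 : ℝ) < (39 / 40) ^ m := by positivity
  rw [← mul_le_mul_iff_left₀ hpos]
  calc _ ≤ _ * Real.exp (-(1 / 40)) ^ m := by gcongr
    _ ≤ _ := key.trans hb
    _ = _ := by
      rw [tailRatio, mul_assoc, ← mul_pow, mul_pow, ← pow_mul, mul_comm q m]
      norm_num

open Finset in
-- For `s = 1 / √h` the moment per block is at most `2 exp (1/2)`, against the threshold factor `exp
-- 2`. Their quotient `2 exp (-3/2)` is at most `4/5`, well below `tailRatio`.
lemma card_upper_tail {q m : ℕ} (x y : Fin q → Bool) (h : x ≠ y) :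
    (#{b : Fin m → Fin q → Bool | 2 * (m * √(hammingDist x y)) < ∑ i, |distGap x y (b i)|} : ℝ) ≤
      2 ^ (m * q) * tailRatio ^ m := by
  have hh : (1 : ℝ) ≤ hammingDist x y := by exact_mod_cast hammingDist_pos.mpr h
  have hsq : 0 < √(hammingDist x y : ℝ) := Real.sqrt_pos.mpr (by linarith)
  have key := card_mul_exp_le m (fun c => (1 / √(hammingDist x y)) * |distGap x y c|)
    (2 * m) {b : Fin m → Fin q → Bool | 2 * (m * √(hammingDist x y)) <
      ∑ i, |distGap x y (b i)|} (by
      intro b hb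
      rw [Finset.mem_filter] at hb
      rw [← Finset.mul_sum]
      have : (1 / √(hammingDist x y)) * (2 * (m * √(hammingDist x y))) ≤
          (1 / √(hammingDist x y)) * ∑ i, |distGap x y (b i)| := by
        gcongr
        exact hb.2.le
      rwa [show (1 / √(hammingDist x y)) * (2 * (m * √(hammingDist x y))) = (2 * m : ℝ) by
        field_simp] at this)
  have hs := sum_exp_abs_distGap_le x y (1 / √(hammingDist x y))
  rw [← Real.exp_nat_mul, show (hammingDist x y : ℝ) * ((1 / √(hammingDist x y)) ^ 2 / 2) = 1 / 2 by
    rw [div_pow, Real.sq_sqrt (by linarith)]; field_simp] at hs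
  have hb := pow_le_pow_left₀ (Finset.sum_nonneg fun c _ => (Real.exp_pos _).le) hs m
  have hE : Real.exp (2 * m) = (Real.exp (1 / 2) * Real.exp (3 / 2)) ^ m := by
    rw [← Real.exp_add, ← Real.exp_nat_mul]; ring_nf
  have hexp : 5 / 2 ≤ Real.exp (3 / 2) := by
    have := Real.add_one_le_exp (3 / 2 : ℝ)
    linarith
  rw [hE] at key
  have e2 := Real.exp_pos (1 / 2)
  have hpos : (0 : ℝ) < (Real.exp (1 / 2) * (5 / 2)) ^ m := by positivity
  rw [← mul_le_mul_iff_left₀ hpos]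
  calc _ ≤ _ * (Real.exp (1 / 2) * Real.exp (3 / 2)) ^ m := by gcongr
    _ ≤ _ := key.trans hb
    _ ≤ _ := by
      have e3 : 2 * Real.exp (1 / 2) ≤ 38 / 39 * (Real.exp (1 / 2) * (5 / 2)) := by linarith
      rw [tailRatio, mul_assoc, ← mul_pow, mul_pow, ← pow_mul, mul_comm q m]
      exact mul_le_mul_of_nonneg_left (pow_le_pow_left₀ (by linarith) e3 m) (by positivity)

/-! ### From counting bit patterns to the coin measure -/

/-- The first `m * q` random bits, as `m` blocks of length `q`. -/
def bitBlocks (m q : ℕ) (ω : ℕ → Bool) (i : Fin m) (j : Fin q) : Bool := ω (i * q + j)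

open MeasureTheory in
-- Prescribing all blocks fixes each of the first `m * q` bits, and each contributes a factor `1/2`
-- to the product measure. An upper bound is all that the union bound needs.
lemma coinMeasure_bitBlocks_eq_le {m q : ℕ} (b : Fin m → Fin q → Bool) :
    coinMeasure {ω | bitBlocks m q ω = b} ≤ ENNReal.ofReal ((1 / 2) ^ (m * q)) := by
  have hinst : ∀ _ : ℕ, IsProbabilityMeasure ((PMF.uniformOfFintype Bool).toMeasure) :=
    fun _ => inferInstance
  -- Quantifying over all `i`, `j` with `i * q + j = t` describes the condition on bit `t` even
  -- where no quotient and remainder are at hand; below, `t / q` and `t % q` show that it leaves at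
  -- most one value.
  have hsub : {ω | bitBlocks m q ω = b} ⊆ Set.pi (Finset.range (m * q) : Set ℕ) (fun t =>
      {c : Bool | ∀ (i : Fin m) (j : Fin q), (i : ℕ) * q + j = t → c = b i j}) := by
    intro ω hω t _ i j hij
    have : bitBlocks m q ω i j = b i j := by rw [show bitBlocks m q ω = b from hω]
    rw [← this, bitBlocks, hij]
  refine (measure_mono hsub).trans ?_
  rw [coinMeasure, Measure.infinitePi_pi _ (fun _ _ => MeasurableSet.of_discrete)]
  rw [ENNReal.ofReal_pow (by norm_num), ← Finset.card_range (m * q), ← Finset.prod_const,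
    Finset.card_range]
  refine Finset.prod_le_prod' fun t ht => ?_
  obtain ⟨d1, d2, d3, _⟩ := div_mod_lt (Finset.mem_range.mp ht)
  have : {c : Bool | ∀ (i : Fin m) (j : Fin q), (i : ℕ) * q + j = t → c = b i j} ⊆
      {b ⟨t / q, d1⟩ ⟨t % q, d2⟩} := fun c hc => hc ⟨t / q, d1⟩ ⟨t % q, d2⟩ d3
  refine (measure_mono this).trans ?_
  rw [PMF.toMeasure_apply_singleton _ _ (MeasurableSet.singleton _)]
  simp [ENNReal.ofReal_inv_of_pos]

open MeasureTheory Finset in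
lemma coinMeasure_bitBlocks_mem_le {m q : ℕ} (S : Finset (Fin m → Fin q → Bool)) {ρ : ℝ}
    (hS : (#S : ℝ) ≤ 2 ^ (m * q) * ρ) :
    coinMeasure {ω | bitBlocks m q ω ∈ S} ≤ ENNReal.ofReal ρ := by
  have hU : {ω | bitBlocks m q ω ∈ S} = ⋃ b ∈ S, {ω | bitBlocks m q ω = b} := by
    ext ω; simp
  rw [hU]
  calc coinMeasure (⋃ b ∈ S, {ω | bitBlocks m q ω = b})
      ≤ ∑ b ∈ S, coinMeasure {ω | bitBlocks m q ω = b} := measure_biUnion_finset_le _ _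
    _ ≤ ∑ b ∈ S, ENNReal.ofReal ((1 / 2) ^ (m * q)) :=
        Finset.sum_le_sum fun b _ => coinMeasure_bitBlocks_eq_le b
    _ = ENNReal.ofReal (#S * (1 / 2) ^ (m * q)) := by
        rw [Finset.sum_const, nsmul_eq_mul, ENNReal.ofReal_mul (by positivity),
          ENNReal.ofReal_natCast]
    _ ≤ ENNReal.ofReal ρ := by
        refine ENNReal.ofReal_le_ofReal ?_
        calc (#S : ℝ) * (1 / 2) ^ (m * q) ≤ 2 ^ (m * q) * ρ * (1 / 2) ^ (m * q) := by gcongr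
          _ = ρ := by
            rw [mul_comm _ ρ, mul_assoc, ← mul_pow]; norm_num

lemma cast_absDiff (a b : ℕ) : (absDiff a b : ℝ) = |(a : ℝ) - b| := by
  unfold absDiff
  rcases le_total a b with h | h
  · rw [Nat.sub_eq_zero_of_le h, zero_add, Nat.cast_sub h, abs_sub_comm, abs_of_nonneg]
    simpa using h
  · rw [Nat.sub_eq_zero_of_le h, add_zero, Nat.cast_sub h, abs_of_nonneg]
    simpa using h

/-- The `v`-th point as a vector. -/
def pointVec (X : ℕ → ℕ → Bool) (q v : ℕ) (j : Fin q) : Bool := X v j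

/-- This links the program's estimate to the statistic of the tail bounds, with the bits read in the
order in which the program stores them. -/
lemma estDist_eq (ω : ℕ → Bool) (X : ℕ → ℕ → Bool) (m q u v : ℕ) :
    (estDist ω (fun v j => (X v j).toNat) m q u v : ℝ) =
      ∑ i, |distGap (pointVec X q u) (pointVec X q v) (bitBlocks m q ω i)| := by
  unfold estDist
  rw [Finset.sum_range]
  push_cast
  refine Finset.sum_congr rfl fun i _ => ?_
  rw [cast_absDiff, distGap, Finset.sum_sub_distrib, Finset.sum_range, Finset.sum_range]
  push_cast
  rfl

/-- The estimated distance of `u` and `v` is as it should be. -/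
def GoodPair (ω : ℕ → Bool) (X : ℕ → ℕ → Bool) (m q u v : ℕ) : Prop :=
  m * √(hammingDist (pointVec X q u) (pointVec X q v)) / 40 ≤
      estDist ω (fun v j => (X v j).toNat) m q u v ∧
    estDist ω (fun v j => (X v j).toNat) m q u v ≤
      2 * (m * √(hammingDist (pointVec X q u) (pointVec X q v)))

open MeasureTheory in
-- Equal points need no probability, as all quantities vanish; otherwise failure lies in the union
-- of the two tails, hence the factor `2`.
lemma coinMeasure_not_goodPair_le (X : ℕ → ℕ → Bool) (m q u v : ℕ) :
    coinMeasure {ω | ¬ GoodPair ω X m q u v} ≤ ENNReal.ofReal (2 * tailRatio ^ m) := by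
  by_cases h : pointVec X q u = pointVec X q v
  · have : {ω | ¬ GoodPair ω X m q u v} = ∅ := by
      ext ω
      simp [GoodPair, estDist_eq, h, distGap]
    rw [this]
    simp
  · have hsub : {ω | ¬ GoodPair ω X m q u v} ⊆
        {ω | bitBlocks m q ω ∈ Finset.univ.filter fun b : Fin m → Fin q → Bool =>
          ∑ i, |distGap (pointVec X q u) (pointVec X q v) (b i)| <
            m * √(hammingDist (pointVec X q u) (pointVec X q v)) / 40} ∪
        {ω | bitBlocks m q ω ∈ Finset.univ.filter fun b : Fin m → Fin q → Bool =>
          2 * (m * √(hammingDist (pointVec X q u) (pointVec X q v))) <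
            ∑ i, |distGap (pointVec X q u) (pointVec X q v) (b i)|} := by
      intro ω hω
      simp only [GoodPair, estDist_eq, Set.mem_ofPred_eq, not_and_or, not_le] at hω
      simpa using hω
    have hρ : (0 : ℝ) ≤ tailRatio ^ m := by unfold tailRatio; positivity
    refine (measure_mono hsub).trans ((measure_union_le _ _).trans ?_)
    rw [two_mul (tailRatio ^ m), ENNReal.ofReal_add hρ hρ]
    exact add_le_add (coinMeasure_bitBlocks_mem_le _ (card_lower_tail _ _ h))
      (coinMeasure_bitBlocks_mem_le _ (card_upper_tail _ _ h))

open MeasureTheory in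
/-- All estimated distances are as they should be, except with small probability. -/
lemma coinMeasure_exists_not_goodPair_le (X : ℕ → ℕ → Bool) (m q n : ℕ) :
    coinMeasure {ω | ¬ ∀ u < n, ∀ v < n, GoodPair ω X m q u v} ≤
      ENNReal.ofReal (n ^ 2 * (2 * tailRatio ^ m)) := by
  have hU : {ω | ¬ ∀ u < n, ∀ v < n, GoodPair ω X m q u v} ⊆
      ⋃ z ∈ Finset.range n ×ˢ Finset.range n, {ω | ¬ GoodPair ω X m q z.1 z.2} := by
    intro ω hω
    simp only [Set.mem_ofPred_eq] at hω
    push Not at hω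
    obtain ⟨u, hu, v, hv, h⟩ := hω
    simp only [Set.mem_iUnion]
    exact ⟨(u, v), by simp [hu, hv], h⟩
  have hρ : (0 : ℝ) ≤ 2 * tailRatio ^ m := by unfold tailRatio; positivity
  refine (measure_mono hU).trans ((measure_biUnion_finset_le _ _).trans ?_)
  refine (Finset.sum_le_sum fun z _ => coinMeasure_not_goodPair_le X m q z.1 z.2).trans ?_
  have e : ((n * n : ℕ) : ENNReal) = ENNReal.ofReal (n ^ 2) := by
    rw [← ENNReal.ofReal_natCast]
    push_cast
    rw [pow_two]
  rw [Finset.sum_const, Finset.card_product, Finset.card_range, nsmul_eq_mul, e,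
    ← ENNReal.ofReal_mul (by positivity)]

/-! ## The radius of the clusters -/

/-- Both infima are over nonempty index types with values in the natural numbers, so they are
attained; `1 ≤ k` is what makes the inner index type nonempty. -/
lemma exists_centers {n d k : ℕ} (P : Fin n → Fin d → Bool) (hk : 1 ≤ k) :
    ∃ T : Fin k → Fin d → Bool, ∀ v, ∃ u, hammingDist (P v) (T u) ≤ kCenterRadius P k := by
  have : Nonempty (Fin k) := ⟨⟨0, hk⟩⟩
  obtain ⟨T, hT⟩ := ciInf_mem
    (fun T : Fin k → Fin d → Bool => ⨆ v : Fin n, ⨅ u : Fin k, hammingDist (P v) (T u))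
  refine ⟨T, fun v => ?_⟩
  obtain ⟨u, hu⟩ := ciInf_mem (fun u : Fin k => hammingDist (P v) (T u))
  refine ⟨u, ?_⟩
  simp only at hu hT
  rw [hu, kCenterRadius, ← hT]
  exact le_ciSup (f := fun v : Fin n => ⨅ u : Fin k, hammingDist (P v) (T u))
    (Set.finite_range _).bddAbove v

/-- The clusters have radius at most `12800` times the optimum if the estimated distances are good. -/
lemma FarthestPoint.hammingDist_le {ω : ℕ → Bool} {X : ℕ → ℕ → Bool} {m q n lo sz clo kk Λ : ℕ}
    {ctr cl : ℕ → ℕ}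
    (h : FarthestPoint (estDist ω (fun v j => (X v j).toNat) m q) lo sz clo kk ctr cl)
    (hn : lo + sz ≤ n) (hm : 0 < m) (hG : ∀ u < n, ∀ v < n, GoodPair ω X m q u v)
    (hT : ∃ T : Fin kk → Fin q → Bool, ∀ v, lo ≤ v → v < lo + sz →
      ∃ u, hammingDist (pointVec X q v) (T u) ≤ Λ) {v : ℕ} (hv : v < sz) :
    hammingDist (pointVec X q (lo + v)) (pointVec X q (ctr (cl (lo + v)))) ≤ 12800 * Λ := by
  obtain ⟨T, hT⟩ := hT
  obtain ⟨R, far, f1, f2, f3, f4, f5⟩ := h.radius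
  obtain ⟨c, hc, hcl⟩ := h.cl_mem v hv
  have : Nonempty (Fin kk) := ⟨⟨c, hc⟩⟩
  choose! g hg using hT
  -- The `kk` centers together with `far` are `kk + 1` indexed points, one more than the optimal
  -- centers available to them.
  set pt : ℕ → ℕ := fun e => if e < kk then ctr (clo + e) else far with hpt
  have hmem : ∀ e, lo ≤ pt e ∧ pt e < lo + sz := by
    intro e
    by_cases he : e < kk
    · simp only [hpt, if_pos he]; exact h.ctr_mem e he
    · simp only [hpt, if_neg he]; exact ⟨f1, f2⟩
  -- By the pigeonhole principle two of them have the same nearby optimal center.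
  obtain ⟨e, e', hne, he⟩ := Fintype.exists_ne_map_eq_of_card_lt
    (fun e : Fin (kk + 1) => g (pt e)) (by simp)
  obtain ⟨a, b, ha, hb, hab, hR⟩ : ∃ a b, (lo ≤ a ∧ a < lo + sz) ∧ (lo ≤ b ∧ b < lo + sz) ∧
      g a = g b ∧ R ≤ estDist ω (fun v j => (X v j).toNat) m q a b := by
    have key : ∀ e e' : Fin (kk + 1), e' < e → g (pt e) = g (pt e') →
        ∃ a b, (lo ≤ a ∧ a < lo + sz) ∧ (lo ≤ b ∧ b < lo + sz) ∧
        g a = g b ∧ R ≤ estDist ω (fun v j => (X v j).toNat) m q a b := by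
      intro e e' hlt he
      refine ⟨pt e, pt e', hmem e, hmem e', he, ?_⟩
      have h1 : (e' : ℕ) < kk := by have := e.2; omega
      by_cases h2 : (e : ℕ) < kk
      · simp only [hpt, if_pos h1, if_pos h2]
        exact f5 e h2 e' hlt
      · simp only [hpt, if_pos h1, if_neg h2]
        exact f4 e' h1
    rcases lt_or_gt_of_ne hne with hlt | hlt
    · exact key e' e hlt he.symm
    · exact key e e' hlt he
  have h2Λ : hammingDist (pointVec X q a) (pointVec X q b) ≤ 2 * Λ := by
    have h1 := hg a ha.1 ha.2
    have h2 := hg b hb.1 hb.2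
    rw [hab] at h1
    have := hammingDist_triangle_right (pointVec X q a) (pointVec X q b) (T (g b))
    omega
  have hctr := (h.ctr_mem c hc).2
  rw [← hcl] at hctr
  set D := hammingDist (pointVec X q (lo + v)) (pointVec X q (ctr (cl (lo + v))))
  have i1 := (hG (lo + v) (by omega) _ (by omega : ctr (cl (lo + v)) < n)).1
  have i2 := (hG a (by omega) b (by omega)).2
  have i3 : (estDist ω (fun v j => (X v j).toNat) m q (lo + v) (ctr (cl (lo + v))) : ℝ) ≤
      estDist ω (fun v j => (X v j).toNat) m q a b := by exact_mod_cast (f3 v hv).trans hR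
  have i4 : √(hammingDist (pointVec X q a) (pointVec X q b) : ℝ) ≤ √(2 * Λ) :=
    Real.sqrt_le_sqrt (by exact_mod_cast h2Λ)
  have hm' : (0 : ℝ) < m := by exact_mod_cast hm
  -- The factor `80` combines the lower distortion `1/40` with the upper distortion `2`; squaring
  -- gives `80² * 2 = 12800`.
  have i5 : (m : ℝ) * √D ≤ m * (80 * √(2 * Λ)) := by
    have : (m : ℝ) * √(hammingDist (pointVec X q a) (pointVec X q b) : ℝ) ≤ m * √(2 * Λ) := by
      gcongr
    change (m : ℝ) * √D / 40 ≤ _ at i1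
    linarith
  have i6 : √D ≤ 80 * √(2 * Λ) := le_of_mul_le_mul_left i5 hm'
  have i7 : (D : ℝ) ≤ 12800 * Λ := by
    have h1 := pow_le_pow_left₀ (Real.sqrt_nonneg _) i6 2
    rw [mul_pow, Real.sq_sqrt (by positivity), Real.sq_sqrt (by positivity)] at h1
    linarith
  exact_mod_cast i7

/-! ## The time bound -/

/-- For `p ≤ r` and `2 ≤ r` one has `log (p + r) ≤ 2 log r`, which settles all terms except the one
with `l * p`. The summand `p * r` on the right is needed when `p = r = 1`, where the logarithms
there vanish. -/
lemma log_mul_le_of_le {p q r l k : ℕ} (hl : 1 ≤ l) (hlp : l ≤ p) (hk : 1 ≤ k)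
    (hkr : k ≤ r) (hpr : p ≤ r) :
    Real.log (p + r) * ((p + r) * (q + 1) + l * p + k * r) ≤
      10 * (p * Real.log p * (q + l) + r * Real.log r * (q + k) + l * q * k + p * r) := by
  have p1 : (1 : ℝ) ≤ p := by exact_mod_cast hl.trans hlp
  have r1 : (1 : ℝ) ≤ r := by exact_mod_cast hk.trans hkr
  have l1 : (1 : ℝ) ≤ l := by exact_mod_cast hl
  have k1 : (1 : ℝ) ≤ k := by exact_mod_cast hk
  have hlp' : (l : ℝ) ≤ p := by exact_mod_cast hlp
  have hpr' : (p : ℝ) ≤ r := by exact_mod_cast hpr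
  have q0 : (0 : ℝ) ≤ q := by positivity
  have lp0 : 0 ≤ Real.log p := Real.log_nonneg p1
  have lr0 : 0 ≤ Real.log r := Real.log_nonneg r1
  rcases Nat.lt_or_ge r 2 with hr | hr
  · obtain rfl : r = 1 := by omega
    obtain rfl : p = 1 := by omega
    obtain rfl : l = 1 := by omega
    obtain rfl : k = 1 := by omega
    have h2 : Real.log (1 + 1) ≤ 1 := by
      have := Real.log_le_sub_one_of_pos (x := 1 + 1) (by norm_num)
      linarith
    have h0 : 0 ≤ Real.log (1 + 1) := Real.log_nonneg (by norm_num)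
    simp only [Nat.cast_one, Real.log_one]
    nlinarith
  · have hr' : (2 : ℝ) ≤ r := by exact_mod_cast hr
    have hlog : Real.log (p + r) ≤ 2 * Real.log r := by
      rw [two_mul, ← Real.log_mul (by linarith) (by linarith)]
      exact Real.log_le_log (by linarith) (by nlinarith)
    have t1 : Real.log (p + r) * ((p + r) * (q + 1)) ≤ 4 * (r * Real.log r * (q + k)) := by
      calc Real.log (p + r) * ((p + r) * (q + 1)) ≤ 2 * Real.log r * ((r + r) * (q + k)) := by
            gcongr
        _ = _ := by ring
    have t2 : Real.log (p + r) * (k * r) ≤ 2 * (r * Real.log r * (q + k)) := by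
      calc Real.log (p + r) * (k * r) ≤ 2 * Real.log r * ((q + k) * r) := by
            gcongr
            linarith
        _ = _ := by ring
    have t3 : Real.log (p + r) * (l * p) ≤
        4 * (p * Real.log p * (q + l)) + 4 * (r * Real.log r * (q + k)) := by
      have n1 : 0 ≤ p * Real.log p * (q + l) := by positivity
      have n2 : 0 ≤ r * Real.log r * (q + k) := by positivity
      -- If `r ≤ p²`, then `log r ≤ 2 log p` and the row term pays. Otherwise `l * p ≤ p² ≤ r`, so
      -- the column term pays.
      rcases le_total (r : ℝ) (p ^ 2) with h | h
      · have : Real.log r ≤ 2 * Real.log p := by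
          have := Real.log_le_log (by linarith) h
          rwa [Real.log_pow, Nat.cast_ofNat] at this
        calc Real.log (p + r) * (l * p) ≤ 2 * (2 * Real.log p) * ((q + l) * p) := by
              gcongr
              · linarith
              · linarith
          _ = 4 * (p * Real.log p * (q + l)) := by ring
          _ ≤ _ := by linarith
      · have hle : (l : ℝ) * p ≤ r * (q + k) := by
          calc (l : ℝ) * p ≤ p * p := by gcongr
            _ = p ^ 2 := by ring
            _ ≤ r * 1 := by linarith
            _ ≤ r * (q + k) := by gcongr; linarith
        calc Real.log (p + r) * (l * p) ≤ 2 * Real.log r * (r * (q + k)) :=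
              mul_le_mul hlog hle (by positivity) (by positivity)
          _ = 2 * (r * Real.log r * (q + k)) := by ring
          _ ≤ _ := by linarith
    have n1 : 0 ≤ p * Real.log p * (q + l) := by positivity
    have n3 : 0 ≤ (l : ℝ) * q * k + p * r := by positivity
    nlinarith

lemma log_mul_le {p q r l k : ℕ} (hl : 1 ≤ l) (hlp : l ≤ p) (hk : 1 ≤ k) (hkr : k ≤ r) :
    Real.log (p + r) * ((p + r) * (q + 1) + l * p + k * r) ≤
      10 * (p * Real.log p * (q + l) + r * Real.log r * (q + k) + l * q * k + p * r) := by
  rcases le_total p r with h | h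
  · exact log_mul_le_of_le hl hlp hk hkr h
  · have := log_mul_le_of_le (q := q) hk hkr hl hlp h
    rw [add_comm (r : ℝ)] at this
    linarith

lemma log_two_bounds : 2 / 3 ≤ Real.log 2 ∧ Real.log 2 ≤ 1 := by
  have h1 := Real.log_two_gt_d9
  have h2 := Real.log_two_lt_d9
  constructor <;> linarith

/-- Taking logarithms gives `τ log 2 ≤ log 2 + log n ≤ 2 log n`, and `log 2 ≥ 2/3`. -/
lemma le_log_of_two_pow_lt {τ n : ℕ} (hn : 2 ≤ n) (h : 2 ^ τ < 2 * n) :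
    (τ : ℝ) ≤ 3 * Real.log n := by
  obtain ⟨h1, h2⟩ := log_two_bounds
  have hn' : (2 : ℝ) ≤ n := by exact_mod_cast hn
  have h3 : Real.log (2 ^ τ) ≤ Real.log (2 * n) :=
    Real.log_le_log (by positivity) (by exact_mod_cast h.le)
  rw [Real.log_pow, Real.log_mul (by norm_num) (by linarith)] at h3
  have h4 : Real.log 2 ≤ Real.log n := Real.log_le_log (by norm_num) hn'
  nlinarith [Nat.cast_nonneg (α := ℝ) τ]

lemma log_le_of_le_two_pow {τ n : ℕ} (hn : 1 ≤ n) (h : n ≤ 2 ^ τ) : Real.log n ≤ τ := by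
  obtain ⟨h1, h2⟩ := log_two_bounds
  have h3 : Real.log n ≤ Real.log (2 ^ τ) :=
    Real.log_le_log (by exact_mod_cast hn) (by exact_mod_cast h)
  rw [Real.log_pow] at h3
  nlinarith [Nat.cast_nonneg (α := ℝ) τ]

/-- The failure probability is small enough. -/
lemma failure_le {α : ℝ} {C τ n : ℕ} (hC : 39 * (α + 3) ≤ C) (hn : 2 ≤ n)
    (h : n ≤ 2 ^ τ) : (n : ℝ) ^ 2 * (2 * tailRatio ^ (C * τ)) ≤ 1 / (n : ℝ) ^ α := by
  have hn' : (2 : ℝ) ≤ n := by exact_mod_cast hn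
  have h1 := log_le_of_le_two_pow (by omega) h
  have h0 : 0 ≤ Real.log n := Real.log_nonneg (by linarith)
  -- As `tailRatio = 1 - 1/39`, the choice of `C` makes its power at most `n ^ (-(α + 3))`. Two of
  -- the three spare factors `n` pay for the pairs, the third for the constant `2`.
  have hr : tailRatio ≤ Real.exp (-(1 / 39)) := by
    have := Real.add_one_le_exp (-(1 / 39) : ℝ)
    unfold tailRatio; linarith
  have hpow : tailRatio ^ (C * τ) ≤ Real.exp (-((α + 3) * Real.log n)) := by
    calc tailRatio ^ (C * τ) ≤ Real.exp (-(1 / 39)) ^ (C * τ) :=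
          pow_le_pow_left₀ (by unfold tailRatio; norm_num) hr _
      _ = Real.exp (-((C : ℝ) / 39 * τ)) := by
          rw [← Real.exp_nat_mul]; push_cast; ring_nf
      _ ≤ _ := by
          refine Real.exp_le_exp.mpr (neg_le_neg ?_)
          have : α + 3 ≤ (C : ℝ) / 39 := by linarith
          exact mul_le_mul this h1 h0 (by positivity)
  have e1 : Real.exp (-((α + 3) * Real.log n)) = (n : ℝ) ^ (-(α + 3)) := by
    rw [Real.rpow_def_of_pos (by linarith)]; ring_nf
  have e2 : (n : ℝ) ^ (-(α + 3)) = 1 / ((n : ℝ) ^ α * n ^ 3) := by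
    rw [Real.rpow_neg (by linarith), Real.rpow_add (by linarith), one_div]
    norm_cast
  rw [e1, e2] at hpow
  have hp : 0 < (n : ℝ) ^ α := Real.rpow_pos_of_pos (by linarith) _
  calc (n : ℝ) ^ 2 * (2 * tailRatio ^ (C * τ))
      ≤ (n : ℝ) ^ 2 * (n * (1 / ((n : ℝ) ^ α * n ^ 3))) := by gcongr; unfold tailRatio; norm_num
    _ = 1 / (n : ℝ) ^ α := by field_simp

/-! ## The program and its analysis -/

/-- The instructions that compute the boundaries of the memory areas. -/
def prologue : List Instr :=
  [.const 41 1, .arith .mul 42 0 1, .arith .mul 43 1 2, .arith .add 43 42 43,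
    .arith .mul 44 0 2, .arith .add 44 43 44]

/-- The program. -/
def program (C : ℕ) : Program := prologue ++ (mainStmt C).code 6

/-- The factor in the word length. -/
def wordFactor (C : ℕ) : ℕ := 2 + (16 * (2 * C + 11) ^ 2 + 20)

/-- The memory layout for an input. -/
def layout (C p q r : ℕ) : Layout where
  w := wordLength (wordFactor C) p q r
  b1 := p * q
  b2 := p * q + q * r
  W := p * q + q * r + p * r
  L := (C * (p + r) + C + (p + r) + 5 * q + 10) ^ 2

/-- With `S = p + q + r` and `D = 16 * (2 * C + 11) ^ 2 + 20`, the memory in use is at most `S² *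
D`. Here `S²` costs two times the length of `S` in bits, and `D ≤ 2 ^ D` costs at most `D` times
that length, so `2 + D` times the length suffices. -/
lemma layout_ok {C p q r : ℕ} (hp : 1 ≤ p) (hr : 1 ≤ r) : (layout C p q r).Ok where
  h1 := Nat.le_add_right _ _
  h2 := Nat.le_add_right _ _
  h3 := by
    simp only [layout, wordLength, wordFactor]
    set S := p + q + r with hS
    have hsize : S ≤ 2 ^ Nat.size S := (Nat.lt_size_self S).le
    have e1 : C * (p + r) + C + (p + r) + 5 * q + 10 ≤ (2 * C + 11) * S := by
      have : C * (p + r) ≤ C * S := Nat.mul_le_mul_left _ (by omega)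
      have : C ≤ C * S := Nat.le_mul_of_pos_right _ (by omega)
      have : (2 * C + 11) * S = C * S + C * S + 11 * S := by ring
      omega
    have e2 : (C * (p + r) + C + (p + r) + 5 * q + 10) ^ 2 ≤ (2 * C + 11) ^ 2 * S ^ 2 := by
      rw [← mul_pow]; exact Nat.pow_le_pow_left e1 2
    have e3 : p * q + q * r + p * r ≤ S ^ 2 := by
      have : S ^ 2 = p * q + q * r + p * r +
        (p * q + q * r + p * r + p ^ 2 + q ^ 2 + r ^ 2) := by rw [hS]; ring
      omega
    have e4 : 1 ≤ S ^ 2 := Nat.one_le_pow _ _ (by omega)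
    obtain ⟨D, hD⟩ : ∃ D, D = 16 * (2 * C + 11) ^ 2 + 20 := ⟨_, rfl⟩
    have e5 : 16 * ((2 * C + 11) ^ 2 * S ^ 2) + S ^ 2 + 16 * S ^ 2 ≤ S ^ 2 * D := by
      rw [hD]; nlinarith
    have e6 : S ^ 2 * D ≤ 2 ^ ((2 + D) * Nat.size S) := by
      rw [add_mul, pow_add]
      refine Nat.mul_le_mul ?_ ?_
      · rw [mul_comm, pow_mul]; exact Nat.pow_le_pow_left hsize 2
      · have h1 : 1 ≤ Nat.size S := Nat.size_pos.mpr (by omega)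
        exact Nat.lt_two_pow_self.le.trans
          (Nat.pow_le_pow_right (by omega) (Nat.le_mul_of_pos_right _ h1))
    rw [← hD]
    omega
  h4 := by
    simp only [layout]
    calc 100 = 10 ^ 2 := by norm_num
      _ ≤ _ := Nat.pow_le_pow_left (by omega) 2

/-! ### The program on a fixed input -/

section

variable {p q r : ℕ} (A : Matrix (Fin p) (Fin q) Bool) (B : Matrix (Fin q) (Fin r) Bool)

/-- The structured state after the prologue. -/
def startState (C l k : ℕ) : St where
  var n := [p, q, r, l, k].getD n 0
  arr a i := inputMem A B ((layout C p q r).addr a i)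
  used := 0
  time := 0

/-- Register `40` is zero from the start and never written, and the prologue leaves memory alone.
The arrays of the structured state are therefore just the input memory read through the layout. -/
lemma prologue_rel {C l k : ℕ} {ω : ℕ → Bool} (hp : 1 ≤ p) (hr : 1 ≤ r) :
    Rel (layout C p q r)
      ((program C).run (wordLength (wordFactor C) p q r) ω (inputConfig A B l k) 6)
      (startState A B C l k) ∧
    ((program C).run (wordLength (wordFactor C) p q r) ω (inputConfig A B l k) 6).pc = 6 := by
  have hok := layout_ok (C := C) (q := q) hp hr
  have h3 : 16 * (layout C p q r).L + (p * q + q * r + p * r) + 16 ≤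
    2 ^ wordLength (wordFactor C) p q r := hok.h3
  have h4 := hok.h4
  set M := 2 ^ wordLength (wordFactor C) p q r with hM
  have c0 : CodeAt (program C) 0 prologue := ⟨[], (mainStmt C).code 6, rfl, rfl⟩
  unfold prologue at c0
  have c1 := c0.tail
  have c2 := c1.tail
  have c3 := c2.tail
  have c4 := c3.tail
  have c5 := c4.tail
  set w := wordLength (wordFactor C) p q r
  set s := inputConfig A B l k with hs
  have s0 : s.pc = 0 := rfl
  have t1 := c0.step (w := w) (ω := ω) s0
  have t2 := c1.step (w := w) (ω := ω) (congrArg Config.pc t1 |>.trans (by simp [Instr.exec, s0]))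
  have t3 := c2.step (w := w) (ω := ω) (congrArg Config.pc t2 |>.trans (by
    rw [t1]; simp [Instr.exec, s0]))
  have t4 := c3.step (w := w) (ω := ω) (congrArg Config.pc t3 |>.trans (by
    rw [t2, t1]; simp [Instr.exec, s0]))
  have t5 := c4.step (w := w) (ω := ω) (congrArg Config.pc t4 |>.trans (by
    rw [t3, t2, t1]; simp [Instr.exec, s0]))
  have t6 := c5.step (w := w) (ω := ω) (congrArg Config.pc t5 |>.trans (by
    rw [t4, t3, t2, t1]; simp [Instr.exec, s0]))
  have hrun : (program C).run w ω s 6 = (program C).step w ω ((program C).step w ω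
    ((program C).step w ω ((program C).step w ω ((program C).step w ω
      ((program C).step w ω s))))) := rfl
  rw [hrun, t6, t5, t4, t3, t2, t1]
  have r0 : s.reg 0 = p := rfl
  have r1 : s.reg 1 = q := rfl
  have r2 : s.reg 2 = r := rfl
  have m0 : 1 % M = 1 := Nat.mod_eq_of_lt (by omega)
  have m1 : p * q % M = p * q := Nat.mod_eq_of_lt (by omega)
  have m2 : q * r % M = q * r := Nat.mod_eq_of_lt (by omega)
  have m3 : (p * q + q * r) % M = p * q + q * r := Nat.mod_eq_of_lt (by omega)
  have m4 : p * r % M = p * r := Nat.mod_eq_of_lt (by omega)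
  have m5 : (p * q + q * r + p * r) % M = p * q + q * r + p * r := Nat.mod_eq_of_lt (by omega)
  refine ⟨⟨?_, ?_, ?_, ?_, ?_, ?_, ?_, ?_⟩, ?_⟩
  · intro x hx
    have n1 : x ≠ 41 := by omega
    have n2 : x ≠ 42 := by omega
    have n3 : x ≠ 43 := by omega
    have n4 : x ≠ 44 := by omega
    simp only [Instr.exec, ne_eq, n1, n2, n3, n4, not_false_eq_true, Function.update_of_ne]
    rfl
  · simp [Instr.exec, hs, inputConfig]
  · simp [Instr.exec, ← hM, m0]
  · simp [Instr.exec, ArithOp.apply, ← hM, r0, r1, r2, m0, m1, m2, m3, m4, m5, layout]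
  · simp [Instr.exec, ArithOp.apply, ← hM, r0, r1, r2, m0, m1, m2, m3, m4, m5, layout]
  · simp [Instr.exec, ArithOp.apply, ← hM, r0, r1, r2, m0, m1, m2, m3, m4, m5, layout]
  · intro a i _ _
    rfl
  · rfl
  · simp [Instr.exec, s0]

/-- The rows of the first matrix, followed by the columns of the second one. -/
def points (v j : ℕ) : Bool :=
  if hj : j < q then
    if hv : v < p then A ⟨v, hv⟩ ⟨j, hj⟩
    else if hv : v - p < r then B ⟨j, hj⟩ ⟨v - p, hv⟩ else false
  else false

lemma startState_arr_zero {C l k v j : ℕ} (hv : v < p) (hj : j < q) :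
    (startState A B C l k).arr 0 (v * q + j) = (points A B v j).toNat := by
  have h := add_mul_lt hv hj
  have ev : (v * q + j) / q = v := by
    rw [mul_comm, Nat.mul_add_div (by omega), Nat.div_eq_of_lt hj, add_zero]
  have em : (v * q + j) % q = j := by
    rw [mul_comm, Nat.mul_add_mod, Nat.mod_eq_of_lt hj]
  have ea : (layout C p q r).addr 0 (v * q + j) = v * q + j := by
    simp [Layout.addr, stride, offs, Layout.base]
  simp only [startState, ea, inputMem, dif_pos h, points, dif_pos hv, dif_pos hj]
  congr 2
  · exact Fin.ext ev
  · exact Fin.ext em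

lemma startState_arr_one {C l k v j : ℕ} (hv : v < r) (hj : j < q) :
    (startState A B C l k).arr 1 (j * r + v) = (points A B (p + v) j).toNat := by
  have h := add_mul_lt hj hv
  have ev : (j * r + v) / r = j := by
    rw [mul_comm, Nat.mul_add_div (by omega), Nat.div_eq_of_lt hv, add_zero]
  have em : (j * r + v) % r = v := by
    rw [mul_comm, Nat.mul_add_mod, Nat.mod_eq_of_lt hv]
  have ea : (layout C p q r).addr 1 (j * r + v) = j * r + v + p * q := by
    simp [Layout.addr, stride, offs, Layout.base, layout]
  have e1 : ¬ j * r + v + p * q < p * q := by omega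
  have e2 : ¬ p + v < p := by omega
  have e3 : j * r + v + p * q - p * q = j * r + v := by omega
  have e4 : p + v - p = v := by omega
  simp only [startState, ea, inputMem, dif_neg e1, points, dif_neg e2, dif_pos hj, e3, e4,
    dif_pos h, dif_pos hv]
  congr 2
  · exact Fin.ext ev
  · exact Fin.ext em

/-- The run of the program: it halts with the product, and in the end the main program has achieved
what it should. -/
lemma program_run {C l k : ℕ} (ω : ℕ → Bool) (hl : 1 ≤ l) (hlp : l ≤ p) (hk : 1 ≤ k)
    (hkr : k ≤ r) : ∃ σ, MainPost ω C p q r l k (fun v j => (points A B v j).toNat)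
        (startState A B C l k) σ ∧
      (program C).Halted ((program C).run (wordLength (wordFactor C) p q r) ω
        (inputConfig A B l k) (6 + σ.time)) ∧
      HoldsOutput q ((program C).run (wordLength (wordFactor C) p q r) ω
        (inputConfig A B l k) (6 + σ.time)) (arithProduct A B) := by
  have hok := layout_ok (C := C) (q := q) (hl.trans hlp) (hk.trans hkr)
  obtain ⟨hR, hpc⟩ := prologue_rel A B (C := C) (l := l) (k := k) (ω := ω) (hl.trans hlp)
    (hk.trans hkr)
  have l1 : (layout C p q r).lim 1 = q * r := by simp [Layout.lim, layout]
  have l2 : (layout C p q r).lim 2 = p * r := by simp [Layout.lim, layout]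
  have hwp := wp_mainStmt (Γ := layout C p q r) (ω := ω) (s := startState A B C l k) (C := C)
    (p := p) (q := q) (r := r) (l := l) (k := k) (x := fun v j => (points A B v j).toNat) rfl rfl rfl rfl rfl rfl hl hlp hk hkr le_rfl rfl l1 l2
    (fun v j => Bool.toNat_le _) (fun v hv j hj => startState_arr_zero A B hv hj)
    (fun v hv j hj => startState_arr_one A B hv hj)
  have hc : CodeAt (program C) 6 ((mainStmt C).code 6) := ⟨prologue, [], by simp [program], rfl⟩
  obtain ⟨σ, t, hQ, ht, hR', hpc'⟩ := wp_sound hok hc hpc hR hwp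
  have htt : σ.time = t := by rw [ht]; exact zero_add t
  subst htt
  refine ⟨σ, hQ, ?_, ?_⟩
  · rw [run_add, Program.Halted]
    change _ ≤ (Program.run _ (layout C p q r).w _ _ _).pc
    rw [hpc', program, List.length_append]
    rfl
  · intro i j
    rw [run_add]
    have h1 := hR'.arr 2 (i * r + j) (by omega) (by rw [l2]; exact add_mul_lt i.2 j.2)
    have ea : (layout C p q r).addr 2 (i * r + j) = p * q + q * r + (i * r + j) := by
      simp [Layout.addr, stride, offs, Layout.base, layout, add_comm]
    rw [ea] at h1
    refine h1.trans ?_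
    rw [hQ.out i i.2 j j.2, Finset.sum_range, arithProduct, Matrix.mul_apply]
    refine Finset.sum_congr rfl fun z _ => ?_
    simp [points, Matrix.map_apply]

lemma pointVec_row (v : Fin p) : pointVec (points A B) q v = A v := by
  funext j
  simp [pointVec, points]

lemma pointVec_col (v : Fin r) : pointVec (points A B) q (p + v) = fun i => B i v := by
  funext j
  simp [pointVec, points]

lemma sum_ite_eq_hammingDist (X : ℕ → ℕ → Bool) (q u v : ℕ) :
    (∑ j ∈ Finset.range q, if (X u j).toNat = (X v j).toNat then 0 else 1) =
      hammingDist (pointVec X q u) (pointVec X q v) := by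
  rw [Finset.sum_range, hammingDist, Finset.card_filter]
  refine Finset.sum_congr rfl fun j _ => ?_
  unfold pointVec
  cases X u j <;> cases X v j <;> simp

/-- The arithmetic behind the time bound: `T` stands for the logarithm of the number of points and
`U` for the part of the bound that is not proportional to the size of the product. -/
lemma cost_le {C τ p q r l k Λ U T : ℝ} (C0 : 0 ≤ C) (τ1 : 1 ≤ τ) (p1 : 1 ≤ p) (q0 : 0 ≤ q)
    (r1 : 1 ≤ r) (l1 : 1 ≤ l) (k1 : 1 ≤ k) (hlp : l ≤ p) (hkr : k ≤ r) (Λ0 : 0 ≤ Λ)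
    (U0 : l * q * k ≤ U) (hτ : τ ≤ 3 * T)
    (hT : T * ((p + r) * (q + 1) + l * p + k * r) ≤ 10 * (U + p * r)) :
    306 + 200 * ((p + r) * (q + 1) + C * τ * q + (p + r) * (C * τ) * (q + 1) +
      l * p * (C * τ + 1) + k * r * (C * τ + 1) + l * k * (q + 1)) + p * r * (200 + 1280000 * Λ) ≤
      (2000000 + 12000 * (C + 1)) * (U + p * r * (1 + Λ)) := by
  obtain ⟨G, hG⟩ : ∃ G, G = (p + r) * (q + 1) + l * p + k * r := ⟨_, rfl⟩
  have G0 : 0 ≤ G := by rw [hG]; positivity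
  rw [← hG] at hT
  -- `G` collects the sizes that carry a logarithmic factor; every summand is at most a multiple of
  -- `(C + 1) * τ` times a part of `G`, and `τ ≤ 3 * T` brings in the hypothesis on `T * G`.
  have s1 : (p + r) * (q + 1) + C * τ * q + (p + r) * (C * τ) * (q + 1) +
      l * p * (C * τ + 1) + k * r * (C * τ + 1) ≤ 2 * ((C + 1) * τ) * G := by
    have a1 : C * τ + 1 ≤ (C + 1) * τ := by linarith
    have a2 : C * τ * q ≤ (C + 1) * τ * ((p + r) * (q + 1)) := by
      have : q ≤ (p + r) * (q + 1) := by nlinarith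
      have : C * τ ≤ (C + 1) * τ := by linarith
      gcongr
    have a3 : 0 ≤ (C + 1) * τ * (l * p + k * r) := by positivity
    have a4 : G * (C * τ + 1) ≤ G * ((C + 1) * τ) := by gcongr
    calc (p + r) * (q + 1) + C * τ * q + (p + r) * (C * τ) * (q + 1) +
          l * p * (C * τ + 1) + k * r * (C * τ + 1) = G * (C * τ + 1) + C * τ * q := by
          rw [hG]; ring
      _ ≤ G * ((C + 1) * τ) + (C + 1) * τ * ((p + r) * (q + 1)) := by linarith
      _ ≤ G * ((C + 1) * τ) + (C + 1) * τ * G := by rw [hG]; linarith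
      _ = _ := by ring
  have s2 : 2 * ((C + 1) * τ) * G ≤ 60 * (C + 1) * (U + p * r) := by
    calc 2 * ((C + 1) * τ) * G ≤ 2 * ((C + 1) * (3 * T)) * G := by gcongr
      _ = 6 * (C + 1) * (T * G) := by ring
      _ ≤ 6 * (C + 1) * (10 * (U + p * r)) := by gcongr
      _ = _ := by ring
  have s3 : l * k * (q + 1) ≤ U + p * r := by
    have : l * k ≤ p * r := by gcongr
    linarith
  obtain ⟨R, hR⟩ : ∃ R, R = p * r := ⟨_, rfl⟩
  have R1 : 1 ≤ R := by rw [hR]; nlinarith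
  rw [← hR] at s2 s3 ⊢
  have W0 : 0 ≤ R * Λ := by positivity
  have U1 : 0 ≤ U := le_trans (by positivity) U0
  have V0 : 0 ≤ C * (R * Λ) := by positivity
  have e : (2000000 + 12000 * (C + 1)) * (U + R * (1 + Λ)) =
      200 * (60 * (C + 1) * (U + R)) + 2000000 * (U + R + R * Λ) + 12000 * (R * Λ) +
        12000 * (C * (R * Λ)) := by ring
  rw [e]
  linarith

/-- If the estimated distances are good, the running time is bounded as it should be. -/
lemma time_le {C l k : ℕ} {ω : ℕ → Bool} (hC : 1 ≤ C) (hl : 1 ≤ l) (hlp : l ≤ p) (hk : 1 ≤ k)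
    (hkr : k ≤ r)
    (hG : ∀ τ, p + r ≤ 2 ^ τ → 2 ^ τ < 2 * (p + r) →
      ∀ u < p + r, ∀ v < p + r, GoodPair ω (points A B) (C * τ) q u v)
    {σ : St} (h : MainPost ω C p q r l k (fun v j => (points A B v j).toNat)
        (startState A B C l k) σ) :
    ((6 + σ.time : ℕ) : ℝ) ≤ (2000000 + 12000 * (C + 1)) * productTimeBound A B l k := by
  obtain ⟨τ, ctr, cl, cnt, h1, h2, FA, FB, hcnt, ht⟩ := h.clusters
  have hτ : 1 ≤ τ := by
    by_contra hτ
    obtain rfl : τ = 0 := by omega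
    rw [pow_zero] at h1
    omega
  have hm : 0 < C * τ := Nat.mul_pos hC hτ
  have hGτ := hG τ h1 h2
  have cA : ∀ v < p, cnt v ≤ 12800 * lambdaRow A l := by
    intro v hv
    rw [hcnt v (by omega), sum_ite_eq_hammingDist]
    have := FA.hammingDist_le (n := p + r) (Λ := lambdaRow A l) (by omega) hm hGτ (by
      obtain ⟨T, hT⟩ := exists_centers (fun i j => A i j) hl
      refine ⟨T, fun v _ hv => ?_⟩
      rw [zero_add] at hv
      have := pointVec_row A B ⟨v, hv⟩
      simp only at this
      rw [this]
      exact hT ⟨v, hv⟩) hv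
    simpa only [zero_add] using this
  have cB : ∀ v < r, cnt (p + v) ≤ 12800 * lambdaCol B k := by
    intro v hv
    rw [hcnt _ (by omega), sum_ite_eq_hammingDist]
    exact FB.hammingDist_le (n := p + r) (Λ := lambdaCol B k) (by omega) hm hGτ (by
      obtain ⟨T, hT⟩ := exists_centers (fun j i => B i j) hk
      refine ⟨T, fun v hv hv' => ?_⟩
      obtain ⟨v', rfl⟩ : ∃ v', v = p + v' := ⟨v - p, by omega⟩
      have hv'' : v' < r := by omega
      have := pointVec_col A B ⟨v', hv''⟩
      simp only at this
      rw [this]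
      exact hT ⟨v', hv''⟩) hv
  -- The coefficient is `100 * 12800`: steps per listed position times the loss in the cluster
  -- radius.
  have hsum : ∑ t ∈ Finset.range (p * r), (200 + 100 * cnt (t / r) + 100 * cnt (p + t % r)) ≤
      p * r * (200 + 1280000 * (lambdaRow A l + lambdaCol B k)) := by
    refine sum_range_le fun t ht => ?_
    obtain ⟨d1, d2, _, _⟩ := div_mod_lt ht
    have := cA _ d1
    have := cB _ d2
    omega
  -- The six steps of the prologue raise the constant from `300` to `306`.
  have ht' : 6 + σ.time ≤ 306 + 200 * ((p + r) * (q + 1) + C * τ * q +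
      (p + r) * (C * τ) * (q + 1) + l * p * (C * τ + 1) + k * r * (C * τ + 1) + l * k * (q + 1)) +
      p * r * (200 + 1280000 * (lambdaRow A l + lambdaCol B k)) := by
    have : (startState A B C l k).time = 0 := rfl
    omega
  have hlog := log_mul_le (q := q) hl hlp hk hkr
  have hτlog := le_log_of_two_pow_lt (n := p + r) (by omega) h2
  push_cast at hτlog
  have p1 : (1 : ℝ) ≤ p := by exact_mod_cast hl.trans hlp
  have r1 : (1 : ℝ) ≤ r := by exact_mod_cast hk.trans hkr
  have l1 : (1 : ℝ) ≤ l := by exact_mod_cast hl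
  have k1 : (1 : ℝ) ≤ k := by exact_mod_cast hk
  have hlp' : (l : ℝ) ≤ p := by exact_mod_cast hlp
  have hkr' : (k : ℝ) ≤ r := by exact_mod_cast hkr
  have τ1 : (1 : ℝ) ≤ τ := by exact_mod_cast hτ
  have C0 : (0 : ℝ) ≤ C := Nat.cast_nonneg _
  have q0 : (0 : ℝ) ≤ q := Nat.cast_nonneg _
  have lp0 : 0 ≤ Real.log p := Real.log_nonneg p1
  have lr0 : 0 ≤ Real.log r := Real.log_nonneg r1
  have hcast : ((6 + σ.time : ℕ) : ℝ) ≤ 306 + 200 * (((p : ℝ) + r) * (q + 1) + C * τ * q +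
      (p + r) * (C * τ) * (q + 1) + l * p * (C * τ + 1) + k * r * (C * τ + 1) + l * k * (q + 1)) +
      p * r * (200 + 1280000 * ((lambdaRow A l : ℝ) + lambdaCol B k)) := by
    have := (Nat.cast_le (α := ℝ)).mpr ht'
    push_cast at this ⊢
    exact this
  have hbound : productTimeBound A B l k =
      (p * Real.log p * (q + l) + r * Real.log r * (q + k) + l * q * k) +
        p * r * (1 + ((lambdaRow A l : ℝ) + lambdaCol B k)) := by
    rw [productTimeBound]; ring
  have U0 : 0 ≤ p * Real.log p * (q + l) + r * Real.log r * (q + k) := by positivity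
  rw [hbound]
  exact hcast.trans (cost_le C0 τ1 p1 q0 r1 l1 k1 hlp' hkr' (by positivity) (by linarith) hτlog hlog)

end

open MeasureTheory in
instance : IsProbabilityMeasure coinMeasure := by
  unfold coinMeasure
  infer_instance

end WordRam

open WordRam MeasureTheory in
theorem corollary2 (α : ℝ) (hα : 1 ≤ α) :
    ∃ (P : Program) (c : ℕ) (K : ℝ), ∀ (p q r l k : ℕ), 1 ≤ l → l ≤ p → 1 ≤ k → k ≤ r →
      ∀ (A : Matrix (Fin p) (Fin q) Bool) (B : Matrix (Fin q) (Fin r) Bool),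
        (∀ ω : ℕ → Bool, ∃ t : ℕ,
          P.Halted (P.run (wordLength c p q r) ω (inputConfig A B l k) t) ∧
          HoldsOutput q (P.run (wordLength c p q r) ω (inputConfig A B l k) t)
            (arithProduct A B)) ∧
        1 - 1 / ((p : ℝ) + r) ^ α ≤
          coinMeasure.real {ω : ℕ → Bool | ∃ t : ℕ,
            (t : ℝ) ≤ K * productTimeBound A B l k ∧
            P.Halted (P.run (wordLength c p q r) ω (inputConfig A B l k) t)} := by
  obtain ⟨C, hC⟩ := exists_nat_ge (39 * (α + 3))
  have hC1 : 1 ≤ C := by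
    have : (1 : ℝ) ≤ C := by linarith
    exact_mod_cast this
  refine ⟨program C, wordFactor C, 2000000 + 12000 * (C + 1), fun p q r l k hl hlp hk hkr A B =>
    ⟨fun ω => ?_, ?_⟩⟩
  · obtain ⟨σ, _, h1, h2⟩ := program_run A B (C := C) ω hl hlp hk hkr
    exact ⟨_, h1, h2⟩
  -- The bad event needs one value of `τ` for all `ω`. It is read off from the run on an arbitrary
  -- bit sequence; the two inequalities determine it, so it is the same for every other run.
  · obtain ⟨τ, h1, h2⟩ : ∃ τ, p + r ≤ 2 ^ τ ∧ 2 ^ τ < 2 * (p + r) := by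
      obtain ⟨σ, h, _⟩ := program_run A B (C := C) (fun _ => false) hl hlp hk hkr
      obtain ⟨τ, _, _, _, h1, h2, _⟩ := h.clusters
      exact ⟨τ, h1, h2⟩
    have huniq : ∀ τ', p + r ≤ 2 ^ τ' → 2 ^ τ' < 2 * (p + r) → τ' = τ := by
      intro τ' h1' h2'
      have a1 : 2 ^ τ' < 2 ^ (τ + 1) := by rw [pow_succ]; omega
      have a2 : 2 ^ τ < 2 ^ (τ' + 1) := by rw [pow_succ]; omega
      have := (Nat.pow_lt_pow_iff_right (by omega)).mp a1
      have := (Nat.pow_lt_pow_iff_right (by omega)).mp a2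
      omega
    set good := {ω : ℕ → Bool | ∃ t : ℕ,
            (t : ℝ) ≤ (2000000 + 12000 * (C + 1)) * productTimeBound A B l k ∧
            (program C).Halted ((program C).run (wordLength (wordFactor C) p q r) ω
              (inputConfig A B l k) t)}
    set bad := {ω : ℕ → Bool | ¬ ∀ u < p + r, ∀ v < p + r,
      GoodPair ω (points A B) (C * τ) q u v}
    have hcover : (Set.univ : Set (ℕ → Bool)) ⊆ good ∪ bad := by
      intro ω _
      by_cases hω : ∀ u < p + r, ∀ v < p + r, GoodPair ω (points A B) (C * τ) q u v
      · left
        obtain ⟨σ, h, hh, _⟩ := program_run A B (C := C) ω hl hlp hk hkr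
        exact ⟨_, time_le A B hC1 hl hlp hk hkr
          (fun τ' h1' h2' => by rw [huniq τ' h1' h2']; exact hω) h, hh⟩
      · right
        exact hω
    have hbad : coinMeasure.real bad ≤ 1 / ((p : ℝ) + r) ^ α := by
      have hb := coinMeasure_exists_not_goodPair_le (points A B) (C * τ) q (p + r)
      have hf := failure_le (α := α) hC (by omega) h1
      have h0 : (0 : ℝ) ≤ ((p + r : ℕ) : ℝ) ^ 2 * (2 * tailRatio ^ (C * τ)) := by
        unfold tailRatio; positivity
      push_cast at hf
      push_cast at h0
      push_cast at hb
      exact (ENNReal.toReal_le_of_le_ofReal h0 hb).trans hf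
    -- Covering the space and using subadditivity avoids any question of whether the two events are
    -- measurable.
    have htot : (1 : ℝ) ≤ coinMeasure.real good + coinMeasure.real bad := by
      calc (1 : ℝ) = coinMeasure.real Set.univ := by simp
        _ ≤ coinMeasure.real (good ∪ bad) := measureReal_mono hcover
        _ ≤ _ := measureReal_union_le _ _
    linarith
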